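/- Model. Let $\Sigma=\{0,1,\sharp\}$ and, for $A\subseteq\Sigma^*\times\Sigma^*$, let $A(x)=\{y : A(x,y)\}$. Machines are random access machines (RAM) whose registers hold integers, with addition, subtraction and multiplication and with output registers whose content is produced by a special OUTPUT instruction. An arithmetic instruction costs an amount linear in the bit size of its operands, any other instruction costs $O(1)$; the space used at a step is the sum of the bit sizes of the integers in the registers. A machine solves the problem $\mathrm{Enum}\cdot A$ if on every input $x$ it halts, produces every element of $A(x)$ exactly once and nothing else, and stops immediately after its last OUTPUT instruction. $T(M,x,i)$ is the total cost of the instructions that $M$ executes on input $x$ before its $i$-th OUTPUT instruction, and $T(M,x,0)=0$. All polynomials have coefficients in $\mathbb N$. Classes. $\mathrm{EnumP}$ is the class of problems $\mathrm{Enum}\cdot A$ such that $A(x,y)$ is decidable in polynomial time and every $y\in A(x)$ has size polynomial in $|x|$. A machine $M$ that solves $\mathrm{Enum}\cdot A$ is incremental linear if for some polynomial $h$ one has $T(M,x,k)\le k\,h(|x|)$ for all $x$ and all $k\le |A(x)|$; $\mathrm{IncP}_1$ is the class of problems in $\mathrm{EnumP}$ solved by an incremental linear machine. $M$ has polynomial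 delay if for some polynomial $d$ one has $T(M,x,t)-T(M,x,t-1)\le d(|x|)$ for all $x$ and all $0<t\le|A(x)|$. $M$ uses polynomial space if the space it uses at every step on input $x$ is at most $s(|x|)$ for some polynomial $s$. For a polynomial $p$, an index $i$ is a $p$-gap of $M$ on $x$ if $T(M,x,i+1)-T(M,x,i)>p(|x|)$. Proposition. Let $\mathrm{Enum}\cdot A\in\mathrm{IncP}_1$ and let $I$ be an incremental linear machine that solves $\mathrm{Enum}\cdot A$ and uses polynomial space. Assume that there are polynomials $p$ and $q$ such that for every $x$ and every $k$ with $1\le k\le|A(x)|$ there are integers $0\le a<b\le k$ such that $q(|x|)\,(b-a)>k$ and no index $i$ with $a\le i<b$ is a $p$-gap of $I$ on $x$. Then $\mathrm{Enum}\cdot A$ is in $\mathrm{DelayP}$ with polynomial space: it is in $\mathrm{EnumP}$ and some machine solves it with polynomial delay and polynomial space. -/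

import Mathlib

noncomputable section

namespace EnumRAM

/-! ### Words and binary predicates -/

/-- The alphabet `{0, 1, ♯}`; the letter `♯` is `2`. -/
abbrev Letter : Type := Fin 3

/-- Words over the alphabet; the size `|x|` of a word is its length. -/
abbrev Word : Type := List Letter

/-- A binary predicate on words, given by its sets of solutions: `A x = {y | A(x, y)}`. -/
abbrev Predicate : Type := Word → Set Word

/-! ### Random access machines

Registers hold integers. There are three banks of registers, each indexed by the natural numbers:
the input bank (which initially holds the input), the working bank, and the output bank (whose
content is produced by the `output` instruction). All three can be read and written. -/

/-- The three banks of registers. -/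
inductive Bank : Type
  | inp
  | work
  | out
  deriving DecidableEq

/-- A register: a bank and an address. -/
abbrev Reg : Type := Bank × ℕ

/-- The content of all the registers; all but finitely many of them hold `0`. -/
abbrev Memory : Type := Reg →₀ ℤ

/-- How an instruction designates a register: `dir b i` is register `i` of bank `b`, and `ind b i`
is the register of bank `b` whose address is the content of working register `i`. -/
inductive Loc : Type
  | dir (b : Bank) (i : ℕ)
  | ind (b : Bank) (i : ℕ)

/-- The register designated by a location (a negative address is read as the address `0`). -/
def Loc.reg (m : Memory) : Loc → Reg
  | .dir b i => (b, i)
  | .ind b i => (b, (m (Bank.work, i)).toNat)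

/-- A source of an instruction: an integer constant or the content of a register. -/
inductive Operand : Type
  | const (z : ℤ)
  | loc (l : Loc)

/-- The value of an operand. -/
def Operand.val (m : Memory) : Operand → ℤ
  | .const z => z
  | .loc l => m (l.reg m)

/-- The instructions, with explicit labels of the instructions that come next. -/
inductive Instr (L : Type) : Type
  /-- `dst := a` -/
  | move (dst : Loc) (a : Operand) (next : L)
  /-- `dst := a + b` -/
  | add (dst : Loc) (a b : Operand) (next : L)
  /-- `dst := a - b` -/
  | sub (dst : Loc) (a b : Operand) (next : L)
  /-- `dst := a * b` -/
  | mul (dst : Loc) (a b : Operand) (next : L)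
  /-- go to `yes` if `a = 0`, to `no` otherwise -/
  | ifZero (a : Operand) (yes no : L)
  /-- go to `yes` if `a > 0`, to `no` otherwise -/
  | ifPos (a : Operand) (yes no : L)
  /-- produce the content of the output registers -/
  | output (next : L)
  /-- stop -/
  | halt

/-- A random access machine: a finite program, that is an instruction for every element of a finite
set of labels, together with the label of the first instruction. -/
structure RAM where
  Label : Type
  [finite : Finite Label]
  start : Label
  prog : Label → Instr Label

/-- A configuration: the label of the instruction to be executed and the content of the
registers. -/
structure Cfg (L : Type) where
  label : L
  mem : Memory

/-- The number of bits of an integer (`0` for the integer `0`). -/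
def bits (z : ℤ) : ℕ := z.natAbs.size

/-- The space used by a configuration: the sum of the numbers of bits of the integers in the
registers. -/
def Cfg.space {L : Type} (c : Cfg L) : ℕ := c.mem.sum fun _ z => bits z

/-- A word as a list of integers: its length, followed by its letters. -/
def encode (x : Word) : List ℤ := (x.length : ℤ) :: x.map fun a => (a.val : ℤ)

/-- The memory whose input registers hold the given list, all other registers being `0`. -/
def load (w : List ℤ) : Memory :=
  Finsupp.onFinset ((Finset.range w.length).image fun i => (Bank.inp, i))
    (fun r => if r.1 = Bank.inp then w.getD r.2 0 else 0) (by
      rintro ⟨b, i⟩ h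
      by_cases hb : b = Bank.inp
      · subst hb
        simp only [Finset.mem_image, Finset.mem_range]
        refine ⟨i, ?_, rfl⟩
        by_contra hi
        exact h ((if_pos rfl).trans (List.getD_eq_default _ _ (not_lt.mp hi)))
      · exact absurd (if_neg hb) h)

/-- The letter that an output register stands for. -/
def decodeLetter (z : ℤ) : Letter := if z = 0 then 0 else if z = 1 then 1 else 2

/-- The word in the output registers: register `0` holds its length `ℓ`, the registers
`1, …, ℓ` hold its letters. -/
def outputWord (m : Memory) : Word :=
  (List.range (m (Bank.out, 0)).toNat).map fun i => decodeLetter (m (Bank.out, i + 1))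

namespace RAM

variable (M : RAM)

/-- The machine has stopped. -/
def Halted (c : Cfg M.Label) : Prop := M.prog c.label = Instr.halt

/-- The next instruction is an `output` instruction. -/
def AtOutput (c : Cfg M.Label) : Prop := ∃ l, M.prog c.label = Instr.output l

/-- One step of the machine; a configuration that has stopped does not change. -/
def step (c : Cfg M.Label) : Cfg M.Label :=
  match M.prog c.label with
  | .move dst a l => ⟨l, c.mem.update (dst.reg c.mem) (a.val c.mem)⟩
  | .add dst a b l => ⟨l, c.mem.update (dst.reg c.mem) (a.val c.mem + b.val c.mem)⟩
  | .sub dst a b l => ⟨l, c.mem.update (dst.reg c.mem) (a.val c.mem - b.val c.mem)⟩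
  | .mul dst a b l => ⟨l, c.mem.update (dst.reg c.mem) (a.val c.mem * b.val c.mem)⟩
  | .ifZero a yes no => ⟨if a.val c.mem = 0 then yes else no, c.mem⟩
  | .ifPos a yes no => ⟨if 0 < a.val c.mem then yes else no, c.mem⟩
  | .output l => ⟨l, c.mem⟩
  | .halt => c

/-- The cost of the next instruction: linear in the size of the inputs for arithmetic instructions,
constant for the others (and nothing once the machine has stopped). -/
def cost (c : Cfg M.Label) : ℕ :=
  match M.prog c.label with
  | .add _ a b _ => 1 + bits (a.val c.mem) + bits (b.val c.mem)
  | .sub _ a b _ => 1 + bits (a.val c.mem) + bits (b.val c.mem)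
  | .mul _ a b _ => 1 + bits (a.val c.mem) + bits (b.val c.mem)
  | .halt => 0
  | _ => 1

/-- The configuration after `t` steps, when the list `w` is initially in the input registers. -/
def conf (w : List ℤ) (t : ℕ) : Cfg M.Label := M.step^[t] ⟨M.start, load w⟩

/-- The total cost of the first `t` steps. -/
def elapsed (w : List ℤ) (t : ℕ) : ℕ := ∑ s ∈ Finset.range t, M.cost (M.conf w s)

/-- On input `x`, the step of index `t` executes an `output` instruction. -/
def OutputsAt (x : Word) (t : ℕ) : Prop := M.AtOutput (M.conf (encode x) t)

/-- On input `x`, the word in the output registers after `t` steps. -/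
def wordAt (x : Word) (t : ℕ) : Word := outputWord (M.conf (encode x) t).mem

/-- `T(M, x, i)`, the sum of the costs of the instructions executed before the `i`-th `output`
instruction (`i = 1, 2, …`) on input `x`, with `T(M, x, 0) = 0`. It is only meaningful when
at least `i` `output` instructions are executed. -/
def T (x : Word) : ℕ → ℕ
  | 0 => 0
  | i + 1 => M.elapsed (encode x) (Nat.nth (M.OutputsAt x) i)

/-- `M` solves the enumeration problem of `A`: on every input `x` it stops, it produces the elements
of `A x` and nothing else, each of them once, and it stops immediately after the last `output`
instruction. -/
structure Solves (A : Predicate) : Prop where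
  halts : ∀ x, ∃ t, M.Halted (M.conf (encode x) t)
  produces : ∀ x y, y ∈ A x ↔ ∃ t, M.OutputsAt x t ∧ M.wordAt x t = y
  distinct : ∀ x s t, M.OutputsAt x s → M.OutputsAt x t → M.wordAt x s = M.wordAt x t → s = t
  stops : ∀ x t, M.OutputsAt x t → (∀ s, t < s → ¬ M.OutputsAt x s) →
    M.Halted (M.conf (encode x) (t + 1))

/-- `M` uses polynomial space. -/
def PolySpace : Prop :=
  ∃ s : Polynomial ℕ, ∀ (x : Word) (t : ℕ), (M.conf (encode x) t).space ≤ s.eval x.length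

/-- `M` is an incremental linear algorithm for `A`: it solves `A` and there is a polynomial `h` such
that it produces `k` solutions in time at most `k * h(|x|)`. -/
def IncrementalLinear (A : Predicate) : Prop :=
  M.Solves A ∧ ∃ h : Polynomial ℕ, ∀ (x : Word) (k : ℕ), k ≤ (A x).ncard →
    M.T x k ≤ k * h.eval x.length

/-- `M` solves `A` with polynomial delay. -/
def PolyDelay (A : Predicate) : Prop :=
  M.Solves A ∧ ∃ d : Polynomial ℕ, ∀ (x : Word) (t : ℕ), t < (A x).ncard →
    M.T x (t + 1) ≤ M.T x t + d.eval x.length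

/-- The index `i` is a `p`-gap of `M` on `x`: `T(i + 1) - T(i) > p(|x|)`. -/
def IsGap (p : Polynomial ℕ) (x : Word) (i : ℕ) : Prop :=
  M.T x i + p.eval x.length < M.T x (i + 1)

end RAM

/-! ### Complexity classes -/

/-- `A(x, y)` is decidable in polynomial time: some machine, given `x` and `y`, stops in time
polynomial in `|x| + |y|`, with `1` in working register `0` if and only if `A(x, y)` holds. -/
def PolyTimeDecidable (A : Predicate) : Prop :=
  ∃ (M : RAM) (r : Polynomial ℕ), ∀ x y : Word, ∃ t : ℕ,
    M.Halted (M.conf (encode x ++ encode y) t) ∧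
    M.elapsed (encode x ++ encode y) t ≤ r.eval (x.length + y.length) ∧
    ((M.conf (encode x ++ encode y) t).mem (Bank.work, 0) = 1 ↔ y ∈ A x)

/-- The solutions are of size polynomial in the size of the instance. -/
def PolyBalanced (A : Predicate) : Prop :=
  ∃ r : Polynomial ℕ, ∀ x y : Word, y ∈ A x → y.length ≤ r.eval x.length

/-- The class `EnumP`. -/
def EnumP : Set Predicate := {A | PolyTimeDecidable A ∧ PolyBalanced A}

/-- The class `IncP₁` of the problems of `EnumP` that have an incremental linear algorithm. -/
def IncP1 : Set Predicate := {A | A ∈ EnumP ∧ ∃ M : RAM, M.IncrementalLinear A}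

/-- The class `DelayP` with polynomial space: the problems of `EnumP` that are solved by a machine
with polynomial delay which uses polynomial space. -/
def DelayPPolySpace : Set Predicate := {A | A ∈ EnumP ∧ ∃ M : RAM, M.PolyDelay A ∧ M.PolySpace}

end EnumRAM

end

noncomputable section

namespace EnumRAM

/-! ### The size of a memory -/

/-! The proof is geometric amortization: it turns any incremental linear machine that works in
polynomial space into one with polynomial delay that still works in polynomial space. Choose `Q = K
* (|x| + 1) ^ e` so large that the `k`-th output of the given machine occurs before step `k * Q`,
that there are at most `2 ^ (Q - 1)` solutions, and that every solution has length at most `Q`. Run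
`Q` copies of the machine, the processes. Process `j` reports only the outputs whose time lies in
its zone, which is `[2 ^ (j - 1) * Q, 2 ^ j * Q)`, or `[0, Q)` if `j = 0`. The zones are disjoint
and together contain all the output times. The space is polynomial, because `Q` configurations are
stored, with counters of at most `2 * Q` bits.

To find the next output, the processes are advanced from the highest to the lowest, each by at most
`2 * Q` steps and never beyond its zone, until one of them meets an output in its own zone. A search
thus simulates at most `2 * Q ^ 2` steps, and it remains to see that a search fails only when all
the outputs have been reported. The invariant `Amortized` says that every process is at the end of
its zone or has made `2 * Q` steps for each output found by the lower processes; `Amortized.found`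
shows that a successful search preserves it. Now suppose that a search finds nothing and that `j` is
the lowest process that is not at its end. Then `j` is not `0`, since the zone of process `0` is
shorter than `2 * Q`. The lower zones are exhausted, and they contain either all the outputs or at
least `2 ^ (j - 1)` of them. In the second case the invariant places process `j` at time `2 * Q * 2
^ (j - 1)`, the end of its zone, already before the search, a contradiction. This is
`wasFound_of_advance`.

The remainder implements this on a RAM. Structured programs with step and space bounds are compiled
to machine code (`Prog.Exec.run`), and `exists_polyDelay_polySpace` wraps two such programs into an
enumerating machine. The main loop copies the pending output and searches for the next one before it
executes the `output` instruction, so that the machine knows which output is the last and can stop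
right after it. -/

/-- The number of bits in all the registers together. -/
def memSpace (m : Memory) : ℕ := m.sum fun _ z => bits z

theorem Cfg.space_eq {L : Type} (c : Cfg L) : c.space = memSpace c.mem := rfl

@[simp] theorem bits_zero : bits 0 = 0 := rfl

theorem bits_le_iff {z : ℤ} {n : ℕ} : bits z ≤ n ↔ z.natAbs < 2 ^ n := Nat.size_le

theorem bits_natCast_le (n : ℕ) : bits (n : ℤ) ≤ n := by
  rw [bits_le_iff, Int.natAbs_natCast]
  exact Nat.lt_two_pow_self

theorem bits_add_le (a b : ℤ) : bits (a + b) ≤ bits a + bits b + 1 := by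
  rw [bits_le_iff]
  have ha := bits_le_iff.1 (le_refl (bits a))
  have hb := bits_le_iff.1 (le_refl (bits b))
  have h1 : 2 ^ bits a ≤ 2 ^ (bits a + bits b) := Nat.pow_le_pow_right (by norm_num) (by omega)
  have h2 : 2 ^ bits b ≤ 2 ^ (bits a + bits b) := Nat.pow_le_pow_right (by norm_num) (by omega)
  have := Int.natAbs_add_le a b
  rw [pow_succ]
  omega

theorem bits_neg (a : ℤ) : bits (-a) = bits a := by simp [bits]

theorem bits_sub_le (a b : ℤ) : bits (a - b) ≤ bits a + bits b + 1 := by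
  rw [sub_eq_add_neg, ← bits_neg b]
  exact bits_add_le a (-b)

theorem bits_mul_le (a b : ℤ) : bits (a * b) ≤ bits a + bits b := by
  rw [bits_le_iff, Int.natAbs_mul, pow_add]
  exact Nat.mul_lt_mul'' (bits_le_iff.1 le_rfl) (bits_le_iff.1 le_rfl)

theorem memSpace_le_sum {m : Memory} {s : Finset Reg} (h : ∀ r, r ∉ s → m r = 0) :
    memSpace m ≤ ∑ r ∈ s, bits (m r) :=
  Finset.sum_le_sum_of_subset fun r hr => by
    by_contra hs
    exact Finsupp.mem_support_iff.1 hr (h r hs)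

theorem bits_le_memSpace (m : Memory) (r : Reg) : bits (m r) ≤ memSpace m := by
  by_cases hr : r ∈ m.support
  · exact Finset.single_le_sum (f := fun r => bits (m r)) (fun _ _ => Nat.zero_le _) hr
  · rw [Finsupp.notMem_support_iff.1 hr]
    exact Nat.zero_le _

theorem memSpace_update_le (m : Memory) (r : Reg) (z : ℤ) :
    memSpace (m.update r z) ≤ memSpace m + bits z := by
  classical
  refine (memSpace_le_sum (s := insert r (m.support.erase r)) ?_).trans ?_
  · intro r' hr'
    simp only [Finset.mem_insert, Finset.mem_erase, not_or, not_and] at hr'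
    rw [Finsupp.update_apply, if_neg hr'.1]
    exact Finsupp.notMem_support_iff.1 (hr'.2 hr'.1)
  · rw [Finset.sum_insert (by simp), Finsupp.update_apply, if_pos rfl, add_comm]
    gcongr
    refine (Finset.sum_congr rfl fun r' hr' => ?_).trans_le
      (Finset.sum_le_sum_of_subset (Finset.erase_subset r m.support))
    rw [Finsupp.update_apply, if_neg (Finset.ne_of_mem_erase hr')]

/-! ### A structured programming language -/

/-- Instructions that are not control instructions. -/
inductive Op : Type
  | move (dst : Loc) (a : Operand)
  | add (dst : Loc) (a b : Operand)
  | sub (dst : Loc) (a b : Operand)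
  | mul (dst : Loc) (a b : Operand)

namespace Op

/-- The corresponding instruction of a random access machine. -/
def instr {L : Type} (next : L) : Op → Instr L
  | move dst a => .move dst a next
  | add dst a b => .add dst a b next
  | sub dst a b => .sub dst a b next
  | mul dst a b => .mul dst a b next

/-- The effect on the memory. -/
def run (m : Memory) : Op → Memory
  | move dst a => m.update (dst.reg m) (a.val m)
  | add dst a b => m.update (dst.reg m) (a.val m + b.val m)
  | sub dst a b => m.update (dst.reg m) (a.val m - b.val m)
  | mul dst a b => m.update (dst.reg m) (a.val m * b.val m)

end Op

/-- The number of bits of the constant in an operand. -/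
def Operand.constBits : Operand → ℕ
  | .const z => bits z
  | .loc _ => 0

theorem Operand.bits_val_le (m : Memory) (a : Operand) :
    bits (a.val m) ≤ memSpace m + a.constBits := by
  cases a with
  | const z => exact Nat.le_add_left _ _
  | loc l => exact bits_le_memSpace m _

/-- The number of bits of the constants in an instruction. -/
def Op.constBits : Op → ℕ
  | move _ a => a.constBits
  | add _ a b => a.constBits + b.constBits
  | sub _ a b => a.constBits + b.constBits
  | mul _ a b => a.constBits + b.constBits

/-- The new value has at most the bits of its two operands and one carry bit, and each operand is
either a register or a constant of the program; the old value of the destination is simply not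
subtracted. -/
theorem Op.memSpace_run_le (m : Memory) (o : Op) :
    memSpace (o.run m) ≤ 3 * memSpace m + (o.constBits + 1) := by
  cases o with
  | move dst a =>
    have h := memSpace_update_le m (dst.reg m) (a.val m)
    have ha := a.bits_val_le m
    simp only [Op.run, Op.constBits]
    omega
  | add dst a b =>
    have h := memSpace_update_le m (dst.reg m) (a.val m + b.val m)
    have := bits_add_le (a.val m) (b.val m)
    have ha := a.bits_val_le m
    have hb := b.bits_val_le m
    simp only [Op.run, Op.constBits]
    omega
  | sub dst a b =>
    have h := memSpace_update_le m (dst.reg m) (a.val m - b.val m)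
    have := bits_sub_le (a.val m) (b.val m)
    have ha := a.bits_val_le m
    have hb := b.bits_val_le m
    simp only [Op.run, Op.constBits]
    omega
  | mul dst a b =>
    have h := memSpace_update_le m (dst.reg m) (a.val m * b.val m)
    have := bits_mul_le (a.val m) (b.val m)
    have ha := a.bits_val_le m
    have hb := b.bits_val_le m
    simp only [Op.run, Op.constBits]
    omega

/-- Structured programs; `loop a p` repeats `p` as long as `a > 0`. -/
inductive Prog : Type
  | op (o : Op)
  | seq (p q : Prog)
  | ifZero (a : Operand) (p q : Prog)
  | ifPos (a : Operand) (p q : Prog)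
  | loop (a : Operand) (p : Prog)

namespace Prog

/-- `Exec S p m n m'`: started with the memory `m`, the program `p` stops after `n` steps with the
memory `m'`, and before each of these steps the memory has at most `S` bits. -/
inductive Exec (S : ℕ) : Prog → Memory → ℕ → Memory → Prop
  | op {o m} (h : memSpace m ≤ S) : Exec S (.op o) m 1 (o.run m)
  | seq {p q m n m' n' m''} (h : Exec S p m n m') (h' : Exec S q m' n' m'') :
      Exec S (.seq p q) m (n + n') m''
  | ifZero_yes {a p q m n m'} (hs : memSpace m ≤ S) (ha : a.val m = 0) (h : Exec S p m n m') :
      Exec S (.ifZero a p q) m (1 + n) m'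
  | ifZero_no {a p q m n m'} (hs : memSpace m ≤ S) (ha : a.val m ≠ 0) (h : Exec S q m n m') :
      Exec S (.ifZero a p q) m (1 + n) m'
  | ifPos_yes {a p q m n m'} (hs : memSpace m ≤ S) (ha : 0 < a.val m) (h : Exec S p m n m') :
      Exec S (.ifPos a p q) m (1 + n) m'
  | ifPos_no {a p q m n m'} (hs : memSpace m ≤ S) (ha : ¬ 0 < a.val m) (h : Exec S q m n m') :
      Exec S (.ifPos a p q) m (1 + n) m'
  | loop_done {a p m} (hs : memSpace m ≤ S) (ha : ¬ 0 < a.val m) : Exec S (.loop a p) m 1 m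
  | loop_more {a p m n m' n' m''} (hs : memSpace m ≤ S) (ha : 0 < a.val m) (h : Exec S p m n m')
      (h' : Exec S (.loop a p) m' n' m'') : Exec S (.loop a p) m (1 + (n + n')) m''

theorem Exec.mono {S S' : ℕ} (hS : S ≤ S') {p m n m'} (h : Exec S p m n m') :
    Exec S' p m n m' := by
  induction h with
  | op h => exact .op (h.trans hS)
  | seq _ _ ih ih' => exact .seq ih ih'
  | ifZero_yes hs ha _ ih => exact .ifZero_yes (hs.trans hS) ha ih
  | ifZero_no hs ha _ ih => exact .ifZero_no (hs.trans hS) ha ih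
  | ifPos_yes hs ha _ ih => exact .ifPos_yes (hs.trans hS) ha ih
  | ifPos_no hs ha _ ih => exact .ifPos_no (hs.trans hS) ha ih
  | loop_done hs ha => exact .loop_done (hs.trans hS) ha
  | loop_more hs ha _ _ ih ih' => exact .loop_more (hs.trans hS) ha ih ih'

/-! ### Programs without loops -/

/-- The program has no loops. -/
def LoopFree : Prog → Prop
  | op _ => True
  | seq p q => p.LoopFree ∧ q.LoopFree
  | ifZero _ p q => p.LoopFree ∧ q.LoopFree
  | ifPos _ p q => p.LoopFree ∧ q.LoopFree
  | loop _ _ => False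

/-- The effect of a program without loops on the memory. -/
def den : Prog → Memory → Memory
  | op o, m => o.run m
  | seq p q, m => q.den (p.den m)
  | ifZero a p q, m => if a.val m = 0 then p.den m else q.den m
  | ifPos a p q, m => if 0 < a.val m then p.den m else q.den m
  | loop _ _, m => m

/-- A bound on the number of steps of a program without loops. -/
def size : Prog → ℕ
  | op _ => 1
  | seq p q => p.size + q.size
  | ifZero _ p q => 1 + (p.size + q.size)
  | ifPos _ p q => 1 + (p.size + q.size)
  | loop _ _ => 0

/-- A bound on the space used by a program without loops, in terms of the initial space. -/
def growth : Prog → Polynomial ℕ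
  | op o => 3 * Polynomial.X + Polynomial.C (o.constBits + 1)
  | seq p q => q.growth.comp p.growth
  | ifZero _ p q => p.growth + q.growth
  | ifPos _ p q => p.growth + q.growth
  | loop _ _ => Polynomial.X

theorem le_eval_growth (p : Prog) (S : ℕ) : S ≤ p.growth.eval S := by
  induction p generalizing S with
  | op o => simp [growth]; omega
  | seq p q ihp ihq => simpa [growth] using (ihp S).trans (ihq _)
  | ifZero a p q ihp ihq => simpa [growth] using (ihp S).trans (Nat.le_add_right _ _)
  | ifPos a p q ihp ihq => simpa [growth] using (ihp S).trans (Nat.le_add_right _ _)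
  | loop a p => simp [growth]

theorem memSpace_den_le {p : Prog} {S : ℕ} {m : Memory} (h : memSpace m ≤ S) :
    memSpace (p.den m) ≤ p.growth.eval S := by
  induction p generalizing S m with
  | op o =>
    have := o.memSpace_run_le m
    simp [growth, den]
    omega
  | seq p q ihp ihq => simpa [growth, den] using ihq (ihp h)
  | ifZero a p q ihp ihq =>
    have := ihp h
    have := ihq h
    simp only [growth, den, Polynomial.eval_add]
    split_ifs <;> omega
  | ifPos a p q ihp ihq =>
    have := ihp h
    have := ihq h
    simp only [growth, den, Polynomial.eval_add]
    split_ifs <;> omega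
  | loop a p => simpa [growth, den] using h

/-- A program without loops stops after a bounded number of steps. -/
theorem LoopFree.exec {p : Prog} (hp : p.LoopFree) {S : ℕ} {m : Memory} (h : memSpace m ≤ S) :
    ∃ n ≤ p.size, Exec (p.growth.eval S) p m n (p.den m) := by
  induction p generalizing S m with
  | op o => exact ⟨1, le_rfl, .op (h.trans (le_eval_growth _ _))⟩
  | seq p q ihp ihq =>
    obtain ⟨n, hn, e⟩ := ihp hp.1 h
    obtain ⟨n', hn', e'⟩ := ihq hp.2 (memSpace_den_le (p := p) h)
    refine ⟨n + n', Nat.add_le_add hn hn', ?_⟩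
    rw [growth, Polynomial.eval_comp]
    exact .seq (e.mono (le_eval_growth q _)) e'
  | ifZero a p q ihp ihq =>
    have hS := h.trans (le_eval_growth (.ifZero a p q) S)
    by_cases ha : a.val m = 0
    · obtain ⟨n, hn, e⟩ := ihp hp.1 h
      refine ⟨1 + n, by simp only [size]; omega, ?_⟩
      rw [den, if_pos ha]
      exact .ifZero_yes hS ha (e.mono (by simp [growth]))
    · obtain ⟨n, hn, e⟩ := ihq hp.2 h
      refine ⟨1 + n, by simp only [size]; omega, ?_⟩
      rw [den, if_neg ha]
      exact .ifZero_no hS ha (e.mono (by simp [growth]))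
  | ifPos a p q ihp ihq =>
    have hS := h.trans (le_eval_growth (.ifPos a p q) S)
    by_cases ha : 0 < a.val m
    · obtain ⟨n, hn, e⟩ := ihp hp.1 h
      refine ⟨1 + n, by simp only [size]; omega, ?_⟩
      rw [den, if_pos ha]
      exact .ifPos_yes hS ha (e.mono (by simp [growth]))
    · obtain ⟨n, hn, e⟩ := ihq hp.2 h
      refine ⟨1 + n, by simp only [size]; omega, ?_⟩
      rw [den, if_neg ha]
      exact .ifPos_no hS ha (e.mono (by simp [growth]))
  | loop a p => exact hp.elim

/-- A loop that counts down: the invariant `P k` holds when at most `k` iterations are left. -/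
theorem exec_loop {S N : ℕ} {a : Operand} {p : Prog} (P : ℕ → Memory → Prop)
    (hS : ∀ k m, P k m → memSpace m ≤ S)
    (hdone : ∀ m, P 0 m → ¬ 0 < a.val m)
    (hstep : ∀ k m, P (k + 1) m → 0 < a.val m →
      ∃ n ≤ N, ∃ m', Exec S p m n m' ∧ ∃ k' ≤ k, P k' m')
    (k : ℕ) (m : Memory) (h : P k m) :
    ∃ n ≤ k * (N + 1) + 1, ∃ m', Exec S (.loop a p) m n m' ∧ (∃ k', P k' m') ∧
      ¬ 0 < a.val m' := by
  induction k using Nat.strong_induction_on generalizing m with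
  | _ k ih =>
    by_cases ha : 0 < a.val m
    · cases k with
      | zero => exact absurd ha (hdone m h)
      | succ k =>
        obtain ⟨n, hn, m', e, k', hk', h'⟩ := hstep k m h ha
        obtain ⟨n', hn', m'', e', h''⟩ := ih k' (by omega) m' h'
        refine ⟨1 + (n + n'), ?_, m'', .loop_more (hS _ _ h) ha e e', h''⟩
        have : k' * (N + 1) ≤ k * (N + 1) := Nat.mul_le_mul_right _ hk'
        rw [Nat.add_mul]
        omega
    · exact ⟨1, by omega, m, .loop_done (hS _ _ h) ha, ⟨k, h⟩, ha⟩

/-! ### Compilation -/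

/-- The labels of the compiled program. -/
def Lab : Prog → Type
  | op _ => Unit
  | seq p q => p.Lab ⊕ q.Lab
  | ifZero _ p q => Option (p.Lab ⊕ q.Lab)
  | ifPos _ p q => Option (p.Lab ⊕ q.Lab)
  | loop _ p => Option p.Lab

theorem finite_lab (p : Prog) : Finite p.Lab := by
  induction p with
  | op o => exact inferInstanceAs (Finite Unit)
  | seq p q ihp ihq => exact inferInstanceAs (Finite (p.Lab ⊕ q.Lab))
  | ifZero a p q ihp ihq => exact inferInstanceAs (Finite (Option (p.Lab ⊕ q.Lab)))
  | ifPos a p q ihp ihq => exact inferInstanceAs (Finite (Option (p.Lab ⊕ q.Lab)))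
  | loop a p ih => exact inferInstanceAs (Finite (Option p.Lab))

/-- The label of the first instruction. -/
def entry : (p : Prog) → p.Lab
  | op _ => ()
  | seq p _ => Sum.inl p.entry
  | ifZero _ _ _ => none
  | ifPos _ _ _ => none
  | loop _ _ => none

/-- The compiled program, when its labels are embedded by `e` in a set of labels `L` and the
execution goes on with the instruction `exit`. -/
def code {L : Type} : (p : Prog) → (e : p.Lab → L) → (exit : L) → p.Lab → Instr L
  | op o, _, exit, _ => o.instr exit
  | seq p q, e, exit, l => match l with
    | Sum.inl l => p.code (fun l => e (Sum.inl l)) (e (Sum.inr q.entry)) l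
    | Sum.inr l => q.code (fun l => e (Sum.inr l)) exit l
  | ifZero a p q, e, exit, l => match l with
    | none => .ifZero a (e (some (Sum.inl p.entry))) (e (some (Sum.inr q.entry)))
    | some (Sum.inl l) => p.code (fun l => e (some (Sum.inl l))) exit l
    | some (Sum.inr l) => q.code (fun l => e (some (Sum.inr l))) exit l
  | ifPos a p q, e, exit, l => match l with
    | none => .ifPos a (e (some (Sum.inl p.entry))) (e (some (Sum.inr q.entry)))
    | some (Sum.inl l) => p.code (fun l => e (some (Sum.inl l))) exit l
    | some (Sum.inr l) => q.code (fun l => e (some (Sum.inr l))) exit l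
  | loop a p, e, exit, l => match l with
    | none => .ifPos a (e (some p.entry)) exit
    | some l => p.code (fun l => e (some l)) (e none) l

end Prog

/-- From `c` the machine goes in `n` steps to `c'`, without executing an `output` instruction, and
the configurations before these steps use space at most `S`. -/
def RAM.Run (M : RAM) (S : ℕ) (c : Cfg M.Label) (n : ℕ) (c' : Cfg M.Label) : Prop :=
  M.step^[n] c = c' ∧ ∀ i < n, (M.step^[i] c).space ≤ S ∧ ¬ M.AtOutput (M.step^[i] c)

theorem RAM.Run.trans {M : RAM} {S n n' : ℕ} {c c' c'' : Cfg M.Label} (h : M.Run S c n c')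
    (h' : M.Run S c' n' c'') : M.Run S c (n + n') c'' := by
  refine ⟨by rw [add_comm, Function.iterate_add_apply, h.1, h'.1], fun i hi => ?_⟩
  rcases lt_or_ge i n with hin | hin
  · exact h.2 i hin
  · have := h'.2 (i - n) (by omega)
    rwa [← h.1, ← Function.iterate_add_apply, Nat.sub_add_cancel hin] at this

theorem RAM.Run.single {M : RAM} {S : ℕ} {c c' : Cfg M.Label} (hs : c.space ≤ S)
    (ho : ¬ M.AtOutput c) (hc : M.step c = c') : M.Run S c 1 c' :=
  ⟨hc, fun i hi => by obtain rfl : i = 0 := by omega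
                      exact ⟨hs, ho⟩⟩

theorem RAM.step_of_ifZero {M : RAM} {c : Cfg M.Label} {a : Operand} {yes no : M.Label}
    (h : M.prog c.label = .ifZero a yes no) :
    M.step c = ⟨if a.val c.mem = 0 then yes else no, c.mem⟩ := by
  rw [RAM.step, h]

theorem RAM.step_of_ifPos {M : RAM} {c : Cfg M.Label} {a : Operand} {yes no : M.Label}
    (h : M.prog c.label = .ifPos a yes no) :
    M.step c = ⟨if 0 < a.val c.mem then yes else no, c.mem⟩ := by
  rw [RAM.step, h]

/-- A compiled program does what it should. -/
theorem Prog.Exec.run {S : ℕ} {p : Prog} {m : Memory} {n : ℕ} {m' : Memory}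
    (h : p.Exec S m n m') (M : RAM) (e : p.Lab → M.Label) (exit : M.Label)
    (hM : ∀ l, M.prog (e l) = p.code e exit l) : M.Run S ⟨e p.entry, m⟩ n ⟨exit, m'⟩ := by
  induction h generalizing exit with
  | @op o m h =>
    refine RAM.Run.single h ?_ ?_
    · rintro ⟨l, hl⟩
      rw [hM] at hl
      cases o <;> cases hl
    · rw [RAM.step, hM]
      cases o <;> rfl
  | @seq p q m n m' n' m'' h h' ih ih' =>
    exact (ih (fun l => e (Sum.inl l)) (e (Sum.inr q.entry)) fun l => hM (Sum.inl l)).trans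
      (ih' (fun l => e (Sum.inr l)) exit fun l => hM (Sum.inr l))
  | @ifZero_yes a p q m n m' hs ha h ih =>
    refine RAM.Run.trans (RAM.Run.single hs ?_ ?_)
      (ih (fun l => e (some (Sum.inl l))) exit fun l => hM (some (Sum.inl l)))
    · rintro ⟨l, hl⟩
      cases (hM none).symm.trans hl
    · rw [RAM.step_of_ifZero (hM none), if_pos ha]
  | @ifZero_no a p q m n m' hs ha h ih =>
    refine RAM.Run.trans (RAM.Run.single hs ?_ ?_)
      (ih (fun l => e (some (Sum.inr l))) exit fun l => hM (some (Sum.inr l)))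
    · rintro ⟨l, hl⟩
      cases (hM none).symm.trans hl
    · rw [RAM.step_of_ifZero (hM none), if_neg ha]
  | @ifPos_yes a p q m n m' hs ha h ih =>
    refine RAM.Run.trans (RAM.Run.single hs ?_ ?_)
      (ih (fun l => e (some (Sum.inl l))) exit fun l => hM (some (Sum.inl l)))
    · rintro ⟨l, hl⟩
      cases (hM none).symm.trans hl
    · rw [RAM.step_of_ifPos (hM none), if_pos ha]
  | @ifPos_no a p q m n m' hs ha h ih =>
    refine RAM.Run.trans (RAM.Run.single hs ?_ ?_)
      (ih (fun l => e (some (Sum.inr l))) exit fun l => hM (some (Sum.inr l)))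
    · rintro ⟨l, hl⟩
      cases (hM none).symm.trans hl
    · rw [RAM.step_of_ifPos (hM none), if_neg ha]
  | @loop_done a p m hs ha =>
    refine RAM.Run.single hs ?_ ?_
    · rintro ⟨l, hl⟩
      cases (hM none).symm.trans hl
    · rw [RAM.step_of_ifPos (hM none), if_neg ha]
  | @loop_more a p m n m' n' m'' hs ha h h' ih ih' =>
    -- The body of the loop is compiled with the test of the loop as its exit, so the run of the
    -- body ends where the remaining iterations start.
    refine RAM.Run.trans (RAM.Run.single (c' := ⟨e (some p.entry), m⟩) hs ?_ ?_) (RAM.Run.trans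
      (ih (fun l => e (some l)) (e none) fun l => hM (some l)) (ih' e exit hM))
    · rintro ⟨l, hl⟩
      cases (hM none).symm.trans hl
    · rw [RAM.step_of_ifPos (hM none), if_pos ha]

/-! ### Machines that alternate silent runs and outputs -/

namespace RAM

/-- An operand is either stored in a register, and then counted by the space, or a constant; since
the program is finite, one `K` takes care of all constants. -/
theorem exists_cost_le (M : RAM) : ∃ K, ∀ c, M.cost c ≤ 2 * c.space + K := by
  have := M.finite
  let f : M.Label → ℕ := fun l => match M.prog l with
    | .add _ a b _ => 1 + a.constBits + b.constBits
    | .sub _ a b _ => 1 + a.constBits + b.constBits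
    | .mul _ a b _ => 1 + a.constBits + b.constBits
    | _ => 1
  obtain ⟨K, hK⟩ := (Set.finite_range f).bddAbove
  refine ⟨K, fun c => ?_⟩
  have hf : f c.label ≤ K := hK ⟨_, rfl⟩
  have key : ∀ a : Operand, bits (a.val c.mem) ≤ c.space + a.constBits := fun a =>
    a.bits_val_le c.mem
  simp only [f] at hf
  rw [cost]
  cases h : M.prog c.label with
  | add dst a b l =>
    have := key a
    have := key b
    simp only [h] at hf ⊢
    omega
  | sub dst a b l =>
    have := key a
    have := key b
    simp only [h] at hf ⊢
    omega
  | mul dst a b l =>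
    have := key a
    have := key b
    simp only [h] at hf ⊢
    omega
  | halt => exact Nat.zero_le _
  | _ =>
    simp only [h] at hf ⊢
    omega

theorem conf_succ (M : RAM) (w : List ℤ) (t : ℕ) : M.conf w (t + 1) = M.step (M.conf w t) :=
  Function.iterate_succ_apply' _ _ _

theorem conf_add (M : RAM) (w : List ℤ) (s t : ℕ) :
    M.conf w (s + t) = M.step^[t] (M.conf w s) := by
  rw [conf, add_comm, Function.iterate_add_apply, conf]

theorem step_of_halted {M : RAM} {c : Cfg M.Label} (h : M.Halted c) : M.step c = c := by
  rw [step, h]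

theorem step_of_atOutput {M : RAM} {c : Cfg M.Label} {l : M.Label}
    (h : M.prog c.label = .output l) : M.step c = ⟨l, c.mem⟩ := by
  rw [step, h]

theorem conf_of_halted {M : RAM} {w : List ℤ} {s : ℕ} (h : M.Halted (M.conf w s)) {t : ℕ}
    (hst : s ≤ t) : M.conf w t = M.conf w s := by
  obtain ⟨t, rfl⟩ := Nat.exists_eq_add_of_le hst
  rw [conf_add, Function.iterate_fixed (step_of_halted h)]

theorem not_atOutput_of_halted {M : RAM} {c : Cfg M.Label} (h : M.Halted c) :
    ¬ M.AtOutput c := by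
  rintro ⟨l, hl⟩
  cases h.symm.trans hl

/-- The output times before `τ i` are exactly `τ 0, …, τ (i - 1)`, so `Nat.count` is `i` there, and
`Nat.nth` inverts `Nat.count` at output times. -/
theorem nth_outputsAt {M : RAM} {x : Word} {N : ℕ} {τ : ℕ → ℕ}
    (hmono : ∀ i j, i < j → j < N → τ i < τ j)
    (hτ : ∀ t, M.OutputsAt x t ↔ ∃ i < N, t = τ i) {i : ℕ} (hi : i < N) :
    Nat.nth (M.OutputsAt x) i = τ i := by
  classical
  have hc : Nat.count (M.OutputsAt x) (τ i) = i := by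
    rw [Nat.count_eq_card_filter_range]
    have : (Finset.range (τ i)).filter (M.OutputsAt x) = (Finset.range i).image τ := by
      ext t
      simp only [Finset.mem_filter, Finset.mem_range, Finset.mem_image, hτ]
      constructor
      · rintro ⟨ht, j, hj, rfl⟩
        refine ⟨j, ?_, rfl⟩
        by_contra hij
        rcases (not_lt.1 hij).lt_or_eq with h | h
        · exact absurd (hmono i j h hj) (by omega)
        · subst h
          omega
      · rintro ⟨j, hj, rfl⟩
        exact ⟨hmono j i hj hi, j, hj.trans hi, rfl⟩
    rw [this, Finset.card_image_of_injOn, Finset.card_range]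
    intro j hj k hk hjk
    simp only [Finset.coe_range, Set.mem_Iio] at hj hk
    by_contra hne
    rcases lt_or_gt_of_ne hne with h | h
    · exact absurd (hmono j k h (hk.trans hi)) (by omega)
    · exact absurd (hmono k j h (hj.trans hi)) (by omega)
  have := Nat.nth_count (p := M.OutputsAt x) (n := τ i) ((hτ _).2 ⟨i, hi, rfl⟩)
  rwa [hc] at this

/-- The times of the outputs of a machine that goes from one output configuration to the next one
by silent runs. -/
theorem exists_output_times {M : RAM} {x : Word} {N S D : ℕ} (out : ℕ → Cfg M.Label)
    (hfirst : ∃ n ≤ D, M.Run S ⟨M.start, load (encode x)⟩ n (out 0))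
    (hnext : ∀ i < N, ∃ n ≤ D, M.Run S (M.step (out i)) n (out (i + 1)))
    (hspace : ∀ i ≤ N, (out i).space ≤ S) (hout : ∀ i ≤ N, M.AtOutput (out i))
    (hlast : M.Halted (M.step (out N))) :
    ∃ τ : ℕ → ℕ, τ 0 ≤ D ∧ (∀ i < N, τ i < τ (i + 1) ∧ τ (i + 1) ≤ τ i + (D + 1)) ∧
      (∀ i ≤ N, M.conf (encode x) (τ i) = out i) ∧
      (∀ t, M.OutputsAt x t ↔ ∃ i < N + 1, t = τ i) ∧
      ∀ t, (M.conf (encode x) t).space ≤ S := by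
  obtain ⟨n₀, hn₀, r₀⟩ := hfirst
  choose! n hn r using hnext
  -- One step for the `output` instruction, followed by the silent run to the next one.
  let τ : ℕ → ℕ := fun i => Nat.rec n₀ (fun i t => t + 1 + n i) i
  have hτs : ∀ i, τ (i + 1) = τ i + 1 + n i := fun _ => rfl
  have hconf : ∀ i ≤ N, M.conf (encode x) (τ i) = out i := by
    intro i
    induction i with
    | zero => exact fun _ => r₀.1
    | succ i ih =>
      intro hi
      rw [hτs, conf_add, conf_succ, ih (by omega)]
      exact (r i (by omega)).1
  have hmain : ∀ i ≤ N, ∀ t ≤ τ i, (M.conf (encode x) t).space ≤ S ∧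
      (M.OutputsAt x t → ∃ j ≤ i, t = τ j) := by
    intro i
    induction i with
    | zero =>
      intro hi t ht
      rcases ht.lt_or_eq with ht | rfl
      · exact ⟨(r₀.2 t ht).1, fun ho => absurd ho (r₀.2 t ht).2⟩
      · exact ⟨hconf 0 hi ▸ hspace 0 hi, fun _ => ⟨0, le_rfl, rfl⟩⟩
    | succ i ih =>
      intro hi t ht
      rcases ht.lt_or_eq with ht | rfl
      · rcases Nat.lt_or_ge (τ i) t with hit | hit
        · have hr := (r i (by omega)).2 (t - (τ i + 1)) (by rw [hτs] at ht; omega)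
          rw [← hconf i (by omega), ← conf_succ, ← conf_add,
            Nat.add_sub_cancel' (by omega)] at hr
          exact ⟨hr.1, fun ho => absurd ho hr.2⟩
        · obtain ⟨h1, h2⟩ := ih (by omega) t hit
          exact ⟨h1, fun ho => (h2 ho).imp fun j hj => ⟨by omega, hj.2⟩⟩
      · exact ⟨hconf _ hi ▸ hspace _ hi, fun _ => ⟨i + 1, le_rfl, rfl⟩⟩
  -- From here on the configuration is constant, which settles both the outputs and the space at all
  -- later times.
  have hhalt : M.Halted (M.conf (encode x) (τ N + 1)) := by
    rwa [conf_succ, hconf N le_rfl]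
  refine ⟨τ, hn₀, fun i hi => ?_, hconf, fun t => ⟨fun ho => ?_, ?_⟩, fun t => ?_⟩
  · have := hn i hi
    rw [hτs]
    omega
  · rcases le_or_gt t (τ N) with ht | ht
    · obtain ⟨j, hj, h⟩ := (hmain N le_rfl t ht).2 ho
      exact ⟨j, by omega, h⟩
    · refine absurd ?_ (not_atOutput_of_halted hhalt)
      rw [← conf_of_halted hhalt (Nat.succ_le_of_lt ht)]
      exact ho
  · rintro ⟨i, hi, rfl⟩
    rw [OutputsAt, hconf i (by omega)]
    exact hout i (by omega)
  · rcases le_or_gt t (τ N) with ht | ht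
    · exact (hmain N le_rfl t ht).1
    · rw [conf_of_halted hhalt (Nat.succ_le_of_lt ht), conf_succ, hconf N le_rfl]
      obtain ⟨l, hl⟩ := hout N le_rfl
      rw [step_of_atOutput hl]
      exact hspace N le_rfl

theorem elapsed_le_add {M : RAM} {x : Word} {S K : ℕ} (hK : ∀ c, M.cost c ≤ 2 * c.space + K)
    (hS : ∀ t, (M.conf (encode x) t).space ≤ S) {s t d : ℕ} (hst : t ≤ s + d) :
    M.elapsed (encode x) t ≤ M.elapsed (encode x) s + d * (2 * S + K) := by
  have h1 : M.elapsed (encode x) t ≤ M.elapsed (encode x) (s + d) :=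
    Finset.sum_le_sum_of_subset (Finset.range_mono hst)
  refine h1.trans ?_
  rw [elapsed, elapsed, Finset.sum_range_add]
  gcongr
  refine (Finset.sum_le_card_nsmul _ _ (2 * S + K) fun i _ => ?_).trans (by simp)
  have := hK (M.conf (encode x) (s + i))
  have := hS (s + i)
  omega

end RAM

/-! ### The output loop -/

/-- The labels of the machine `outputLoop`. -/
inductive LoopLab (G H : Prog) : Type
  | first (l : G.Lab)
  | next (l : H.Lab)
  | firstTest
  | test
  | out
  | lastOut
  | quit

theorem finite_loopLab (G H : Prog) : Finite (LoopLab G H) := by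
  have := G.finite_lab
  have := H.finite_lab
  let f : LoopLab G H → G.Lab ⊕ H.Lab ⊕ Fin 5 := fun l => match l with
    | .first l => .inl l
    | .next l => .inr (.inl l)
    | .firstTest => .inr (.inr 0)
    | .test => .inr (.inr 1)
    | .out => .inr (.inr 2)
    | .lastOut => .inr (.inr 3)
    | .quit => .inr (.inr 4)
  refine Finite.of_injective f fun a b h => ?_
  cases a <;> cases b <;> simp_all [f]

/-- The machine that executes `G` and, as long as `a ≠ 0`, executes `H` and produces an output. It
tests the value of `a` before it produces an output, so that it can stop immediately
after the last one. -/
def outputLoop (G H : Prog) (a : Operand) : RAM where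
  Label := LoopLab G H
  finite := finite_loopLab G H
  start := .first G.entry
  prog
    | .first l => G.code .first .firstTest l
    | .firstTest => .ifZero a .quit (.next H.entry)
    | .next l => H.code .next .test l
    | .test => .ifZero a .lastOut .out
    | .out => .output (.next H.entry)
    | .lastOut => .output .quit
    | .quit => .halt

/-- The label of the `output` instruction that is executed with the memory `m`. -/
def LoopLab.outOf (G H : Prog) (a : Operand) (m : Memory) : LoopLab G H :=
  if a.val m = 0 then .lastOut else .out

theorem LoopLab.outOf_of_eq {G H : Prog} {a : Operand} {m : Memory} (h : a.val m = 0) :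
    LoopLab.outOf G H a m = .lastOut := if_pos h

theorem LoopLab.outOf_of_ne {G H : Prog} {a : Operand} {m : Memory} (h : a.val m ≠ 0) :
    LoopLab.outOf G H a m = .out := if_neg h

theorem outputLoop_run_first {S n : ℕ} {G H : Prog} {a : Operand} {m m' : Memory}
    (h : G.Exec S m n m') :
    (outputLoop G H a).Run S ⟨.first G.entry, m⟩ n ⟨.firstTest, m'⟩ :=
  h.run (outputLoop G H a) LoopLab.first .firstTest fun _ => rfl

/-- The extra step is the test that chooses between the two `output` instructions, the one that
continues and the one that leads to `halt`. -/
theorem outputLoop_run_next {S n : ℕ} {G H : Prog} {a : Operand} {m m' : Memory}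
    (h : H.Exec S m n m') (hs : memSpace m' ≤ S) :
    (outputLoop G H a).Run S ⟨.next H.entry, m⟩ (n + 1)
      ⟨.outOf G H a m', m'⟩ := by
  refine (h.run (outputLoop G H a) LoopLab.next .test fun _ => rfl).trans
    (RAM.Run.single hs ?_ rfl)
  rintro ⟨l, hl⟩
  cases hl

theorem outputLoop_run_stop {S : ℕ} {G H : Prog} {a : Operand} {m : Memory}
    (hs : memSpace m ≤ S) (ha : a.val m = 0) :
    (outputLoop G H a).Run S ⟨.firstTest, m⟩ 1 ⟨.quit, m⟩ := by
  refine RAM.Run.single hs ?_ ((RAM.step_of_ifZero rfl).trans ?_)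
  · rintro ⟨l, hl⟩
    cases hl
  · exact congrArg (fun l => (⟨l, m⟩ : Cfg (outputLoop G H a).Label)) (if_pos ha)

theorem outputLoop_run_enter {S : ℕ} {G H : Prog} {a : Operand} {m : Memory}
    (hs : memSpace m ≤ S) (ha : a.val m ≠ 0) :
    (outputLoop G H a).Run S ⟨.firstTest, m⟩ 1 ⟨.next H.entry, m⟩ := by
  refine RAM.Run.single hs ?_ ((RAM.step_of_ifZero rfl).trans ?_)
  · rintro ⟨l, hl⟩
    cases hl
  · exact congrArg (fun l => (⟨l, m⟩ : Cfg (outputLoop G H a).Label)) (if_neg ha)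

/-- This reduces the theorem to two structured programs. `mem i` is the memory after `G` and `i`
executions of `H`, the `i + 1`-st of which prepares the output of index `i`; the operand `a`
vanishes once no further output is pending. -/
theorem exists_polyDelay_polySpace {A : Predicate} (G H : Prog) (a : Operand)
    (D S : Polynomial ℕ)
    (h : ∀ x : Word, ∃ (N : ℕ) (mem : ℕ → Memory),
      (∃ n ≤ D.eval x.length, G.Exec (S.eval x.length) (load (encode x)) n (mem 0)) ∧
      (∀ i < N, ∃ n ≤ D.eval x.length, H.Exec (S.eval x.length) (mem i) n (mem (i + 1))) ∧
      (∀ i ≤ N, a.val (mem i) = 0 ↔ i = N) ∧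
      (∀ i ≤ N, memSpace (mem i) ≤ S.eval x.length) ∧
      (∀ y, y ∈ A x ↔ ∃ i < N, outputWord (mem (i + 1)) = y) ∧
      (∀ i j, i < N → j < N → outputWord (mem (i + 1)) = outputWord (mem (j + 1)) → i = j)) :
    ∃ M : RAM, M.PolyDelay A ∧ M.PolySpace := by
  set M := outputLoop G H a with hM
  obtain ⟨K, hK⟩ := M.exists_cost_le
  have main : ∀ x : Word, (∀ t, (M.conf (encode x) t).space ≤ S.eval x.length) ∧
      ((∃ t, M.Halted (M.conf (encode x) t) ∧ (∀ t, ¬ M.OutputsAt x t) ∧ ∀ y, y ∉ A x) ∨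
        ∃ (N : ℕ) (mem : ℕ → Memory) (τ : ℕ → ℕ), τ 0 ≤ 2 * D.eval x.length + 2 ∧
          (∀ i < N, τ i < τ (i + 1) ∧ τ (i + 1) ≤ τ i + (2 * D.eval x.length + 2 + 1)) ∧
          (∀ t, M.OutputsAt x t ↔ ∃ i < N + 1, t = τ i) ∧
          M.Halted (M.conf (encode x) (τ N + 1)) ∧
          (∀ i < N + 1, M.wordAt x (τ i) = outputWord (mem (i + 1))) ∧
          (∀ y, y ∈ A x ↔ ∃ i < N + 1, outputWord (mem (i + 1)) = y) ∧
          (∀ i j, i < N + 1 → j < N + 1 →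
            outputWord (mem (i + 1)) = outputWord (mem (j + 1)) → i = j)) := by
    intro x
    obtain ⟨N, mem, ⟨n₀, hn₀, e₀⟩, hstep, hflag, hs, hA, hinj⟩ := h x
    cases N with
    | zero =>
      have r₀ := (outputLoop_run_first (H := H) (a := a) e₀).trans
        (outputLoop_run_stop (hs 0 le_rfl) ((hflag 0 le_rfl).2 rfl))
      have hh : M.Halted (M.conf (encode x) (n₀ + 1)) := by
        have : M.conf (encode x) (n₀ + 1) = ⟨.quit, mem 0⟩ := r₀.1
        rw [this]
        rfl
      have hlt : ∀ t, (M.conf (encode x) t).space ≤ S.eval x.length ∧ ¬ M.OutputsAt x t := by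
        intro t
        rcases lt_or_ge t (n₀ + 1) with ht | ht
        · exact r₀.2 t ht
        · rw [RAM.OutputsAt, RAM.conf_of_halted hh ht]
          refine ⟨?_, RAM.not_atOutput_of_halted hh⟩
          have : M.conf (encode x) (n₀ + 1) = ⟨.quit, mem 0⟩ := r₀.1
          rw [this]
          exact hs 0 le_rfl
      refine ⟨fun t => (hlt t).1, Or.inl ⟨n₀ + 1, hh, fun t => (hlt t).2, fun y => ?_⟩⟩
      simp [hA]
    | succ N =>
      have r₀ := (outputLoop_run_first (H := H) (a := a) e₀).trans
        (outputLoop_run_enter (hs 0 (by omega)) (by rw [Ne, hflag 0 (by omega)]; omega))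
      let out : ℕ → Cfg M.Label := fun i =>
        ⟨LoopLab.outOf G H a (mem (i + 1)), mem (i + 1)⟩
      obtain ⟨n₁, hn₁, e₁⟩ := hstep 0 (by omega)
      have r₁ := r₀.trans (outputLoop_run_next e₁ (hs 1 (by omega)))
      have hout : ∀ i ≤ N, M.AtOutput (out i) := by
        intro i _
        by_cases h : a.val (mem (i + 1)) = 0
        · refine ⟨LoopLab.quit, ?_⟩
          rw [show (out i).label = _ from LoopLab.outOf_of_eq h]
          rfl
        · refine ⟨LoopLab.next H.entry, ?_⟩
          rw [show (out i).label = _ from LoopLab.outOf_of_ne h]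
          rfl
      have hstepout : ∀ i < N, M.step (out i) = ⟨.next H.entry, mem (i + 1)⟩ := by
        intro i hi
        have : a.val (mem (i + 1)) ≠ 0 := by
          rw [Ne, hflag (i + 1) (by omega)]
          omega
        refine RAM.step_of_atOutput ?_
        rw [show (out i).label = _ from LoopLab.outOf_of_ne this]
        rfl
      have hlast : M.Halted (M.step (out N)) := by
        have hl : M.prog (out N).label = .output LoopLab.quit := by
          rw [show (out N).label = _ from LoopLab.outOf_of_eq ((hflag (N + 1) le_rfl).2 rfl)]
          rfl
        rw [RAM.step_of_atOutput hl]
        rfl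
      -- Up to the first output there are `G`, the first test, `H` and the second test, hence `2 * D
      -- + 2` steps; later stretches are shorter.
      obtain ⟨τ, h0, hτ, hc, ho, hsp⟩ := RAM.exists_output_times (x := x) (N := N)
        (S := S.eval x.length) (D := 2 * D.eval x.length + 2) out
        ⟨_, by omega, r₁⟩ (fun i hi => by
          obtain ⟨n, hn, e⟩ := hstep (i + 1) (by omega)
          rw [hstepout i hi]
          exact ⟨n + 1, by omega, outputLoop_run_next e (hs (i + 2) (by omega))⟩)
        (fun i hi => hs (i + 1) (by omega)) hout hlast
      refine ⟨hsp, Or.inr ⟨N, mem, τ, h0, hτ, ho, ?_, fun i hi => ?_, hA, hinj⟩⟩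
      · rwa [RAM.conf_succ, hc N le_rfl]
      · rw [RAM.wordAt, hc i (by omega)]
  have hmono : ∀ {N : ℕ} {τ : ℕ → ℕ}, (∀ i < N, τ i < τ (i + 1)) → ∀ i j, i < j → j < N + 1 →
      τ i < τ j := by
    intro N τ hτ i j hij
    induction j, hij using Nat.le_induction with
    | base => exact fun hj => hτ i (by omega)
    | succ j hij ih => exact fun hj => (ih (by omega)).trans (hτ j (by omega))
  have solves : M.Solves A := by
    refine ⟨fun x => ?_, fun x y => ?_, fun x s t hs ht hst => ?_, fun x t ht hlast => ?_⟩
    · obtain ⟨-, ⟨t, ht, -⟩ | ⟨N, mem, τ, -, -, -, ht, -⟩⟩ := main x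
      · exact ⟨t, ht⟩
      · exact ⟨_, ht⟩
    · obtain ⟨-, ⟨t, -, ho, hA⟩ | ⟨N, mem, τ, -, -, ho, -, hw, hA, -⟩⟩ := main x
      · simp [ho, hA]
      · rw [hA]
        constructor
        · rintro ⟨i, hi, rfl⟩
          exact ⟨τ i, (ho _).2 ⟨i, hi, rfl⟩, hw i hi⟩
        · rintro ⟨t, ht, rfl⟩
          obtain ⟨i, hi, rfl⟩ := (ho t).1 ht
          exact ⟨i, hi, (hw i hi).symm⟩
    · obtain ⟨-, ⟨-, -, ho, -⟩ | ⟨N, mem, τ, -, -, ho, -, hw, -, hinj⟩⟩ := main x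
      · exact absurd hs (ho s)
      · obtain ⟨i, hi, rfl⟩ := (ho s).1 hs
        obtain ⟨j, hj, rfl⟩ := (ho t).1 ht
        rw [hw i hi, hw j hj] at hst
        rw [hinj i j hi hj hst]
    · obtain ⟨-, ⟨-, -, ho, -⟩ | ⟨N, mem, τ, -, hτ, ho, hh, -⟩⟩ := main x
      · exact absurd ht (ho t)
      · obtain ⟨i, hi, rfl⟩ := (ho t).1 ht
        rcases (Nat.lt_succ_iff.1 hi).lt_or_eq with h | rfl
        · exact absurd ((ho _).2 ⟨i + 1, by omega, rfl⟩) (hlast _ (hτ i h).1)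
        · exact hh
  -- Number of steps between two outputs, including the `output` step itself, times the bound on the
  -- cost of a step.
  refine ⟨M, ⟨solves, (2 * D + 2 + 1) * (2 * S + Polynomial.C K), fun x t ht => ?_⟩,
    S, fun x => (main x).1⟩
  simp only [Polynomial.eval_mul, Polynomial.eval_add, Polynomial.eval_C, Polynomial.eval_ofNat,
    Polynomial.eval_one]
  obtain ⟨hsp, ⟨-, -, ho, hA⟩ | ⟨N, mem, τ, h0, hτ, ho, -, -, hA, -⟩⟩ := main x
  · rw [Set.eq_empty_of_forall_notMem hA, Set.ncard_empty] at ht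
    omega
  · have htN : t < N + 1 := by
      refine ht.trans_le ?_
      have : A x = ((Finset.range (N + 1)).image fun i => outputWord (mem (i + 1)) : Finset Word) := by
        ext y
        simp [hA]
      rw [this, Set.ncard_coe_finset]
      exact Finset.card_image_le.trans (by simp)
    have hn := fun i hi => RAM.nth_outputsAt (M := M) (x := x)
      (hmono fun i hi => (hτ i hi).1) ho (i := i) hi
    cases t with
    | zero =>
      rw [RAM.T, RAM.T, hn 0 htN]
      refine (RAM.elapsed_le_add hK hsp (s := 0) (d := 2 * D.eval x.length + 2 + 1)
        (by omega)).trans ?_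
      simp [RAM.elapsed]
    | succ t =>
      rw [RAM.T, RAM.T, hn _ htN, hn _ (by omega)]
      exact RAM.elapsed_le_add hK hsp (hτ t (by omega)).2

/-! ### The memory layout of the simulation

The simulation of `Q` copies of a machine, the processes, uses the first registers of the working
bank for its own variables, and the registers of the input bank above the input for the contents of
the processes: cell `k` of process `j < Q` is the input register `w.length + k * Q + j`, where `w`
is the input. -/

/-- The content of the memory: the variables `v`, the cells `d j k` of the processes, and the
contents `o` of the output bank. -/
structure Rep (w : List ℤ) (Q : ℕ) (v : List ℤ) (d : ℕ → ℕ → ℤ) (o : ℕ → ℤ) (m : Memory) :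
    Prop where
  work : ∀ i, m (Bank.work, i) = v.getD i 0
  inp : ∀ i < w.length, m (Bank.inp, i) = w.getD i 0
  data : ∀ j < Q, ∀ k, m (Bank.inp, w.length + k * Q + j) = d j k
  out : ∀ i, m (Bank.out, i) = o i

/-- Change cell `k` of process `j`. -/
def setCell (d : ℕ → ℕ → ℤ) (j k : ℕ) (z : ℤ) : ℕ → ℕ → ℤ :=
  Function.update d j (Function.update (d j) k z)

/-- Working register `i` as a location. -/
abbrev wLoc (i : ℕ) : Loc := .dir .work i

/-- Working register `i` as an operand. -/
abbrev wVal (i : ℕ) : Operand := .loc (wLoc i)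

/-- The input register whose address is in working register `i`. -/
abbrev inpAt (i : ℕ) : Loc := .ind .inp i

/-- The variables of the simulation. -/
abbrev regs (w : List ℤ) (Q : ℕ) (x2 x3 x4 x5 x6 x7 x8 x9 x10 x11 : ℤ) : List ℤ :=
  [(w.length : ℤ), (Q : ℤ), x2, x3, x4, x5, x6, x7, x8, x9, x10, x11]

namespace Rep

variable {w : List ℤ} {Q : ℕ} {v : List ℤ} {d : ℕ → ℕ → ℤ} {o : ℕ → ℤ} {m : Memory}

theorem congr_data (h : Rep w Q v d o m) {d' : ℕ → ℕ → ℤ} (hd : ∀ j < Q, d j = d' j) :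
    Rep w Q v d' o m :=
  ⟨h.work, h.inp, fun j hj k => by rw [h.data j hj, hd j hj], h.out⟩

/-- The side condition on the index is a Boolean equation, so that `rfl` proves it for an explicit
list of variables whatever their values are. -/
theorem updateWork (h : Rep w Q v d o m) (i : ℕ) (z : ℤ) (hi : Nat.ble (i + 1) v.length = true) :
    Rep w Q (v.set i z) d o (m.update (Bank.work, i) z) := by
  refine ⟨fun i' => ?_, fun i' hi' => ?_, fun j hj k => ?_, fun i' => ?_⟩
  · rw [Finsupp.update_apply, List.getD_eq_getElem?_getD, List.getElem?_set]
    have hi := Nat.le_of_ble_eq_true hi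
    by_cases hii : i = i'
    · subst hii
      simp [show i < v.length by omega]
    · rw [if_neg (by simp [Ne.symm hii]), if_neg hii, h.work, List.getD_eq_getElem?_getD]
  · rw [Finsupp.update_apply, if_neg (by simp), h.inp i' hi']
  · rw [Finsupp.update_apply, if_neg (by simp), h.data j hj]
  · rw [Finsupp.update_apply, if_neg (by simp), h.out]

/-- The remainder modulo `Q` is the process and the quotient is the cell. -/
theorem cell_injective {C j j' k k' : ℕ} (hj : j < Q) (hj' : j' < Q)
    (h : C + k * Q + j = C + k' * Q + j') : j = j' ∧ k = k' := by
  have h1 : k * Q + j = k' * Q + j' := by omega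
  have hQ : 0 < Q := by omega
  have h2 := congrArg (· % Q) h1
  have h3 := congrArg (· / Q) h1
  simp only [Nat.add_comm (_ * Q), Nat.add_mul_mod_self_right,
    Nat.mod_eq_of_lt hj, Nat.mod_eq_of_lt hj'] at h2
  simp only [Nat.add_comm (_ * Q), Nat.add_mul_div_right _ _ hQ, Nat.div_eq_of_lt hj,
    Nat.div_eq_of_lt hj', zero_add] at h3
  exact ⟨h2, h3⟩

theorem updateData (h : Rep w Q v d o m) {j : ℕ} (hj : j < Q) (k : ℕ) (z : ℤ) :
    Rep w Q v (setCell d j k z) o (m.update (Bank.inp, w.length + k * Q + j) z) := by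
  refine ⟨fun i' => ?_, fun i' hi' => ?_, fun j' hj' k' => ?_, fun i' => ?_⟩
  · rw [Finsupp.update_apply, if_neg (by simp), h.work]
  · rw [Finsupp.update_apply, if_neg, h.inp i' hi']
    simp only [Prod.mk.injEq, true_and]
    omega
  · rw [Finsupp.update_apply, h.data j' hj']
    by_cases hc : j' = j ∧ k' = k
    · obtain ⟨rfl, rfl⟩ := hc
      simp [setCell]
    · rw [if_neg]
      · by_cases hjj : j' = j
        · subst hjj
          have : k' ≠ k := fun hk => hc ⟨rfl, hk⟩
          simp [setCell, this]
        · simp [setCell, hjj]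
      · simp only [Prod.mk.injEq, true_and]
        exact fun he => hc (cell_injective hj' hj he)
  · rw [Finsupp.update_apply, if_neg (by simp), h.out]

theorem updateOut (h : Rep w Q v d o m) (i : ℕ) (z : ℤ) :
    Rep w Q v d (Function.update o i z) (m.update (Bank.out, i) z) := by
  refine ⟨fun i' => ?_, fun i' hi' => ?_, fun j hj k => ?_, fun i' => ?_⟩
  · rw [Finsupp.update_apply, if_neg (by simp), h.work]
  · rw [Finsupp.update_apply, if_neg (by simp), h.inp i' hi']
  · rw [Finsupp.update_apply, if_neg (by simp), h.data j hj]
  · rw [Finsupp.update_apply, Function.update_apply]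
    simp [h.out]

theorem val (h : Rep w Q v d o m) (i : ℕ) : (wVal i).val m = v.getD i 0 := h.work i

theorem moveC (h : Rep w Q v d o m) (i : ℕ) (z : ℤ)
    (hi : Nat.ble (i + 1) v.length = true := by rfl) :
    Rep w Q (v.set i z) d o ((Prog.op (.move (wLoc i) (.const z))).den m) :=
  h.updateWork i z hi

theorem moveW (h : Rep w Q v d o m) (i a : ℕ)
    (hi : Nat.ble (i + 1) v.length = true := by rfl) :
    Rep w Q (v.set i (v.getD a 0)) d o ((Prog.op (.move (wLoc i) (wVal a))).den m) := by
  rw [← h.val a]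
  exact h.updateWork i _ hi

theorem addW (h : Rep w Q v d o m) (i a b : ℕ)
    (hi : Nat.ble (i + 1) v.length = true := by rfl) :
    Rep w Q (v.set i (v.getD a 0 + v.getD b 0)) d o
      ((Prog.op (.add (wLoc i) (wVal a) (wVal b))).den m) := by
  rw [← h.val a, ← h.val b]
  exact h.updateWork i _ hi

theorem subW (h : Rep w Q v d o m) (i a b : ℕ)
    (hi : Nat.ble (i + 1) v.length = true := by rfl) :
    Rep w Q (v.set i (v.getD a 0 - v.getD b 0)) d o
      ((Prog.op (.sub (wLoc i) (wVal a) (wVal b))).den m) := by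
  rw [← h.val a, ← h.val b]
  exact h.updateWork i _ hi

theorem mulW (h : Rep w Q v d o m) (i a b : ℕ)
    (hi : Nat.ble (i + 1) v.length = true := by rfl) :
    Rep w Q (v.set i (v.getD a 0 * v.getD b 0)) d o
      ((Prog.op (.mul (wLoc i) (wVal a) (wVal b))).den m) := by
  rw [← h.val a, ← h.val b]
  exact h.updateWork i _ hi

theorem addC (h : Rep w Q v d o m) (i a : ℕ) (z : ℤ)
    (hi : Nat.ble (i + 1) v.length = true := by rfl) :
    Rep w Q (v.set i (v.getD a 0 + z)) d o
      ((Prog.op (.add (wLoc i) (wVal a) (.const z))).den m) := by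
  rw [← h.val a]
  exact h.updateWork i _ hi

theorem subC (h : Rep w Q v d o m) (i a : ℕ) (z : ℤ)
    (hi : Nat.ble (i + 1) v.length = true := by rfl) :
    Rep w Q (v.set i (v.getD a 0 - z)) d o
      ((Prog.op (.sub (wLoc i) (wVal a) (.const z))).den m) := by
  rw [← h.val a]
  exact h.updateWork i _ hi

theorem mulC (h : Rep w Q v d o m) (i a : ℕ) (z : ℤ)
    (hi : Nat.ble (i + 1) v.length = true := by rfl) :
    Rep w Q (v.set i (v.getD a 0 * z)) d o
      ((Prog.op (.mul (wLoc i) (wVal a) (.const z))).den m) := by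
  rw [← h.val a]
  exact h.updateWork i _ hi

theorem reg_inpAt (h : Rep w Q v d o m) {a c : ℕ} (ha : v.getD a 0 = (c : ℤ)) :
    (inpAt a).reg m = (Bank.inp, c) := by
  rw [Loc.reg, h.work, ha, Int.toNat_natCast]

theorem loadCell (h : Rep w Q v d o m) (i a : ℕ) {j k : ℕ} (hj : j < Q)
    (ha : v.getD a 0 = ((w.length + k * Q + j : ℕ) : ℤ))
    (hi : Nat.ble (i + 1) v.length = true := by rfl) :
    Rep w Q (v.set i (d j k)) d o ((Prog.op (.move (wLoc i) (.loc (inpAt a)))).den m) := by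
  have : (Operand.loc (inpAt a)).val m = d j k := by
    rw [Operand.val, h.reg_inpAt ha, h.data j hj]
  rw [← this]
  exact h.updateWork i _ hi

theorem loadInp (h : Rep w Q v d o m) (i a : ℕ) {k : ℕ} (hk : k < w.length)
    (ha : v.getD a 0 = (k : ℤ)) (hi : Nat.ble (i + 1) v.length = true := by rfl) :
    Rep w Q (v.set i (w.getD k 0)) d o ((Prog.op (.move (wLoc i) (.loc (inpAt a)))).den m) := by
  have : (Operand.loc (inpAt a)).val m = w.getD k 0 := by
    rw [Operand.val, h.reg_inpAt ha, h.inp k hk]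
  rw [← this]
  exact h.updateWork i _ hi

theorem storeCellC (h : Rep w Q v d o m) (i : ℕ) (z : ℤ) {j k : ℕ} (hj : j < Q)
    (hi : v.getD i 0 = ((w.length + k * Q + j : ℕ) : ℤ)) :
    Rep w Q v (setCell d j k z) o ((Prog.op (.move (inpAt i) (.const z))).den m) := by
  rw [Prog.den, Op.run, h.reg_inpAt hi]
  exact h.updateData hj k z

theorem storeCell (h : Rep w Q v d o m) (i a : ℕ) {j k : ℕ} (hj : j < Q)
    (hi : v.getD i 0 = ((w.length + k * Q + j : ℕ) : ℤ)) :
    Rep w Q v (setCell d j k (v.getD a 0)) o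
      ((Prog.op (.move (inpAt i) (wVal a))).den m) := by
  rw [Prog.den, Op.run, h.reg_inpAt hi, h.val a]
  exact h.updateData hj k _

theorem storeOut (h : Rep w Q v d o m) (i a : ℕ) {c : ℕ} (hi : v.getD i 0 = (c : ℤ)) :
    Rep w Q v d (Function.update o c (v.getD a 0))
      ((Prog.op (.move (.ind .out i) (wVal a))).den m) := by
  rw [Prog.den, Op.run, h.val a, Loc.reg, h.work, hi, Int.toNat_natCast]
  exact h.updateOut c _

theorem storeOutDir (h : Rep w Q v d o m) (i a : ℕ) :
    Rep w Q v d (Function.update o i (v.getD a 0))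
      ((Prog.op (.move (.dir .out i) (wVal a))).den m) := by
  rw [Prog.den, Op.run, h.val a]
  exact h.updateOut i _

end Rep

open Prog

/-! ### Access to the cells of a process -/

/-- Replace the cell number in register `5` by the address of the cell of process `j`, where `j` is
the content of register `2`. -/
def cellAddr : Prog :=
  .seq (.op (.mul (wLoc 5) (wVal 5) (wVal 1)))
    (.seq (.op (.add (wLoc 5) (wVal 5) (wVal 2))) (.op (.add (wLoc 5) (wVal 5) (wVal 0))))

/-- Put cell `k` into register `i`. -/
def getCell (k i : ℕ) : Prog :=
  .seq (.op (.move (wLoc 5) (.const k))) (.seq cellAddr (.op (.move (wLoc i) (.loc (inpAt 5)))))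

/-- Put an operand into cell `k`. -/
def putCell (k : ℕ) (a : Operand) : Prog :=
  .seq (.op (.move (wLoc 5) (.const k))) (.seq cellAddr (.op (.move (inpAt 5) a)))

/-- The number of a bank. -/
def Bank.num : Bank → ℕ
  | .inp => 0
  | .work => 1
  | .out => 2

/-- Put into register `5` the address of the cell that represents a register of the process. -/
def locAddr : Loc → Prog
  | .dir b i => .seq (.op (.move (wLoc 5) (.const ((4 * i + b.num : ℕ) : ℤ)))) cellAddr
  | .ind b i =>
    .seq (getCell (4 * i + 1) 5)
      (.seq (.ifPos (wVal 5) (.op (.mul (wLoc 5) (wVal 5) (.const 4)))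
          (.op (.move (wLoc 5) (.const 0))))
        (.seq (.op (.add (wLoc 5) (wVal 5) (.const (b.num : ℤ)))) cellAddr))

/-- Put into register `i` the value of an operand of the process. -/
def getOperand (i : ℕ) : Operand → Prog
  | .const z => .op (.move (wLoc i) (.const z))
  | .loc l => .seq (locAddr l) (.op (.move (wLoc i) (.loc (inpAt 5))))

/-! ### The effect of the access programs on a represented memory. -/

section

variable {w : List ℤ} {Q : ℕ} {d : ℕ → ℕ → ℤ} {o : ℕ → ℤ} {m : Memory} {j : ℕ}
  {x2 x3 x4 x5 x6 x7 x8 x9 x10 x11 : ℤ}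

theorem Rep.cellAddr {k : ℕ}
    (h : Rep w Q (regs w Q j x3 x4 k x6 x7 x8 x9 x10 x11) d o m) :
    Rep w Q (regs w Q j x3 x4 (w.length + k * Q + j : ℕ) x6 x7 x8 x9 x10 x11) d o
      (cellAddr.den m) := by
  have h1 := ((h.mulW 5 5 1).addW 5 5 2).addW 5 5 0
  have e : ((w.length + k * Q + j : ℕ) : ℤ) = (k : ℤ) * Q + j + w.length := by
    push_cast
    ring
  rw [e]
  exact h1

/-- Register `5` is a scratch register for addresses. Its final value is left unspecified, because
every access overwrites it and `clearProg` resets it. -/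
theorem Rep.getCell6 (k : ℕ) (hj : j < Q)
    (h : Rep w Q (regs w Q j x3 x4 x5 x6 x7 x8 x9 x10 x11) d o m) :
    ∃ y, Rep w Q (regs w Q j x3 x4 y (d j k) x7 x8 x9 x10 x11) d o ((getCell k 6).den m) :=
  ⟨_, Rep.loadCell (Rep.cellAddr (h.moveC 5 k)) 6 5 hj rfl⟩

theorem Rep.getCell7 (k : ℕ) (hj : j < Q)
    (h : Rep w Q (regs w Q j x3 x4 x5 x6 x7 x8 x9 x10 x11) d o m) :
    ∃ y, Rep w Q (regs w Q j x3 x4 y x6 (d j k) x8 x9 x10 x11) d o ((getCell k 7).den m) :=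
  ⟨_, Rep.loadCell (Rep.cellAddr (h.moveC 5 k)) 7 5 hj rfl⟩

theorem Rep.getCell8 (k : ℕ) (hj : j < Q)
    (h : Rep w Q (regs w Q j x3 x4 x5 x6 x7 x8 x9 x10 x11) d o m) :
    ∃ y, Rep w Q (regs w Q j x3 x4 y x6 x7 (d j k) x9 x10 x11) d o ((getCell k 8).den m) :=
  ⟨_, Rep.loadCell (Rep.cellAddr (h.moveC 5 k)) 8 5 hj rfl⟩

theorem Rep.getCell5 (k : ℕ) (hj : j < Q)
    (h : Rep w Q (regs w Q j x3 x4 x5 x6 x7 x8 x9 x10 x11) d o m) :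
    Rep w Q (regs w Q j x3 x4 (d j k) x6 x7 x8 x9 x10 x11) d o ((getCell k 5).den m) :=
  Rep.loadCell (Rep.cellAddr (h.moveC 5 k)) 5 5 hj rfl

theorem Rep.putCellC (k : ℕ) (z : ℤ) (hj : j < Q)
    (h : Rep w Q (regs w Q j x3 x4 x5 x6 x7 x8 x9 x10 x11) d o m) :
    ∃ y, Rep w Q (regs w Q j x3 x4 y x6 x7 x8 x9 x10 x11) (setCell d j k z) o
      ((putCell k (.const z)).den m) :=
  ⟨_, Rep.storeCellC (Rep.cellAddr (h.moveC 5 k)) 5 z hj rfl⟩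

theorem Rep.putCell6 (k : ℕ) (hj : j < Q)
    (h : Rep w Q (regs w Q j x3 x4 x5 x6 x7 x8 x9 x10 x11) d o m) :
    ∃ y, Rep w Q (regs w Q j x3 x4 y x6 x7 x8 x9 x10 x11) (setCell d j k x6) o
      ((putCell k (wVal 6)).den m) :=
  ⟨_, Rep.storeCell (Rep.cellAddr (h.moveC 5 k)) 5 6 hj rfl⟩

theorem Rep.putCell10 (k : ℕ) (hj : j < Q)
    (h : Rep w Q (regs w Q j x3 x4 x5 x6 x7 x8 x9 x10 x11) d o m) :
    ∃ y, Rep w Q (regs w Q j x3 x4 y x6 x7 x8 x9 x10 x11) (setCell d j k x10) o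
      ((putCell k (wVal 10)).den m) :=
  ⟨_, Rep.storeCell (Rep.cellAddr (h.moveC 5 k)) 5 10 hj rfl⟩

theorem Rep.putCell11 (k : ℕ) (hj : j < Q)
    (h : Rep w Q (regs w Q j x3 x4 x5 x6 x7 x8 x9 x10 x11) d o m) :
    ∃ y, Rep w Q (regs w Q j x3 x4 y x6 x7 x8 x9 x10 x11) (setCell d j k x11) o
      ((putCell k (wVal 11)).den m) :=
  ⟨_, Rep.storeCell (Rep.cellAddr (h.moveC 5 k)) 5 11 hj rfl⟩

/-! ### The cells of a process -/

/-- The cells of a process: the registers of the three banks of the machine, and then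
the number of the label, a counter and a bound. -/
def cells {L : Type} (num : L → ℕ) (c : Cfg L) (cnt wid : ℤ) (k : ℕ) : ℤ :=
  if k % 4 = 0 then c.mem (Bank.inp, k / 4)
  else if k % 4 = 1 then c.mem (Bank.work, k / 4)
  else if k % 4 = 2 then c.mem (Bank.out, k / 4)
  else if k = 3 then num c.label else if k = 7 then cnt else if k = 11 then wid else 0

section

variable {L : Type} {num : L → ℕ} {c : Cfg L} {cnt wid : ℤ}

theorem cells_reg (b : Bank) (a : ℕ) : cells num c cnt wid (4 * a + b.num) = c.mem (b, a) := by
  have h : (4 * a + b.num) / 4 = a := by cases b <;> simp only [Bank.num] <;> omega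
  rw [cells, h]
  cases b <;> simp [Bank.num, Nat.add_mod]

@[simp] theorem cells_label : cells num c cnt wid 3 = num c.label := by simp [cells]

@[simp] theorem cells_counter : cells num c cnt wid 7 = cnt := by simp [cells]

@[simp] theorem cells_width : cells num c cnt wid 11 = wid := by simp [cells]

theorem update_cells_reg (r : Reg) (z : ℤ) :
    Function.update (cells num c cnt wid) (4 * r.2 + r.1.num) z =
      cells num ⟨c.label, c.mem.update r z⟩ cnt wid := by
  obtain ⟨b, a⟩ := r
  ext k
  simp only [Function.update_apply, cells, Finsupp.update_apply, Prod.mk.injEq]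
  cases b <;> simp only [Bank.num] <;> split_ifs <;> first | rfl | omega | simp_all <;> omega

theorem update_cells_label (l : L) :
    Function.update (cells num c cnt wid) 3 (num l) = cells num ⟨l, c.mem⟩ cnt wid := by
  ext k
  simp only [Function.update_apply, cells]
  split_ifs <;> first | rfl | omega

theorem update_cells_counter (z : ℤ) :
    Function.update (cells num c cnt wid) 7 z = cells num c z wid := by
  ext k
  simp only [Function.update_apply, cells]
  split_ifs <;> first | rfl | omega

theorem Rep.locAddr {l : Loc} (hj : j < Q) (hd : d j = cells num c cnt wid)
    (h : Rep w Q (regs w Q j x3 x4 x5 x6 x7 x8 x9 x10 x11) d o m) :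
    Rep w Q (regs w Q j x3 x4
      (w.length + (4 * (l.reg c.mem).2 + (l.reg c.mem).1.num) * Q + j : ℕ)
      x6 x7 x8 x9 x10 x11) d o ((locAddr l).den m) := by
  cases l with
  | dir b i => exact Rep.cellAddr (h.moveC 5 _)
  | ind b i =>
    have h1 := h.getCell5 (4 * i + 1) hj
    have hc : d j (4 * i + 1) = c.mem (Bank.work, i) := by
      rw [hd]
      exact cells_reg Bank.work i
    rw [hc] at h1
    refine Rep.cellAddr (k := 4 * (c.mem (Bank.work, i)).toNat + b.num) ?_
    -- The branch on the sign reproduces the convention that a negative address is read as `0`.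
    have h2 : Rep w Q (regs w Q j x3 x4 ((c.mem (Bank.work, i)).toNat * 4 : ℤ)
        x6 x7 x8 x9 x10 x11) d o (Prog.den (.ifPos (wVal 5)
          (.op (.mul (wLoc 5) (wVal 5) (.const 4))) (.op (.move (wLoc 5) (.const 0))))
          ((getCell (4 * i + 1) 5).den m)) := by
      have hv : (wVal 5).val ((getCell (4 * i + 1) 5).den m) = c.mem (Bank.work, i) := h1.val 5
      rw [Prog.den]
      split_ifs with hpos
      · rw [Int.toNat_of_nonneg (by omega)]
        exact h1.mulC 5 5 4
      · rw [Int.toNat_of_nonpos (by omega)]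
        exact h1.moveC 5 0
    have h3 := h2.addC 5 5 (b.num : ℤ)
    have e : ((4 * (c.mem (Bank.work, i)).toNat + b.num : ℕ) : ℤ) =
        ((c.mem (Bank.work, i)).toNat * 4 : ℤ) + b.num := by
      push_cast
      ring
    rw [e]
    exact h3

theorem Rep.getOperand6 {a : Operand} (hj : j < Q) (hd : d j = cells num c cnt wid)
    (h : Rep w Q (regs w Q j x3 x4 x5 x6 x7 x8 x9 x10 x11) d o m) :
    ∃ y, Rep w Q (regs w Q j x3 x4 y (a.val c.mem) x7 x8 x9 x10 x11) d o
      ((getOperand 6 a).den m) := by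
  cases a with
  | const z => exact ⟨_, h.moveC 6 z⟩
  | loc l =>
    have h1 := Rep.loadCell (h.locAddr (l := l) hj hd) 6 5 hj rfl
    rw [hd, cells_reg] at h1
    exact ⟨_, h1⟩

theorem Rep.getOperand7 {a : Operand} (hj : j < Q) (hd : d j = cells num c cnt wid)
    (h : Rep w Q (regs w Q j x3 x4 x5 x6 x7 x8 x9 x10 x11) d o m) :
    ∃ y, Rep w Q (regs w Q j x3 x4 y x6 (a.val c.mem) x8 x9 x10 x11) d o
      ((getOperand 7 a).den m) := by
  cases a with
  | const z => exact ⟨_, h.moveC 7 z⟩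
  | loc l =>
    have h1 := Rep.loadCell (h.locAddr (l := l) hj hd) 7 5 hj rfl
    rw [hd, cells_reg] at h1
    exact ⟨_, h1⟩

/-- Put the content of register `6` into the cell of a register of the process. -/
def putLoc (l : Loc) : Prog := .seq (locAddr l) (.op (.move (inpAt 5) (wVal 6)))

theorem Rep.putLoc {l : Loc} (hj : j < Q) (hd : d j = cells num c cnt wid)
    (h : Rep w Q (regs w Q j x3 x4 x5 x6 x7 x8 x9 x10 x11) d o m) :
    ∃ y, Rep w Q (regs w Q j x3 x4 y x6 x7 x8 x9 x10 x11)
      (Function.update d j (cells num ⟨c.label, c.mem.update (l.reg c.mem) x6⟩ cnt wid)) o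
      ((putLoc l).den m) := by
  have h1 := Rep.storeCell (h.locAddr (l := l) hj hd) 5 6 hj rfl
  rw [setCell, hd, update_cells_reg] at h1
  exact ⟨_, h1⟩

theorem Rep.putLabel {l : L} (hj : j < Q) (hd : d j = cells num c cnt wid)
    (h : Rep w Q (regs w Q j x3 x4 x5 x6 x7 x8 x9 x10 x11) d o m) :
    ∃ y, Rep w Q (regs w Q j x3 x4 y x6 x7 x8 x9 x10 x11)
      (Function.update d j (cells num ⟨l, c.mem⟩ cnt wid)) o
      ((putCell 3 (.const (num l))).den m) := by
  obtain ⟨y, h1⟩ := h.putCellC 3 (num l) hj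
  rw [setCell, hd, update_cells_label] at h1
  exact ⟨_, h1⟩

end

end

open Prog

/-! ### One step of a process -/

/-- A program that does nothing that matters. -/
def nop : Prog := .op (.move (wLoc 5) (.const 0))

/-- Note that process `j` has found a solution, and leave the loops of the search. -/
def foundProg : Prog :=
  .seq (.op (.add (wLoc 4) (wVal 2) (.const 1)))
    (.seq (.op (.move (wLoc 3) (.const 0))) (.op (.move (wLoc 2) (.const 0))))

/-- Execute an instruction of the process. At an `output` instruction, a solution is found if
register `9` is positive. -/
def instrProg {L : Type} (num : L → ℕ) : Instr L → Prog
  | .move dst a l =>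
    .seq (getOperand 6 a) (.seq (putLoc dst) (putCell 3 (.const (num l))))
  | .add dst a b l =>
    .seq (getOperand 6 a) (.seq (getOperand 7 b) (.seq (.op (.add (wLoc 6) (wVal 6) (wVal 7)))
      (.seq (putLoc dst) (putCell 3 (.const (num l))))))
  | .sub dst a b l =>
    .seq (getOperand 6 a) (.seq (getOperand 7 b) (.seq (.op (.sub (wLoc 6) (wVal 6) (wVal 7)))
      (.seq (putLoc dst) (putCell 3 (.const (num l))))))
  | .mul dst a b l =>
    .seq (getOperand 6 a) (.seq (getOperand 7 b) (.seq (.op (.mul (wLoc 6) (wVal 6) (wVal 7)))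
      (.seq (putLoc dst) (putCell 3 (.const (num l))))))
  | .ifZero a yes no =>
    .seq (getOperand 6 a) (.ifZero (wVal 6) (putCell 3 (.const (num yes)))
      (putCell 3 (.const (num no))))
  | .ifPos a yes no =>
    .seq (getOperand 6 a) (.ifPos (wVal 6) (putCell 3 (.const (num yes)))
      (putCell 3 (.const (num no))))
  | .output l => .seq (putCell 3 (.const (num l))) (.ifPos (wVal 9) foundProg nop)
  | .halt => nop

/-- Execute the instruction whose label has, in the given list, the index in register `8`. -/
def dispatch {L : Type} (num : L → ℕ) (prog : L → Instr L) : List L → Prog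
  | [] => nop
  | l :: ls => .ifZero (wVal 8) (instrProg num (prog l))
      (.seq (.op (.sub (wLoc 8) (wVal 8) (.const 1))) (dispatch num prog ls))

/-- Set the auxiliary registers to `0`. -/
def clearProg : Prog :=
  .seq (.op (.move (wLoc 5) (.const 0))) (.seq (.op (.move (wLoc 6) (.const 0)))
    (.seq (.op (.move (wLoc 7) (.const 0))) (.seq (.op (.move (wLoc 8) (.const 0)))
      (.op (.move (wLoc 9) (.const 0))))))

/-- Execute a step of process `j` if its counter is positive. -/
def tick {L : Type} (num : L → ℕ) (prog : L → Instr L) (ls : List L) : Prog :=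
  .seq (.op (.sub (wLoc 3) (wVal 3) (.const 1)))
    (.seq (getCell 7 6)
      (.seq (.ifPos (wVal 6)
          (.seq (.op (.sub (wLoc 6) (wVal 6) (.const 1)))
            (.seq (putCell 7 (wVal 6))
              (.seq (getCell 11 7)
                (.seq (.op (.sub (wLoc 9) (wVal 7) (wVal 6)))
                  (.seq (getCell 3 8) (dispatch num prog ls))))))
          nop)
        clearProg))

theorem loopFree_getCell (k i : ℕ) : (getCell k i).LoopFree := ⟨trivial, ⟨trivial, trivial, trivial⟩, trivial⟩

theorem loopFree_putCell (k : ℕ) (a : Operand) : (putCell k a).LoopFree :=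
  ⟨trivial, ⟨trivial, trivial, trivial⟩, trivial⟩

theorem loopFree_locAddr (l : Loc) : (locAddr l).LoopFree := by
  cases l with
  | dir b i => exact ⟨trivial, trivial, trivial, trivial⟩
  | ind b i => exact ⟨loopFree_getCell _ _, ⟨trivial, trivial⟩, trivial, trivial, trivial, trivial⟩

theorem loopFree_putLoc (l : Loc) : (putLoc l).LoopFree := ⟨loopFree_locAddr l, trivial⟩

theorem loopFree_getOperand (i : ℕ) (a : Operand) : (getOperand i a).LoopFree := by
  cases a with
  | const z => trivial
  | loc l => exact ⟨loopFree_locAddr l, trivial⟩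

theorem loopFree_instrProg {L : Type} (num : L → ℕ) (i : Instr L) :
    (instrProg num i).LoopFree := by
  have h1 := loopFree_putCell
  have h2 := loopFree_putLoc
  have h3 := loopFree_getOperand
  cases i <;> simp [instrProg, LoopFree, h1, h2, h3, foundProg, nop]

theorem loopFree_dispatch {L : Type} (num : L → ℕ) (prog : L → Instr L) (ls : List L) :
    (dispatch num prog ls).LoopFree := by
  induction ls with
  | nil => trivial
  | cons l ls ih => exact ⟨loopFree_instrProg _ _, trivial, ih⟩

theorem loopFree_tick {L : Type} (num : L → ℕ) (prog : L → Instr L) (ls : List L) :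
    (tick num prog ls).LoopFree :=
  ⟨trivial, loopFree_getCell _ _, ⟨⟨trivial, loopFree_putCell _ _, loopFree_getCell _ _, trivial,
    loopFree_getCell _ _, loopFree_dispatch _ _ _⟩, trivial⟩, trivial, trivial, trivial, trivial,
    trivial⟩

/-! ### The effect of one simulated step on a represented memory. -/

section

open scoped Classical in
/-- The variables after a step of process `j`, which has found a solution if `hit` holds. -/
abbrev regsAfter (w : List ℤ) (Q : ℕ) (hit : Prop) (j : ℕ) (x3 x4 x5 x6 x7 x8 x9 x10 x11 : ℤ) :
    List ℤ :=
  regs w Q (if hit then 0 else j) (if hit then 0 else x3) (if hit then (j : ℤ) + 1 else x4)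
    x5 x6 x7 x8 x9 x10 x11

variable {w : List ℤ} {Q : ℕ} {d : ℕ → ℕ → ℤ} {o : ℕ → ℤ} {m : Memory} {j : ℕ}
  {x3 x4 x5 x6 x7 x8 x9 x10 x11 : ℤ} {M : RAM} {num : M.Label → ℕ} {c : Cfg M.Label}
  {cnt wid : ℤ}

theorem Rep.not_hit {hit : Prop} (hhit : ¬ hit) {d : ℕ → ℕ → ℤ}
    (h : Rep w Q (regs w Q j x3 x4 x5 x6 x7 x8 x9 x10 x11) d o m) :
    Rep w Q (regsAfter w Q hit j x3 x4 x5 x6 x7 x8 x9 x10 x11) d o m := by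
  simpa only [regsAfter, if_neg hhit] using h

theorem Rep.putLoc_putLabel {dst : Loc} {l : M.Label} (hj : j < Q)
    (hd : d j = cells num c cnt wid)
    (h : Rep w Q (regs w Q j x3 x4 x5 x6 x7 x8 x9 x10 x11) d o m) :
    ∃ y, Rep w Q (regs w Q j x3 x4 y x6 x7 x8 x9 x10 x11)
      (Function.update d j (cells num ⟨l, c.mem.update (dst.reg c.mem) x6⟩ cnt wid)) o
      ((Prog.seq (EnumRAM.putLoc dst) (putCell 3 (.const (num l)))).den m) := by
  obtain ⟨y, h1⟩ := h.putLoc (l := dst) hj hd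
  obtain ⟨y', h2⟩ := h1.putLabel (l := l) hj (Function.update_self ..)
  rw [Function.update_idem] at h2
  exact ⟨y', h2⟩

/-- The cells of process `j` follow `M.step`, and no other process is touched. The control registers
`2`, `3` and `4` change only at an `output` instruction with a positive register `9`: the first two
become `0`, which ends both loops of the search, and the third becomes `j + 1`. -/
theorem Rep.instrProg (hj : j < Q) (hd : d j = cells num c cnt wid)
    (h : Rep w Q (regs w Q j x3 x4 x5 x6 x7 x8 x9 x10 x11) d o m) :
    ∃ y5 y6 y7, Rep w Q (regsAfter w Q (M.AtOutput c ∧ 0 < x9) j x3 x4 y5 y6 y7 x8 x9 x10 x11)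
      (Function.update d j (cells num (M.step c) cnt wid)) o
      ((instrProg num (M.prog c.label)).den m) := by
  cases hp : M.prog c.label with
  | move dst a l =>
    have hn : ¬ (M.AtOutput c ∧ 0 < x9) := by
      rintro ⟨⟨l', hl'⟩, -⟩
      cases hp.symm.trans hl'
    obtain ⟨y, h1⟩ := h.getOperand6 (a := a) hj hd
    obtain ⟨y', h2⟩ := h1.putLoc_putLabel (dst := dst) (l := l) hj hd
    rw [RAM.step, hp]
    exact ⟨_, _, _, h2.not_hit hn⟩
  | add dst a b l =>
    have hn : ¬ (M.AtOutput c ∧ 0 < x9) := by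
      rintro ⟨⟨l', hl'⟩, -⟩
      cases hp.symm.trans hl'
    obtain ⟨y, h1⟩ := h.getOperand6 (a := a) hj hd
    obtain ⟨y', h2⟩ := h1.getOperand7 (a := b) hj hd
    obtain ⟨y'', h3⟩ := Rep.putLoc_putLabel (dst := dst) (l := l) hj hd (h2.addW 6 6 7)
    rw [RAM.step, hp]
    exact ⟨_, _, _, h3.not_hit hn⟩
  | sub dst a b l =>
    have hn : ¬ (M.AtOutput c ∧ 0 < x9) := by
      rintro ⟨⟨l', hl'⟩, -⟩
      cases hp.symm.trans hl'
    obtain ⟨y, h1⟩ := h.getOperand6 (a := a) hj hd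
    obtain ⟨y', h2⟩ := h1.getOperand7 (a := b) hj hd
    obtain ⟨y'', h3⟩ := Rep.putLoc_putLabel (dst := dst) (l := l) hj hd (h2.subW 6 6 7)
    rw [RAM.step, hp]
    exact ⟨_, _, _, h3.not_hit hn⟩
  | mul dst a b l =>
    have hn : ¬ (M.AtOutput c ∧ 0 < x9) := by
      rintro ⟨⟨l', hl'⟩, -⟩
      cases hp.symm.trans hl'
    obtain ⟨y, h1⟩ := h.getOperand6 (a := a) hj hd
    obtain ⟨y', h2⟩ := h1.getOperand7 (a := b) hj hd
    obtain ⟨y'', h3⟩ := Rep.putLoc_putLabel (dst := dst) (l := l) hj hd (h2.mulW 6 6 7)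
    rw [RAM.step, hp]
    exact ⟨_, _, _, h3.not_hit hn⟩
  | ifZero a yes no =>
    have hn : ¬ (M.AtOutput c ∧ 0 < x9) := by
      rintro ⟨⟨l', hl'⟩, -⟩
      cases hp.symm.trans hl'
    obtain ⟨y, h1⟩ := h.getOperand6 (a := a) hj hd
    have hv : (wVal 6).val ((getOperand 6 a).den m) = a.val c.mem := h1.val 6
    rw [RAM.step_of_ifZero hp, EnumRAM.instrProg, Prog.den, Prog.den, hv]
    split_ifs with ha
    · obtain ⟨y', h2⟩ := h1.putLabel (l := yes) hj hd
      exact ⟨_, _, _, h2.not_hit hn⟩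
    · obtain ⟨y', h2⟩ := h1.putLabel (l := no) hj hd
      exact ⟨_, _, _, h2.not_hit hn⟩
  | ifPos a yes no =>
    have hn : ¬ (M.AtOutput c ∧ 0 < x9) := by
      rintro ⟨⟨l', hl'⟩, -⟩
      cases hp.symm.trans hl'
    obtain ⟨y, h1⟩ := h.getOperand6 (a := a) hj hd
    have hv : (wVal 6).val ((getOperand 6 a).den m) = a.val c.mem := h1.val 6
    rw [RAM.step_of_ifPos hp, EnumRAM.instrProg, Prog.den, Prog.den, hv]
    split_ifs with ha
    · obtain ⟨y', h2⟩ := h1.putLabel (l := yes) hj hd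
      exact ⟨_, _, _, h2.not_hit hn⟩
    · obtain ⟨y', h2⟩ := h1.putLabel (l := no) hj hd
      exact ⟨_, _, _, h2.not_hit hn⟩
  | output l =>
    obtain ⟨y, h1⟩ := h.putLabel (l := l) hj hd
    have hv : (wVal 9).val ((putCell 3 (.const (num l))).den m) = x9 := h1.val 9
    rw [RAM.step_of_atOutput hp, EnumRAM.instrProg, Prog.den, Prog.den, hv]
    by_cases h9 : 0 < x9
    · have hhit : M.AtOutput c ∧ 0 < x9 := ⟨⟨l, hp⟩, h9⟩
      refine ⟨y, x6, x7, ?_⟩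
      simp only [regsAfter, if_pos hhit, if_pos h9]
      exact ((h1.addC 4 2 1).moveC 3 0).moveC 2 0
    · rw [if_neg h9]
      exact ⟨_, _, _, Rep.not_hit (fun hn => h9 hn.2) (h1.moveC 5 0)⟩
  | halt =>
    have hn : ¬ (M.AtOutput c ∧ 0 < x9) := RAM.not_atOutput_of_halted hp ∘ And.left
    -- A process that has halted stays as it is while its counter goes on decreasing, in agreement
    -- with `RAM.conf`.
    rw [RAM.step_of_halted hp, ← hd, Function.update_eq_self]
    exact ⟨_, _, _, Rep.not_hit hn (h.moveC 5 0)⟩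

/-- Register `8` is decremented along the list, so that it vanishes exactly at the current label. -/
theorem Rep.dispatch [DecidableEq M.Label] (ls : List M.Label) (hj : j < Q)
    (hd : d j = cells num c cnt wid) (hl : c.label ∈ ls)
    (h : Rep w Q (regs w Q j x3 x4 x5 x6 x7 (ls.idxOf c.label) x9 x10 x11) d o m) :
    ∃ y5 y6 y7 y8,
      Rep w Q (regsAfter w Q (M.AtOutput c ∧ 0 < x9) j x3 x4 y5 y6 y7 y8 x9 x10 x11)
        (Function.update d j (cells num (M.step c) cnt wid)) o
        ((dispatch num M.prog ls).den m) := by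
  induction ls generalizing m with
  | nil => exact absurd hl List.not_mem_nil
  | cons l ls ih =>
    have hv : (wVal 8).val m = ((l :: ls).idxOf c.label : ℤ) := h.val 8
    rw [EnumRAM.dispatch, Prog.den, hv]
    by_cases hll : l = c.label
    · subst hll
      rw [if_pos (by simp)]
      obtain ⟨y5, y6, y7, h1⟩ := h.instrProg hj hd
      exact ⟨_, _, _, _, h1⟩
    · have hidx : ((l :: ls).idxOf c.label : ℤ) = (ls.idxOf c.label : ℤ) + 1 := by
        rw [List.idxOf_cons_ne _ hll]
        push_cast
        rfl
      rw [if_neg (by omega)]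
      refine ih ((List.mem_cons.1 hl).resolve_left (Ne.symm hll)) ?_
      have h1 := h.subC 8 8 1
      rw [show (regs w Q j x3 x4 x5 x6 x7 ((l :: ls).idxOf c.label) x9 x10 x11).getD 8 0 - 1 =
        (ls.idxOf c.label : ℤ) from sub_eq_of_eq_add hidx] at h1
      exact h1

theorem Rep.clearProg {x2 : ℤ}
    (h : Rep w Q (regs w Q x2 x3 x4 x5 x6 x7 x8 x9 x10 x11) d o m) :
    Rep w Q (regs w Q x2 x3 x4 0 0 0 0 0 x10 x11) d o (clearProg.den m) :=
  ((((h.moveC 5 0).moveC 6 0).moveC 7 0).moveC 8 0).moveC 9 0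

theorem Rep.ifPos_yes {v : List ℤ} {a : Operand} {p q : Prog} (ha : 0 < a.val m)
    (h : Rep w Q v d o (p.den m)) : Rep w Q v d o ((Prog.ifPos a p q).den m) := by
  rwa [Prog.den, if_pos ha]

theorem Rep.ifPos_no {v : List ℤ} {a : Operand} {p q : Prog} (ha : ¬ 0 < a.val m)
    (h : Rep w Q v d o (q.den m)) : Rep w Q v d o ((Prog.ifPos a p q).den m) := by
  rwa [Prog.den, if_neg ha]

/-- A process at the end of its zone only uses up its allowance in register `3`. -/
theorem Rep.tick_idle (ls : List M.Label) (hj : j < Q) (hd : d j = cells num c cnt wid)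
    (hcnt : cnt ≤ 0)
    (h : Rep w Q (regs w Q j x3 x4 x5 x6 x7 x8 x9 x10 x11) d o m) :
    Rep w Q (regs w Q j (x3 - 1) x4 0 0 0 0 0 x10 x11) d o ((tick num M.prog ls).den m) := by
  obtain ⟨y, h1⟩ := Rep.getCell6 7 hj (h.subC 3 3 1)
  rw [hd, cells_counter] at h1
  refine Rep.clearProg (x5 := 0) (x6 := cnt) (x7 := x7) (x8 := x8) (x9 := x9)
    (Rep.ifPos_no ?_ (h1.moveC 5 0))
  rw [h1.val 6]
  exact hcnt.not_gt

theorem Rep.tick_step [DecidableEq M.Label] (ls : List M.Label) (hls : ∀ l, l ∈ ls) (hj : j < Q)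
    (hd : d j = cells (fun l => ls.idxOf l) c cnt wid) (hcnt : 0 < cnt)
    (h : Rep w Q (regs w Q j x3 x4 x5 x6 x7 x8 x9 x10 x11) d o m) :
    Rep w Q (regsAfter w Q (M.AtOutput c ∧ cnt ≤ wid) j (x3 - 1) x4 0 0 0 0 0 x10 x11)
      (Function.update d j (cells (fun l => ls.idxOf l) (M.step c) (cnt - 1) wid)) o
      ((tick (fun l => ls.idxOf l) M.prog ls).den m) := by
  obtain ⟨y, h1⟩ := Rep.getCell6 7 hj (h.subC 3 3 1)
  rw [hd, cells_counter] at h1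
  have e : setCell d j 7 (cnt - 1) =
      Function.update d j (cells (fun l => ls.idxOf l) c (cnt - 1) wid) := by
    rw [setCell, hd, update_cells_counter]
  obtain ⟨y1, h2⟩ : ∃ y1, Rep w Q (regs w Q j (x3 - 1) x4 y1 (cnt - 1) x7 x8 x9 x10 x11)
      (setCell d j 7 (cnt - 1)) o _ := Rep.putCell6 7 hj (h1.subC 6 6 1)
  rw [e] at h2
  obtain ⟨y2, h3⟩ := Rep.getCell7 11 hj h2
  rw [Function.update_self, cells_width] at h3
  obtain ⟨y3, h4⟩ : ∃ y3, Rep w Q (regs w Q j (x3 - 1) x4 y3 (cnt - 1) wid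
      (Function.update d j (cells (fun l => ls.idxOf l) c (cnt - 1) wid) j 3) (wid - (cnt - 1))
      x10 x11) _ o _ := Rep.getCell8 3 hj (h3.subW 9 7 6)
  rw [Function.update_self, cells_label] at h4
  obtain ⟨y5, y6, y7, y8, h5⟩ := h4.dispatch ls hj (Function.update_self ..) (hls _)
  -- Register `9` holds the width minus the decremented counter. It is positive exactly when the
  -- counter before the step is at most the width, that is, when the process is inside its zone.
  rw [Function.update_idem, show (0 < wid - (cnt - 1)) = (cnt ≤ wid) by
    rw [eq_iff_iff]; omega] at h5
  refine Rep.clearProg (Rep.ifPos_yes ?_ h5)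
  rw [h1.val 6]
  exact hcnt

end

/-! ### Geometric amortization

Process `j` looks for outputs in the zone from `zoneStart Q j` to `zoneEnd Q j`. In a search, the
processes are advanced by `2 * Q` steps each, in decreasing order of `j`, until an output is found.
-/

/-- The end of the zone of process `j`. -/
def zoneEnd (Q j : ℕ) : ℕ := 2 ^ j * Q

/-- The length of the zone of process `j`. -/
def zoneWidth (Q : ℕ) : ℕ → ℕ
  | 0 => Q
  | j + 1 => zoneEnd Q j

/-- The start of the zone of process `j`. -/
def zoneStart (Q : ℕ) : ℕ → ℕ
  | 0 => 0
  | j + 1 => zoneEnd Q j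

theorem zoneStart_add_zoneWidth (Q j : ℕ) : zoneStart Q j + zoneWidth Q j = zoneEnd Q j := by
  cases j with
  | zero => simp [zoneStart, zoneWidth, zoneEnd]
  | succ j =>
    simp only [zoneStart, zoneWidth, zoneEnd]
    ring

theorem zoneEnd_mono (Q : ℕ) {i j : ℕ} (h : i ≤ j) : zoneEnd Q i ≤ zoneEnd Q j := by
  unfold zoneEnd
  gcongr
  norm_num

theorem zoneEnd_le_zoneStart (Q : ℕ) {i j : ℕ} (h : i < j) : zoneEnd Q i ≤ zoneStart Q j := by
  obtain ⟨j, rfl⟩ : ∃ j', j = j' + 1 := ⟨j - 1, by omega⟩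
  exact zoneEnd_mono Q (by omega)

theorem exists_zone {Q j s : ℕ} (h : s < zoneEnd Q j) :
    ∃ i ≤ j, zoneStart Q i ≤ s ∧ s < zoneEnd Q i := by
  induction j with
  | zero => exact ⟨0, le_rfl, Nat.zero_le _, h⟩
  | succ j ih =>
    rcases lt_or_ge s (zoneEnd Q j) with hs | hs
    · obtain ⟨i, hi, h'⟩ := ih hs
      exact ⟨i, by omega, h'⟩
    · exact ⟨j + 1, le_rfl, hs, h⟩

section

variable (O : ℕ → Prop) (Q : ℕ)

/-- Process `j` finds no output when it advances from `a` to `b`. -/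
def NoHit (j a b : ℕ) : Prop := ∀ s, a ≤ s → s < b → zoneStart Q j ≤ s → ¬ O s

/-- Process `j` advances from `a` to `b` in a search and finds no output. -/
structure Advance (j a b : ℕ) : Prop where
  le : a ≤ b
  le_end : b ≤ zoneEnd Q j
  far : b = zoneEnd Q j ∨ b = a + 2 * Q
  noHit : NoHit O Q j a b

/-- A search changes the positions of the processes from `t₀` to `t` and process `j` finds the
output at time `u`. -/
structure Found (t₀ t : ℕ → ℕ) (j u : ℕ) : Prop where
  lt : j < Q
  above : ∀ i, j < i → i < Q → Advance O Q i (t₀ i) (t i)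
  below : ∀ i < j, t i = t₀ i
  pos : t j = u + 1
  le : t₀ j ≤ u
  lt_end : u < zoneEnd Q j
  start_le : zoneStart Q j ≤ u
  isOutput : O u
  noHit : NoHit O Q j (t₀ j) u

/-- The output at time `s` has been found by the processes at the positions `t`. -/
def WasFound (t : ℕ → ℕ) (s : ℕ) : Prop := O s ∧ ∃ j < Q, zoneStart Q j ≤ s ∧ s < t j

open scoped Classical in
/-- The number of outputs found by process `j` at position `u`. -/
def numFound (j u : ℕ) : ℕ := Nat.count O u - Nat.count O (zoneStart Q j)

/-- The invariant of the amortization: every process has advanced by `2 * Q` steps for every output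
that the lower processes have found. -/
def Amortized (t : ℕ → ℕ) : Prop :=
  ∀ j < Q, t j ≤ zoneEnd Q j ∧
    (t j = zoneEnd Q j ∨ 2 * Q * ∑ i ∈ Finset.range j, numFound O Q i (t i) ≤ t j)

end

variable {O : ℕ → Prop} {Q : ℕ}

open scoped Classical in
theorem count_eq_of_forall {a b : ℕ} (hab : a ≤ b) (h : ∀ s, a ≤ s → s < b → ¬ O s) :
    Nat.count O b = Nat.count O a := by
  induction b, hab using Nat.le_induction with
  | base => rfl
  | succ b hab ih =>
    rw [Nat.count_succ, if_neg (h b hab (by omega)), add_zero,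
      ih fun s hs hsb => h s hs (by omega)]

/-- The subtraction in `numFound` is truncated, so it gives `0` as long as the process is before its
zone, where it ignores the outputs that it passes. -/
theorem numFound_eq_of_noHit {j a b : ℕ} (hab : a ≤ b) (h : NoHit O Q j a b) :
    numFound O Q j b = numFound O Q j a := by
  classical
  unfold numFound
  rcases le_total a (zoneStart Q j) with ha | ha
  · rcases le_total b (zoneStart Q j) with hb | hb
    · have h1 := Nat.count_monotone O ha
      have h2 := Nat.count_monotone O hb
      omega
    · have h1 := Nat.count_monotone O ha
      rw [count_eq_of_forall hb fun s hs hsb => h s (ha.trans hs) hsb hs]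
      omega
  · rw [count_eq_of_forall hab fun s hs hsb => h s hs hsb (ha.trans hs)]

theorem Found.numFound_eq {t₀ t : ℕ → ℕ} {j u : ℕ} (h : Found O Q t₀ t j u) :
    numFound O Q j (t j) = numFound O Q j (t₀ j) + 1 := by
  classical
  rw [← numFound_eq_of_noHit h.le h.noHit, h.pos]
  have := Nat.count_monotone O h.start_le
  rw [numFound, numFound, Nat.count_succ, if_pos h.isOutput]
  omega

/-- An output found by process `j` adds one to the sums of the processes above `j` only, and each of
these has just paid for it by `2 * Q` steps or by reaching its end. For the processes up to `j` the
sum is the same and the position has not decreased. -/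
theorem Amortized.found {t₀ t : ℕ → ℕ} {j u : ℕ} (ha : Amortized O Q t₀)
    (h : Found O Q t₀ t j u) : Amortized O Q t := by
  have sum_eq : ∀ i ≤ j, ∑ i' ∈ Finset.range i, numFound O Q i' (t i') =
      ∑ i' ∈ Finset.range i, numFound O Q i' (t₀ i') := fun i hi =>
    Finset.sum_congr rfl fun i' hi' => by
      rw [h.below i' ((Finset.mem_range.1 hi').trans_le hi)]
  have sum_le : ∀ i, j < i → i ≤ Q → ∑ i' ∈ Finset.range i, numFound O Q i' (t i') =
      ∑ i' ∈ Finset.range i, numFound O Q i' (t₀ i') + 1 := by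
    intro i hi
    induction i, hi using Nat.le_induction with
    | base =>
      intro _
      rw [Finset.sum_range_succ, Finset.sum_range_succ, sum_eq j le_rfl, h.numFound_eq, add_assoc]
    | succ i hi ih =>
      intro hiQ
      have adv := h.above i hi (by omega)
      rw [Finset.sum_range_succ, Finset.sum_range_succ, ih (by omega),
        numFound_eq_of_noHit adv.le adv.noHit]
      omega
  intro i hi
  obtain ⟨h1, h2⟩ := ha i hi
  rcases lt_trichotomy i j with hij | rfl | hij
  · rw [sum_eq i hij.le, h.below i hij]
    exact ⟨h1, h2⟩
  · have := h.pos
    have := h.le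
    have := h.lt_end
    rw [sum_eq i le_rfl]
    exact ⟨by omega, Or.inr (by omega)⟩
  · have adv := h.above i hij hi
    refine ⟨adv.le_end, ?_⟩
    rcases adv.far with hf | hf
    · exact Or.inl hf
    · rcases h2 with h2 | h2
      · have := adv.le
        have := adv.le_end
        exact Or.inl (by omega)
      · rw [sum_le i hij hi.le, mul_add, hf]
        exact Or.inr (by omega)

theorem Found.wasFound_iff {t₀ t : ℕ → ℕ} {j u : ℕ} (h : Found O Q t₀ t j u) (s : ℕ) :
    WasFound O Q t s ↔ WasFound O Q t₀ s ∨ s = u := by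
  constructor
  · rintro ⟨hs, i, hi, hz, ht⟩
    rcases lt_trichotomy i j with hij | rfl | hij
    · rw [h.below i hij] at ht
      exact Or.inl ⟨hs, i, hi, hz, ht⟩
    · rcases lt_or_ge s (t₀ i) with hs0 | hs0
      · exact Or.inl ⟨hs, i, hi, hz, hs0⟩
      · right
        by_contra hne
        have := h.pos
        exact h.noHit s hs0 (by omega) hz hs
    · rcases lt_or_ge s (t₀ i) with hs0 | hs0
      · exact Or.inl ⟨hs, i, hi, hz, hs0⟩
      · exact absurd hs ((h.above i hij hi).noHit s hs0 ht hz)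
  · rintro (⟨hs, i, hi, hz, ht⟩ | rfl)
    · refine ⟨hs, i, hi, hz, ht.trans_le ?_⟩
      rcases lt_trichotomy i j with hij | rfl | hij
      · exact (h.below i hij).ge
      · have := h.pos
        have := h.le
        omega
      · exact (h.above i hij hi).le
    · exact ⟨h.isOutput, j, h.lt, h.start_le, by rw [h.pos]; omega⟩

/-- The zones are disjoint and no process goes beyond its own, so only process `j` could have found
`u` before, and it had not passed `u`. -/
theorem Found.not_wasFound {t₀ t : ℕ → ℕ} {j u : ℕ} (h : Found O Q t₀ t j u)
    (ha : Amortized O Q t₀) : ¬ WasFound O Q t₀ u := by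
  rintro ⟨-, i, hi, hz, ht⟩
  have h1 := h.start_le
  have h2 := h.lt_end
  have h3 := (ha i hi).1
  rcases lt_trichotomy i j with hij | rfl | hij
  · have := zoneEnd_le_zoneStart Q hij
    omega
  · have := h.le
    omega
  · have := zoneEnd_le_zoneStart Q hij
    omega

theorem wasFound_iff_of_advance {t₀ t : ℕ → ℕ} (h : ∀ j < Q, Advance O Q j (t₀ j) (t j)) (s : ℕ) :
    WasFound O Q t s ↔ WasFound O Q t₀ s := by
  constructor
  · rintro ⟨hs, i, hi, hz, ht⟩
    refine ⟨hs, i, hi, hz, ?_⟩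
    by_contra hlt
    exact (h i hi).noHit s (not_lt.1 hlt) ht hz hs
  · rintro ⟨hs, i, hi, hz, ht⟩
    exact ⟨hs, i, hi, hz, ht.trans_le (h i hi).le⟩

-- The sum telescopes, since every zone starts where the previous one ends.
open scoped Classical in
theorem sum_numFound_zoneEnd (j : ℕ) :
    ∑ i ∈ Finset.range (j + 1), numFound O Q i (zoneEnd Q i) = Nat.count O (zoneEnd Q j) := by
  induction j with
  | zero => simp [numFound, zoneStart]
  | succ j ih =>
    rw [Finset.sum_range_succ, ih, numFound, zoneStart]
    have := Nat.count_monotone O (zoneEnd_mono Q (show j ≤ j + 1 by omega))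
    omega

open scoped Classical in
/-- If no process finds an output, then all the outputs have been found: this is where it matters
that the `k`-th output occurs before time `k * Q`. -/
theorem wasFound_of_advance {N : ℕ} (hQ : 0 < Q) (hN : N ≤ 2 ^ (Q - 1))
    (hcount : ∀ K, min K N ≤ Nat.count O (K * Q)) (htotal : ∀ t, Nat.count O t ≤ N)
    {t₀ t : ℕ → ℕ} (ha : Amortized O Q t₀) (h : ∀ j < Q, Advance O Q j (t₀ j) (t j)) {s : ℕ}
    (hs : O s) : WasFound O Q t s := by
  -- A later output would be one more than the total number `N`.
  have lt_of_count : ∀ b, N ≤ Nat.count O b → s < b := by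
    intro b hb
    by_contra hsb
    have h1 := Nat.count_monotone O (not_lt.1 hsb)
    have h2 := htotal (s + 1)
    rw [Nat.count_succ, if_pos hs] at h2
    omega
  have cover : ∀ j < Q, (∀ i ≤ j, t i = zoneEnd Q i) → N ≤ Nat.count O (zoneEnd Q j) →
      WasFound O Q t s := by
    intro j hj hend hc
    obtain ⟨i, hi, hz, hlt⟩ := exists_zone (lt_of_count _ hc)
    exact ⟨hs, i, by omega, hz, by rwa [hend i hi]⟩
  by_cases hall : ∀ j < Q, t j = zoneEnd Q j
  · refine cover (Q - 1) (by omega) (fun i hi => hall i (by omega)) ?_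
    have := hcount (2 ^ (Q - 1))
    rwa [min_eq_right hN] at this
  · push Not at hall
    -- Consider the lowest process that is not at the end of its zone after the search; it has
    -- advanced by the full `2 * Q` steps.
    have hmin := Nat.find_spec hall
    have hlow : ∀ i < Nat.find hall, t i = zoneEnd Q i := by
      intro i hi
      have := Nat.find_min hall hi
      push Not at this
      exact this (hi.trans hmin.1)
    set j := Nat.find hall
    obtain ⟨hj, hne⟩ := hmin
    have adv := h j hj
    have hfar := adv.far.resolve_left hne
    have hle := adv.le_end
    rcases Nat.eq_zero_or_pos j with hj0 | hj0
    -- Process `0` would have advanced by `2 * Q` steps in a zone of length `Q`.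
    · rw [hj0, zoneEnd, pow_zero, one_mul] at hle
      rw [hj0] at hfar
      omega
    · obtain ⟨i, hi⟩ : ∃ i, j = i + 1 := ⟨j - 1, by omega⟩
      rw [hi] at hj hne adv hfar hle hlow
      refine cover i (by omega) (fun i' hi' => hlow i' (by omega)) ?_
      -- If the lower zones do not contain all the outputs, then `hcount` provides at least `2 ^ i`
      -- outputs in them.
      by_contra hc
      have hci := hcount (2 ^ i)
      have hci' : 2 ^ i ≤ Nat.count O (zoneEnd Q i) := by
        rcases min_choice (2 ^ i) N with hm | hm <;> rw [hm] at hci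
        · exact hci
        · exact absurd hci hc
      rcases (ha _ hj).2 with h2 | h2
      · omega
      · have hsum : ∑ i' ∈ Finset.range (i + 1), numFound O Q i' (t₀ i') =
            Nat.count O (zoneEnd Q i) := by
          rw [← sum_numFound_zoneEnd]
          refine Finset.sum_congr rfl fun i' hi' => ?_
          have hi' := Finset.mem_range.1 hi'
          have adv' := h i' (by omega)
          rw [← hlow i' hi', numFound_eq_of_noHit adv'.le adv'.noHit]
        rw [hsum] at h2
        -- All these outputs had been found before the search, so by the invariant process `i + 1`
        -- had already reached the end of its zone and could not advance by `2 * Q`.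
        have h3 : 2 * Q * 2 ^ i ≤ 2 * Q * Nat.count O (zoneEnd Q i) := by gcongr
        have h4 : zoneEnd Q (i + 1) = 2 * Q * 2 ^ i := by
          rw [zoneEnd, pow_succ]
          ring
        omega

/-! ### The space used by the simulation -/

/-- The cells contain at most `P` bits. -/
def CellBound (f : ℕ → ℤ) (P : ℕ) : Prop :=
  ∃ T : Finset ℕ, (∀ k ∉ T, f k = 0) ∧ ∑ k ∈ T, bits (f k) ≤ P

theorem CellBound.of_eq_or_eq_zero {f g : ℕ → ℤ} {P : ℕ} (hf : CellBound f P)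
    (h : ∀ k, g k = f k ∨ g k = 0) : CellBound g P := by
  obtain ⟨T, hT, hs⟩ := hf
  refine ⟨T, fun k hk => ?_, (Finset.sum_le_sum fun k _ => ?_).trans hs⟩
  · rcases h k with h | h
    · rw [h, hT k hk]
    · exact h
  · rcases h k with h | h <;> rw [h]
    exact Nat.zero_le _

/-- The nonzero cells are the images of the nonzero registers and the three cells for label, counter
and width. -/
theorem cellBound_cells {L : Type} (num : L → ℕ) (c : Cfg L) (cnt wid : ℤ) :
    CellBound (cells num c cnt wid) (c.space + bits (num c.label) + bits cnt + bits wid) := by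
  refine ⟨c.mem.support.image (fun r : Reg => 4 * r.2 + r.1.num) ∪ {3, 7, 11}, fun k hk => ?_, ?_⟩
  · simp only [Finset.mem_union, Finset.mem_image, Finset.mem_insert, Finset.mem_singleton, not_or,
      not_exists, not_and] at hk
    have key : ∀ (b : Bank), k % 4 = b.num → c.mem (b, k / 4) = 0 := by
      intro b hb
      by_contra hne
      exact hk.1 (b, k / 4) (Finsupp.mem_support_iff.2 hne) (by simp only; omega)
    unfold cells
    split_ifs with h0 h1 h2 h3 h7 h11
    · exact key .inp h0
    · exact key .work h1
    · exact key .out h2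
    · exact absurd h3 hk.2.1
    · exact absurd h7 hk.2.2.1
    · exact absurd h11 hk.2.2.2
    · rfl
  · have h1 : ∑ k ∈ c.mem.support.image (fun r : Reg => 4 * r.2 + r.1.num),
        bits (cells num c cnt wid k) ≤ c.space := by
      refine (Finset.sum_image_le_of_nonneg (fun _ _ => Nat.zero_le _)).trans ?_
      refine Finset.sum_le_sum fun r _ => ?_
      rw [cells_reg]
    have h2 : ∑ k ∈ ({3, 7, 11} : Finset ℕ), bits (cells num c cnt wid k) =
        bits (num c.label) + bits cnt + bits wid := by
      rw [Finset.sum_insert (by simp), Finset.sum_insert (by simp), Finset.sum_singleton,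
        cells_label, cells_counter, cells_width, add_assoc]
    have h3 := Finset.sum_union_inter (s₁ := c.mem.support.image
      (fun r : Reg => 4 * r.2 + r.1.num)) (s₂ := {3, 7, 11})
      (f := fun k => bits (cells num c cnt wid k))
    omega

/-- Every part of the memory of the simulation is bounded. -/
structure Good (w : List ℤ) (Q P : ℕ) (v : List ℤ) (d : ℕ → ℕ → ℤ) (o : ℕ → ℤ) : Prop where
  vars : ∀ z ∈ v, bits z ≤ P
  length_le : v.length ≤ 12
  inp : ∀ z ∈ w, bits z ≤ P
  data : ∀ j < Q, CellBound (d j) P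
  out_eq_zero : ∀ i, Q < i → o i = 0
  out : ∀ i, bits (o i) ≤ P

/-- A bound on the space used by the simulation. -/
def spaceBound (l Q P : ℕ) : ℕ := P * (12 + l + Q + (Q + 1))

/-- Four finite sets of registers cover everything that is not zero: variables, input, cells of the
processes, output. In the input bank, division by `Q` identifies the cell to which an address above
the input belongs. -/
theorem Rep.memSpace_le {w : List ℤ} {Q P : ℕ} {v : List ℤ} {d : ℕ → ℕ → ℤ} {o : ℕ → ℤ}
    {m : Memory} (hQ : 0 < Q) (h : Rep w Q v d o m) (g : Good w Q P v d o) :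
    memSpace m ≤ spaceBound w.length Q P := by
  have hd := g.data
  choose! T hT hTs using hd
  have bw : ∀ i, bits (v.getD i 0) ≤ P := by
    intro i
    rw [List.getD_eq_getElem?_getD]
    rcases lt_or_ge i v.length with hi | hi
    · rw [List.getElem?_eq_getElem hi]
      exact g.vars _ (List.getElem_mem hi)
    · rw [List.getElem?_eq_none hi]
      exact Nat.zero_le _
  let S1 : Finset Reg := (Finset.range 12).image fun i => (Bank.work, i)
  let S2 : Finset Reg := (Finset.range w.length).image fun i => (Bank.inp, i)
  let S3 : Finset Reg := ((Finset.range Q).sigma T).image fun p =>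
    (Bank.inp, w.length + p.2 * Q + p.1)
  let S4 : Finset Reg := (Finset.range (Q + 1)).image fun i => (Bank.out, i)
  have h1 : ∑ r ∈ S1, bits (m r) ≤ 12 * P := by
    refine (Finset.sum_image_le_of_nonneg (fun _ _ => Nat.zero_le _)).trans ?_
    refine (Finset.sum_le_card_nsmul _ _ P fun i _ => ?_).trans (by simp)
    rw [h.work]
    exact bw i
  have h2 : ∑ r ∈ S2, bits (m r) ≤ w.length * P := by
    refine (Finset.sum_image_le_of_nonneg (fun _ _ => Nat.zero_le _)).trans ?_
    refine (Finset.sum_le_card_nsmul _ _ P fun i hi => ?_).trans (by simp)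
    have hi := Finset.mem_range.1 hi
    rw [h.inp i hi, List.getD_eq_getElem _ _ hi]
    exact g.inp _ (List.getElem_mem hi)
  have h3 : ∑ r ∈ S3, bits (m r) ≤ Q * P := by
    refine (Finset.sum_image_le_of_nonneg (fun _ _ => Nat.zero_le _)).trans ?_
    rw [Finset.sum_sigma]
    refine (Finset.sum_le_card_nsmul _ _ P fun j hj => ?_).trans (by simp)
    have hj := Finset.mem_range.1 hj
    refine (Finset.sum_le_sum fun k _ => ?_).trans (hTs j hj)
    rw [h.data j hj]
  have h4 : ∑ r ∈ S4, bits (m r) ≤ (Q + 1) * P := by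
    refine (Finset.sum_image_le_of_nonneg (fun _ _ => Nat.zero_le _)).trans ?_
    refine (Finset.sum_le_card_nsmul _ _ P fun i _ => ?_).trans (by simp)
    rw [h.out]
    exact g.out i
  have hu := fun (A B : Finset Reg) =>
    Finset.sum_union_inter (s₁ := A) (s₂ := B) (f := fun r => bits (m r))
  refine (memSpace_le_sum (s := S1 ∪ (S2 ∪ (S3 ∪ S4))) ?_).trans ?_
  · rintro ⟨b, a⟩ hr
    simp only [S1, S2, S3, S4, Finset.mem_union, Finset.mem_image, Finset.mem_range,
      Finset.mem_sigma, not_or, not_exists, not_and, Prod.mk.injEq] at hr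
    obtain ⟨r1, r2, r3, r4⟩ := hr
    cases b with
    | work =>
      have : 12 ≤ a := by
        by_contra hlt
        exact r1 a (by omega) rfl rfl
      rw [h.work, List.getD_eq_default _ _ (g.length_le.trans this)]
    | out =>
      have : Q < a := by
        by_contra hlt
        exact r4 a (by omega) rfl rfl
      rw [h.out, g.out_eq_zero a this]
    | inp =>
      have hwa : w.length ≤ a := by
        by_contra hlt
        exact r2 a (by omega) rfl rfl
      have hj : (a - w.length) % Q < Q := Nat.mod_lt _ hQ
      have ha : w.length + (a - w.length) / Q * Q + (a - w.length) % Q = a := by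
        have := Nat.div_add_mod' (a - w.length) Q
        omega
      have hk : (a - w.length) / Q ∉ T ((a - w.length) % Q) := fun hk => r3 ⟨_, _⟩ ⟨hj, hk⟩ rfl ha
      rw [← ha, h.data _ hj, hT _ hj _ hk]
  · have e1 := hu S1 (S2 ∪ (S3 ∪ S4))
    have e2 := hu S2 (S3 ∪ S4)
    have e3 := hu S3 S4
    have e : spaceBound w.length Q P = 12 * P + (w.length * P + (Q * P + (Q + 1) * P)) := by
      rw [spaceBound]
      ring
    omega

/-! ### The search for the next output -/

/-- The invariants of the loops bound the memory by `B` between two blocks; only inside a block may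
it reach `S`. The growth therefore does not compound over the iterations. -/
theorem Prog.LoopFree.exec_of_le {p : Prog} (hp : p.LoopFree) {B S : ℕ} {m : Memory}
    (h : memSpace m ≤ B) (hS : p.growth.eval B ≤ S) :
    ∃ n ≤ p.size, Exec S p m n (p.den m) := by
  obtain ⟨n, hn, e⟩ := hp.exec h
  exact ⟨n, hn, e.mono hS⟩

/-- The preparation of a search. -/
def searchInit : Prog :=
  .seq (.op (.move (wLoc 2) (wVal 1)))
    (.seq (.op (.move (wLoc 3) (.const 0))) (.op (.move (wLoc 4) (.const 0))))

/-- Go to the next lower process, which may execute `2 * Q` steps. -/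
def searchNext : Prog :=
  .seq (.op (.sub (wLoc 2) (wVal 2) (.const 1))) (.op (.add (wLoc 3) (wVal 1) (wVal 1)))

/-! ### The programs of the simulation and the advance of a single process. -/

section

variable (M : RAM) (ls : List M.Label)

open scoped Classical in
/-- The number of a label in a list of labels. -/
def labelNum (l : M.Label) : ℕ := ls.idxOf l

/-- Execute at most as many steps of the current process as register `3` says. -/
def advanceProg : Prog := .loop (wVal 3) (tick (labelNum M ls) M.prog ls)

/-- Advance the processes, until one of them finds an output. -/
def searchProg : Prog :=
  .seq searchInit (.loop (wVal 2) (.seq searchNext (advanceProg M ls)))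

/-- Start to copy the output of the process whose number plus one is in register `4`. -/
def copyInit : Prog :=
  .seq (.op (.sub (wLoc 2) (wVal 4) (.const 1))) (.seq (getCell 2 6)
    (.seq (.op (.move (wLoc 3) (wVal 6))) (.seq (.op (.move (.dir .out 0) (wVal 6))) clearProg)))

/-- Copy the output register whose address is in register `3`. -/
def copyStep : Prog :=
  .seq (.op (.mul (wLoc 5) (wVal 3) (.const 4))) (.seq (.op (.add (wLoc 5) (wVal 5) (.const 2)))
    (.seq cellAddr (.seq (.op (.move (wLoc 6) (.loc (inpAt 5))))
      (.seq (.op (.move (.ind .out 3) (wVal 6)))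
        (.seq (.op (.sub (wLoc 3) (wVal 3) (.const 1))) clearProg)))))

/-- Copy the output of a process to the output registers. -/
def copyProg : Prog := .seq copyInit (.loop (wVal 3) copyStep)

/-- Multiply register `1` by the `e`-th power of register `0`. -/
def powProg : ℕ → Prog
  | 0 => .op (.mul (wLoc 1) (wVal 1) (.const 1))
  | e + 1 => .seq (.op (.mul (wLoc 1) (wVal 1) (wVal 0))) (powProg e)

/-- Compute the parameters of the simulation. -/
def initVars (K e : ℕ) : Prog :=
  .seq (.op (.add (wLoc 0) (.loc (.dir .inp 0)) (.const 1)))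
    (.seq (.op (.move (wLoc 1) (.const K)))
      (.seq (powProg e)
        (.seq (.op (.move (wLoc 3) (wVal 1)))
          (.seq (.op (.move (wLoc 10) (wVal 1))) (.op (.move (wLoc 11) (wVal 1)))))))

/-- Set the label, the counter and the zone of a process. -/
def initCells : Prog :=
  .seq (putCell 7 (wVal 11)) (.seq (putCell 11 (wVal 10))
    (.seq (putCell 3 (.const (labelNum M ls M.start)))
      (.seq (.op (.move (wLoc 10) (wVal 11))) (.seq (.op (.add (wLoc 11) (wVal 11) (wVal 11)))
        (.seq (.op (.move (wLoc 4) (wVal 0))) clearProg)))))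

/-- Copy an input register to a process. -/
def initCopy : Prog :=
  .seq (.op (.sub (wLoc 4) (wVal 4) (.const 1)))
    (.seq (.op (.move (wLoc 6) (.loc (inpAt 4))))
      (.seq (.op (.mul (wLoc 5) (wVal 4) (.const 4)))
        (.seq cellAddr (.seq (.op (.move (inpAt 5) (wVal 6))) clearProg))))

/-- Go to the next process. -/
def initNext : Prog :=
  .seq (.op (.add (wLoc 2) (wVal 2) (.const 1))) (.op (.sub (wLoc 3) (wVal 3) (.const 1)))

/-- Clear the registers that only the initialization uses. -/
def initEnd : Prog := .seq (.op (.move (wLoc 10) (.const 0))) (.op (.move (wLoc 11) (.const 0)))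

/-- Set up the processes. -/
def initProg (K e : ℕ) : Prog :=
  .seq (initVars K e) (.seq
    (.loop (wVal 3) (.seq (initCells M ls) (.seq (.loop (wVal 4) initCopy) initNext))) initEnd)

/-- The parts without loops of the simulation. -/
def simBlocks (K e : ℕ) : List Prog :=
  [tick (labelNum M ls) M.prog ls, searchInit, searchNext, copyInit, copyStep, initVars K e,
    initCells M ls, initCopy, initNext, initEnd]

/-- The cells of the processes, when process `j` has executed `t j` steps on input `w`. -/
def simCells (w : List ℤ) (Q : ℕ) (t : ℕ → ℕ) (j : ℕ) : ℕ → ℤ :=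
  cells (labelNum M ls) (M.conf w (t j)) ((zoneEnd Q j : ℤ) - t j) (zoneWidth Q j)

/-- The parameters of the simulation: `Q` is the number of processes, `s` bounds the space used by
the simulated machine on input `w`, and `P` is large enough. -/
structure SimContext (K e : ℕ) (w : List ℤ) (Q s P S : ℕ) : Prop where
  eq : Q = K * w.length ^ e
  pos : 0 < Q
  head : w.getD 0 0 + 1 = w.length
  labels : ∀ l, l ∈ ls
  space : ∀ t, (M.conf w t).space ≤ s
  inp : ∀ z ∈ w, bits z ≤ P
  le : s + ls.length + 4 * Q + w.length + 3 ≤ P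
  growth_le : ∀ p ∈ simBlocks M ls K e, p.growth.eval (spaceBound w.length Q P) ≤ S

variable {M ls} {w : List ℤ} {K e Q s P S : ℕ}

theorem labelNum_le (l : M.Label) : labelNum M ls l ≤ ls.length := by
  classical
  unfold labelNum
  exact List.idxOf_le_length

/-- The last zones end at exponentially large times, but such times are less than `2 ^ Q * 2 ^ Q`.
-/
theorem bits_zoneEnd_le {j : ℕ} (hj : j ≤ Q) {z : ℤ} (h0 : 0 ≤ z) (hz : z ≤ zoneEnd Q j) :
    bits z ≤ 2 * Q := by
  rw [bits_le_iff]
  have h1 : 2 ^ j ≤ 2 ^ Q := Nat.pow_le_pow_right (by norm_num) hj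
  have h2 : Q < 2 ^ Q := Nat.lt_two_pow_self
  have h3 : zoneEnd Q j < 2 ^ (2 * Q) := by
    rw [zoneEnd, two_mul, pow_add]
    calc 2 ^ j * Q ≤ 2 ^ Q * Q := by gcongr
      _ < 2 ^ Q * 2 ^ Q := by gcongr
  omega

theorem zoneWidth_le (Q j : ℕ) : zoneWidth Q j ≤ zoneEnd Q j := by
  have := zoneStart_add_zoneWidth Q j
  omega

namespace SimContext

theorem cellBound (C : SimContext M ls K e w Q s P S) {t : ℕ → ℕ} {j : ℕ} (hj : j < Q)
    (ht : t j ≤ zoneEnd Q j) : CellBound (simCells M ls w Q t j) P := by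
  obtain ⟨T, h1, h2⟩ := cellBound_cells (labelNum M ls) (M.conf w (t j))
    ((zoneEnd Q j : ℤ) - t j) (zoneWidth Q j)
  refine ⟨T, h1, h2.trans ?_⟩
  have := C.space (t j)
  have := C.le
  have := (bits_natCast_le (labelNum M ls (M.conf w (t j)).label)).trans (labelNum_le _)
  have := bits_zoneEnd_le hj.le (z := (zoneEnd Q j : ℤ) - t j) (by omega) (by omega)
  have := bits_zoneEnd_le hj.le (z := (zoneWidth Q j : ℤ)) (by omega)
    (by exact_mod_cast zoneWidth_le Q j)
  omega

theorem spaceBound_le (C : SimContext M ls K e w Q s P S) : spaceBound w.length Q P ≤ S :=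
  (le_eval_growth (tick (labelNum M ls) M.prog ls) _).trans (C.growth_le _ (by simp [simBlocks]))

/-- The output registers are bounded. -/
structure OutBound (Q P : ℕ) (o : ℕ → ℤ) : Prop where
  eq_zero : ∀ i, Q < i → o i = 0
  bits_le : ∀ i, bits (o i) ≤ P

theorem memSpace_le (C : SimContext M ls K e w Q s P S) {x2 x3 x4 x10 x11 : ℤ} {d : ℕ → ℕ → ℤ}
    {o : ℕ → ℤ} {m : Memory} (ho : OutBound Q P o)
    (hx : ∀ z ∈ [x2, x3, x4, x10, x11], bits z ≤ P) (hd : ∀ j < Q, CellBound (d j) P)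
    (h : Rep w Q (regs w Q x2 x3 x4 0 0 0 0 0 x10 x11) d o m) :
    memSpace m ≤ spaceBound w.length Q P := by
  have := C.le
  refine h.memSpace_le C.pos ⟨?_, le_rfl, C.inp, hd, ho.eq_zero, ho.bits_le⟩
  simp only [List.forall_mem_cons] at hx ⊢
  have h1 := bits_natCast_le w.length
  have h2 := bits_natCast_le Q
  refine ⟨by omega, by omega, hx.1, hx.2.1, hx.2.2.1, ?_, ?_, ?_, ?_, ?_, hx.2.2.2.1,
    hx.2.2.2.2.1, by simp⟩ <;> simp

theorem memSpace_le_sim (C : SimContext M ls K e w Q s P S) {x2 x3 x4 : ℕ} {t : ℕ → ℕ}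
    {o : ℕ → ℤ} {m : Memory} (ho : OutBound Q P o) (h2 : x2 ≤ P) (h3 : x3 ≤ P) (h4 : x4 ≤ P)
    (ht : ∀ j < Q, t j ≤ zoneEnd Q j)
    (h : Rep w Q (regs w Q x2 x3 x4 0 0 0 0 0 0 0) (simCells M ls w Q t) o m) :
    memSpace m ≤ spaceBound w.length Q P := by
  refine C.memSpace_le ho ?_ (fun j hj => C.cellBound hj (ht j hj)) h
  simp only [List.forall_mem_cons]
  exact ⟨(bits_natCast_le _).trans h2, (bits_natCast_le _).trans h3, (bits_natCast_le _).trans h4,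
    by simp, by simp, by simp⟩

end SimContext

/-- This brings the result of `Rep.tick_step`, where the configuration has made a step and the
counter is one less, back to the form in which the position of process `j` is `u + 1`. -/
theorem simCells_update (t : ℕ → ℕ) (j u : ℕ) :
    Function.update (simCells M ls w Q (Function.update t j u)) j
      (cells (labelNum M ls) (M.step (M.conf w u)) ((zoneEnd Q j : ℤ) - u - 1) (zoneWidth Q j)) =
      simCells M ls w Q (Function.update t j (u + 1)) := by
  ext i k
  by_cases hi : i = j
  · subst hi
    simp only [Function.update_self, simCells, RAM.conf_succ]
    congr 1
    push_cast
    ring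
  · simp only [Function.update_of_ne hi, simCells]

/-- The configuration at time `t` is about to produce an output. -/
abbrev outAt (M : RAM) (w : List ℤ) (t : ℕ) : Prop := M.AtOutput (M.conf w t)

open SimContext in
theorem SimContext.exec_advance (C : SimContext M ls K e w Q s P S) {o : ℕ → ℤ}
    (ho : OutBound Q P o) {t : ℕ → ℕ} (ht : ∀ j < Q, t j ≤ zoneEnd Q j) {j : ℕ} (hj : j < Q)
    {m : Memory}
    (h : Rep w Q (regs w Q j (2 * Q : ℕ) 0 0 0 0 0 0 0 0) (simCells M ls w Q t) o m) :
    ∃ n ≤ 2 * Q * ((tick (labelNum M ls) M.prog ls).size + 1) + 1, ∃ m',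
      Exec S (advanceProg M ls) m n m' ∧
      ((∃ u, Advance (outAt M w) Q j (t j) u ∧
          Rep w Q (regs w Q j 0 0 0 0 0 0 0 0 0) (simCells M ls w Q (Function.update t j u)) o m') ∨
        ∃ u, t j ≤ u ∧ u < zoneEnd Q j ∧ zoneStart Q j ≤ u ∧ outAt M w u ∧
          NoHit (outAt M w) Q j (t j) u ∧
          Rep w Q (regs w Q 0 0 (j + 1 : ℕ) 0 0 0 0 0 0 0)
            (simCells M ls w Q (Function.update t j (u + 1))) o m') := by
  classical
  have hP := C.le
  have htu : ∀ u ≤ zoneEnd Q j, ∀ i < Q, Function.update t j u i ≤ zoneEnd Q i := by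
    intro u hu i hi
    by_cases hij : i = j
    · subst hij
      simpa using hu
    · simpa [hij] using ht i hi
  -- Either the process is still searching, with `k` steps of its allowance left, or it has stopped
  -- just after an output in its zone. In the second case register `3` is `0` and the loop ends,
  -- whatever `k` is.
  let P' : ℕ → Memory → Prop := fun k m' => k ≤ 2 * Q ∧
    ((∃ u, t j ≤ u ∧ u ≤ zoneEnd Q j ∧ (u = zoneEnd Q j ∨ u = t j + (2 * Q - k)) ∧
        NoHit (outAt M w) Q j (t j) u ∧
        Rep w Q (regs w Q j k (0 : ℕ) 0 0 0 0 0 0 0)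
          (simCells M ls w Q (Function.update t j u)) o m') ∨
      ∃ u, t j ≤ u ∧ u < zoneEnd Q j ∧ zoneStart Q j ≤ u ∧ outAt M w u ∧
        NoHit (outAt M w) Q j (t j) u ∧
        Rep w Q (regs w Q (0 : ℕ) (0 : ℕ) (j + 1 : ℕ) 0 0 0 0 0 0 0)
          (simCells M ls w Q (Function.update t j (u + 1))) o m')
  have hspace : ∀ k m', P' k m' → memSpace m' ≤ spaceBound w.length Q P := by
    rintro k m' ⟨hk, ⟨u, -, hu, -, -, hr⟩ | ⟨u, -, hu, -, -, -, hr⟩⟩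
    · exact C.memSpace_le_sim ho (by omega) (by omega) (by omega) (htu u hu) hr
    · exact C.memSpace_le_sim ho (by omega) (by omega) (by omega) (htu (u + 1) hu) hr
  have hSB := C.spaceBound_le
  obtain ⟨n, hn, m', e, ⟨k, hk, hres⟩, hg⟩ := exec_loop (S := S)
    (N := (tick (labelNum M ls) M.prog ls).size) (a := wVal 3)
    (p := tick (labelNum M ls) M.prog ls) P' (fun k m' hm' => (hspace k m' hm').trans hSB)
    (by
      rintro m' ⟨-, ⟨u, -, -, -, -, hr⟩ | ⟨u, -, -, -, -, -, hr⟩⟩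
      · rw [hr.val 3]
        exact lt_irrefl _
      · rw [hr.val 3]
        exact lt_irrefl _)
    (by
      rintro k m' hm' hpos
      obtain ⟨n, hn, e⟩ := (loopFree_tick (labelNum M ls) M.prog ls).exec_of_le
        (hspace _ _ hm') (C.growth_le _ (by simp [simBlocks]))
      refine ⟨n, hn, _, e, k, le_rfl, ?_⟩
      obtain ⟨hk, ⟨u, h1, h2, h3, h4, hr⟩ | ⟨u, -, -, -, -, -, hr⟩⟩ := hm'
      · refine ⟨by omega, ?_⟩
        have hd : simCells M ls w Q (Function.update t j u) j =
            cells (labelNum M ls) (M.conf w u) ((zoneEnd Q j : ℤ) - u) (zoneWidth Q j) := by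
          simp [simCells]
        rcases h2.eq_or_lt with hu | hu
        · left
          refine ⟨u, h1, h2, Or.inl hu, h4, ?_⟩
          have := hr.tick_idle (M := M) ls hj hd (by omega)
          rwa [show ((k + 1 : ℕ) : ℤ) - 1 = k by push_cast; ring] at this
        · have hr' := hr.tick_step (M := M) ls C.labels hj hd (by omega)
          rw [show ((k + 1 : ℕ) : ℤ) - 1 = k by push_cast; ring] at hr'
          have hr' := simCells_update (M := M) (ls := ls) (w := w) (Q := Q) t j u ▸ hr'
          by_cases hit : M.AtOutput (M.conf w u) ∧ ((zoneEnd Q j : ℤ) - u) ≤ zoneWidth Q j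
          · right
            -- This translates the comparison of counter and width into `zoneStart Q j ≤ u`.
            have hz := zoneStart_add_zoneWidth Q j
            refine ⟨u, h1, hu, by omega, hit.1, h4, ?_⟩
            simp only [regsAfter, if_pos hit] at hr'
            exact_mod_cast hr'
          · left
            simp only [regsAfter, if_neg hit] at hr'
            refine ⟨u + 1, by omega, hu, ?_, ?_, hr'⟩
            · rcases h3 with h3 | h3
              · omega
              · right
                omega
            · intro s' hs1 hs2 hs3 hs4
              rcases (Nat.lt_succ_iff.1 hs2).lt_or_eq with hlt | rfl
              · exact h4 s' hs1 hlt hs3 hs4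
              -- An output at `u` itself, inside the zone, would have been a hit.
              · have hz := zoneStart_add_zoneWidth Q j
                exact hit ⟨hs4, by omega⟩
      · rw [hr.val 3] at hpos
        exact absurd hpos (lt_irrefl _))
    (2 * Q) m ⟨le_rfl, Or.inl ⟨t j, le_rfl, ht j hj, Or.inr (by omega), fun s' h1 h2 => by omega, by
      rw [Function.update_eq_self]
      exact h⟩⟩
  refine ⟨n, hn, m', e, ?_⟩
  rcases hres with ⟨u, h1, h2, h3, h4, hr⟩ | ⟨u, h1, h2, h3, h4, h5, hr⟩
  · left
    rw [hr.val 3] at hg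
    obtain rfl : k = 0 := by
      have hg : ¬ (0 : ℤ) < k := hg
      omega
    exact ⟨u, ⟨h1, h2, h3, h4⟩, hr⟩
  · exact Or.inr ⟨u, h1, h2, h3, h4, h5, hr⟩

end

/-! ### The complete search, the copying of an output and the initialization. -/

section

variable {M : RAM} {ls : List M.Label} {w : List ℤ} {K e Q s P S : ℕ}

namespace SimContext

/-- A bound on the number of steps of a search. -/
def searchTime (T Q : ℕ) : ℕ := 3 + (Q * ((2 + (2 * Q * (T + 1) + 1)) + 1) + 1)

theorem exec_search (C : SimContext M ls K e w Q s P S) {o : ℕ → ℤ} (ho : OutBound Q P o)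
    {t₀ : ℕ → ℕ} (ht₀ : ∀ j < Q, t₀ j ≤ zoneEnd Q j) {x2 x3 x4 : ℤ} {m : Memory}
    (hx : ∀ z ∈ [x2, x3, x4, 0, 0], bits z ≤ P)
    (h : Rep w Q (regs w Q x2 x3 x4 0 0 0 0 0 0 0) (simCells M ls w Q t₀) o m) :
    ∃ n ≤ searchTime (tick (labelNum M ls) M.prog ls).size Q, ∃ m',
      Exec S (searchProg M ls) m n m' ∧
      ((∃ t, (∀ j < Q, Advance (outAt M w) Q j (t₀ j) (t j)) ∧
          Rep w Q (regs w Q 0 0 0 0 0 0 0 0 0 0) (simCells M ls w Q t) o m') ∨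
        ∃ t j u, Found (outAt M w) Q t₀ t j u ∧
          Rep w Q (regs w Q 0 0 (j + 1 : ℕ) 0 0 0 0 0 0 0) (simCells M ls w Q t) o m') := by
  have hP := C.le
  -- While nothing has been found, the processes from `k` on have advanced and those below `k` are
  -- untouched. After a hit both loop variables are `0`.
  let P' : ℕ → Memory → Prop := fun k m' => k ≤ Q ∧
    ((∃ t, (∀ j < Q, k ≤ j → Advance (outAt M w) Q j (t₀ j) (t j)) ∧ (∀ j < k, t j = t₀ j) ∧
        Rep w Q (regs w Q k (0 : ℕ) (0 : ℕ) 0 0 0 0 0 0 0) (simCells M ls w Q t) o m') ∨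
      ∃ t j u, Found (outAt M w) Q t₀ t j u ∧
        Rep w Q (regs w Q (0 : ℕ) (0 : ℕ) (j + 1 : ℕ) 0 0 0 0 0 0 0) (simCells M ls w Q t) o m')
  have hle : ∀ (k : ℕ) (t : ℕ → ℕ), (∀ j < Q, k ≤ j → Advance (outAt M w) Q j (t₀ j) (t j)) →
      (∀ j < k, t j = t₀ j) → ∀ j < Q, t j ≤ zoneEnd Q j := by
    intro k t h1 h2 j hj
    rcases lt_or_ge j k with hjk | hjk
    · rw [h2 j hjk]
      exact ht₀ j hj
    · exact (h1 j hj hjk).le_end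
  have hfound : ∀ t j u, Found (outAt M w) Q t₀ t j u → ∀ i < Q, t i ≤ zoneEnd Q i := by
    intro t j u hf i hi
    rcases lt_trichotomy i j with hij | rfl | hij
    · rw [hf.below i hij]
      exact ht₀ i hi
    · rw [hf.pos]
      exact hf.lt_end
    · exact (hf.above i hij hi).le_end
  have hspace : ∀ k m', P' k m' → memSpace m' ≤ spaceBound w.length Q P := by
    rintro k m' ⟨hk, ⟨t, h1, h2, hr⟩ | ⟨t, j, u, hf, hr⟩⟩
    · exact C.memSpace_le_sim ho (by omega) (by omega) (by omega) (hle k t h1 h2) hr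
    · have := hf.lt
      exact C.memSpace_le_sim ho (by omega) (by omega) (by omega) (hfound t j u hf) hr
  obtain ⟨n₀, hn₀, e₀⟩ := (show searchInit.LoopFree from ⟨trivial, trivial, trivial⟩).exec_of_le
    (C.memSpace_le ho hx (fun j hj => C.cellBound hj (ht₀ j hj)) h)
    (C.growth_le _ (by simp [simBlocks]))
  have r₀ := ((h.moveW 2 1).moveC 3 0).moveC 4 0
  obtain ⟨n, hn, m', e, ⟨k, hk, hres⟩, hg⟩ := exec_loop (S := S)
    (N := 2 + (2 * Q * ((tick (labelNum M ls) M.prog ls).size + 1) + 1)) (a := wVal 2)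
    (p := .seq searchNext (advanceProg M ls)) P' (fun k m' hm' => (hspace k m' hm').trans
      C.spaceBound_le)
    (by
      rintro m' ⟨-, ⟨t, -, -, hr⟩ | ⟨t, j, u, -, hr⟩⟩
      · rw [hr.val 2]
        exact lt_irrefl _
      · rw [hr.val 2]
        exact lt_irrefl _)
    (by
      rintro k m' hm' hpos
      obtain ⟨n₁, hn₁, e₁⟩ := (show searchNext.LoopFree from ⟨trivial, trivial⟩).exec_of_le
        (hspace _ _ hm') (C.growth_le _ (by simp [simBlocks]))
      obtain ⟨hk, ⟨t, h1, h2, hr⟩ | ⟨t, j, u, -, hr⟩⟩ := hm'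
      · have hr' : Rep w Q (regs w Q ((k + 1 : ℕ) - 1 : ℤ) ((Q : ℤ) + Q) 0 0 0 0 0 0 0 0)
            (simCells M ls w Q t) o _ := (hr.subC 2 2 1).addW 3 1 1
        rw [show ((k + 1 : ℕ) - 1 : ℤ) = k by push_cast; ring,
          show (Q : ℤ) + Q = (2 * Q : ℕ) by push_cast; ring] at hr'
        obtain ⟨n₂, hn₂, m'', e₂, hres⟩ := C.exec_advance ho (hle _ t h1 h2)
          (show k < Q by omega) hr'
        refine ⟨n₁ + n₂, Nat.add_le_add hn₁ hn₂, m'', .seq e₁ e₂, k, le_rfl, by omega, ?_⟩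
        rcases hres with ⟨u, ha, hr''⟩ | ⟨u, g1, g2, g3, g4, g5, hr''⟩
        · left
          rw [h2 k (by omega)] at ha
          refine ⟨_, fun j hj hkj => ?_, fun j hj => ?_, hr''⟩
          · rcases hkj.eq_or_lt with rfl | hlt
            · simpa using ha
            · rw [Function.update_of_ne hlt.ne']
              exact h1 j hj hlt
          · rw [Function.update_of_ne hj.ne]
            exact h2 j (by omega)
        · right
          rw [h2 k (by omega)] at g1 g5
          refine ⟨_, k, u, ⟨by omega, fun i hki hi => ?_, fun i hi => ?_, by simp, g1, g2, g3, g4,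
            g5⟩, hr''⟩
          · rw [Function.update_of_ne hki.ne']
            exact h1 i hi hki
          · rw [Function.update_of_ne hi.ne]
            exact h2 i (by omega)
      · rw [hr.val 2] at hpos
        exact absurd hpos (lt_irrefl _))
    Q (searchInit.den m) ⟨le_rfl, Or.inl ⟨t₀, fun j hj hQj => by omega, fun j _ => rfl, r₀⟩⟩
  refine ⟨n₀ + n, Nat.add_le_add hn₀ hn, m', .seq e₀ e, ?_⟩
  rcases hres with ⟨t, h1, h2, hr⟩ | ⟨t, j, u, hf, hr⟩
  · left
    rw [hr.val 2] at hg
    obtain rfl : k = 0 := by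
      have hg : ¬ (0 : ℤ) < k := hg
      omega
    exact ⟨t, fun j hj => h1 j hj (Nat.zero_le _), hr⟩
  · exact Or.inr ⟨t, j, u, hf, hr⟩

/-! ### Copying an output -/

/-- A bound on the number of steps for copying an output. -/
def copyTime (Q : ℕ) : ℕ := copyInit.size + (Q * (copyStep.size + 1) + 1)

/-- Letters are copied from the last to the first. Output registers beyond the length of the word
keep the letters of earlier outputs; `outputWord` does not read them, and those up to address `Q`
are allowed for by `OutBound`. -/
theorem exec_copy (C : SimContext M ls K e w Q s P S) {o : ℕ → ℤ} (ho : OutBound Q P o)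
    {t : ℕ → ℕ} (ht : ∀ j < Q, t j ≤ zoneEnd Q j) {j : ℕ} (hj : j < Q) {m : Memory}
    (hlen : (outputWord (M.conf w (t j)).mem).length ≤ Q)
    (h : Rep w Q (regs w Q 0 0 (j + 1 : ℕ) 0 0 0 0 0 0 0) (simCells M ls w Q t) o m) :
    ∃ n ≤ copyTime Q, ∃ m', Exec S copyProg m n m' ∧
      ∃ o' x3, bits x3 ≤ P ∧ OutBound Q P o' ∧
        Rep w Q (regs w Q j x3 (j + 1 : ℕ) 0 0 0 0 0 0 0) (simCells M ls w Q t) o' m' ∧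
        ∀ m'' : Memory, (∀ i, m'' (Bank.out, i) = o' i) →
          outputWord m'' = outputWord (M.conf w (t j)).mem := by
  have hP := C.le
  set c := M.conf w (t j) with hc
  have hlen' : (c.mem (Bank.out, 0)).toNat ≤ Q := by simpa [outputWord] using hlen
  set l := (c.mem (Bank.out, 0)).toNat with hl
  have hbits : ∀ r, bits (c.mem r) ≤ P := by
    intro r
    have h1 := bits_le_memSpace c.mem r
    have h2 := C.space (t j)
    rw [Cfg.space_eq] at h2
    rw [← hc] at h2
    omega
  have hcell : ∀ i, simCells M ls w Q t j (4 * i + 2) = c.mem (Bank.out, i) := fun i =>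
    cells_reg Bank.out i
  -- The second alternative for `x3` is needed because the length register of the process may hold a
  -- negative number, which stands for the empty word.
  let P' : ℕ → Memory → Prop := fun k m' => k ≤ l ∧ ∃ o' x3, bits x3 ≤ P ∧
    (x3 = k ∨ (k = 0 ∧ x3 ≤ 0)) ∧ OutBound Q P o' ∧ o' 0 = c.mem (Bank.out, 0) ∧
    (∀ i, k < i → i ≤ l → o' i = c.mem (Bank.out, i)) ∧
    Rep w Q (regs w Q j x3 (j + 1 : ℕ) 0 0 0 0 0 0 0) (simCells M ls w Q t) o' m'
  have hspace : ∀ k m', P' k m' → memSpace m' ≤ spaceBound w.length Q P := by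
    rintro k m' ⟨hk, o', x3, hx, -, ho', -, -, hr⟩
    refine C.memSpace_le ho' ?_ (fun j hj => C.cellBound hj (ht j hj)) hr
    simp only [List.forall_mem_cons]
    exact ⟨(bits_natCast_le _).trans (by omega), hx, (bits_natCast_le _).trans (by omega),
      by simp, by simp, by simp⟩
  have hupd : ∀ o' : ℕ → ℤ, OutBound Q P o' → ∀ i ≤ Q,
      OutBound Q P (Function.update o' i (c.mem (Bank.out, i))) := by
    intro o' ho' i hi
    refine ⟨fun i' hi' => ?_, fun i' => ?_⟩
    · rw [Function.update_of_ne (by omega)]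
      exact ho'.eq_zero i' hi'
    · rw [Function.update_apply]
      split_ifs
      · exact hbits _
      · exact ho'.bits_le i'
  obtain ⟨n₀, hn₀, e₀⟩ := (show copyInit.LoopFree from
      ⟨trivial, loopFree_getCell _ _, trivial, trivial, trivial, trivial, trivial, trivial,
        trivial⟩).exec_of_le
    (C.memSpace_le_sim (x2 := 0) (x3 := 0) ho (by omega) (by omega) (by omega) ht h)
    (C.growth_le _ (by simp [simBlocks]))
  have r₀ : P' l (copyInit.den m) := by
    have h1 : Rep w Q (regs w Q ((j + 1 : ℕ) - 1 : ℤ) 0 (j + 1 : ℕ) 0 0 0 0 0 0 0)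
        (simCells M ls w Q t) o _ := h.subC 2 4 1
    rw [show ((j + 1 : ℕ) - 1 : ℤ) = j by push_cast; ring] at h1
    obtain ⟨y, h2⟩ := h1.getCell6 2 hj
    rw [show simCells M ls w Q t j 2 = c.mem (Bank.out, 0) from hcell 0] at h2
    have h3 := h2.moveW 3 6
    have h4 := h3.storeOutDir 0 6
    refine ⟨le_rfl, _, _, hbits (Bank.out, 0), ?_, hupd o ho 0 (Nat.zero_le _), by simp,
      fun i hi hil => by omega, Rep.clearProg h4⟩
    rcases le_or_gt 0 (c.mem (Bank.out, 0)) with hn | hn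
    · left
      omega
    · right
      omega
  obtain ⟨n, hn, m', e, ⟨k, hk, o', x3, hx, hx3, ho', h0, hi, hr⟩, hg⟩ := exec_loop (S := S)
    (N := copyStep.size) (a := wVal 3) (p := copyStep) P'
    (fun k m' hm' => (hspace k m' hm').trans C.spaceBound_le)
    (by
      rintro m' ⟨-, o', x3, -, hx3, -, -, -, hr⟩
      rw [hr.val 3]
      have : ¬ 0 < x3 := by omega
      exact this)
    (by
      rintro k m' hm' hpos
      obtain ⟨n₁, hn₁, e₁⟩ := (show copyStep.LoopFree from
        ⟨trivial, trivial, ⟨trivial, trivial, trivial⟩, trivial, trivial, trivial, trivial, trivial,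
          trivial, trivial, trivial⟩).exec_of_le
        (hspace _ _ hm') (C.growth_le _ (by simp [simBlocks]))
      refine ⟨n₁, hn₁, _, e₁, k, le_rfl, ?_⟩
      obtain ⟨hk, o', x3, -, hx3, ho', h0, hi, hr⟩ := hm'
      obtain rfl : x3 = (k + 1 : ℕ) := by omega
      have h1 : Rep w Q (regs w Q j (k + 1 : ℕ) (j + 1 : ℕ) ((k + 1 : ℕ) * 4 + 2) 0 0 0 0 0 0)
        (simCells M ls w Q t) o' _ := (hr.mulC 5 3 4).addC 5 5 2
      rw [show ((k + 1 : ℕ) * 4 + 2 : ℤ) = (4 * (k + 1) + 2 : ℕ) by push_cast; ring] at h1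
      have h2 := Rep.loadCell h1.cellAddr 6 5 hj rfl
      rw [hcell] at h2
      have h3 := h2.storeOut 3 6 (c := k + 1) rfl
      have h4 : Rep w Q (regs w Q j ((k + 1 : ℕ) - 1) (j + 1 : ℕ) 0 0 0 0 0 0 0)
        (simCells M ls w Q t) (Function.update o' (k + 1) (c.mem (Bank.out, k + 1))) _ :=
        Rep.clearProg (h3.subC 3 3 1)
      rw [show ((k + 1 : ℕ) - 1 : ℤ) = k by push_cast; ring] at h4
      refine ⟨by omega, _, _, (bits_natCast_le _).trans (by omega), Or.inl rfl,
        hupd o' ho' (k + 1) (by omega), ?_, fun i hki hil => ?_, h4⟩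
      · rw [Function.update_of_ne (by omega), h0]
      · rw [Function.update_apply]
        split_ifs with hik
        · rw [hik]
        · exact hi i (by omega) hil)
    l (copyInit.den m) r₀
  refine ⟨n₀ + n, ?_, m', .seq e₀ e, o', x3, hx, ho', hr, fun m'' hm'' => ?_⟩
  · have : l * (copyStep.size + 1) ≤ Q * (copyStep.size + 1) := Nat.mul_le_mul_right _ hlen'
    rw [copyTime]
    omega
  · have hk0 : k = 0 := by
      rw [hr.val 3] at hg
      have hg : ¬ 0 < x3 := hg
      omega
    subst hk0
    rw [outputWord, outputWord, hm'', h0, ← hl]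
    refine List.map_congr_left fun i hi' => ?_
    rw [hm'', hi (i + 1) (by omega) (by simpa using hi')]

/-! ### Initialization -/

theorem _root_.EnumRAM.Rep.powProg {a b : ℤ} {v : List ℤ} {d : ℕ → ℕ → ℤ} {o : ℕ → ℤ}
    {m : Memory} (e : ℕ) (h : Rep w Q (a :: b :: v) d o m) :
    Rep w Q (a :: (b * a ^ e) :: v) d o ((powProg e).den m) := by
  induction e generalizing b m with
  | zero =>
    have := h.mulC 1 1 1
    rw [pow_zero]
    exact this
  | succ e ih =>
    have := ih (h.mulW 1 1 0)
    rw [pow_succ', ← mul_assoc]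
    exact this

theorem _root_.EnumRAM.load_apply (w : List ℤ) (b : Bank) (i : ℕ) :
    load w (b, i) = if b = Bank.inp then w.getD i 0 else 0 := rfl

theorem rep_load (w : List ℤ) (Q : ℕ) :
    Rep w Q [0, 0, 0, 0, 0, 0, 0, 0, 0, 0, 0, 0] (fun _ _ => 0) (fun _ => 0) (load w) := by
  refine ⟨fun i => ?_, fun i _ => by simp [load_apply], fun j _ k => ?_,
    fun i => by simp [load_apply]⟩
  · rw [load_apply, if_neg (by simp)]
    rcases lt_or_ge i 12 with hi | hi
    · interval_cases i <;> rfl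
    · rw [List.getD_eq_default _ _ hi]
  · rw [load_apply, if_pos rfl, List.getD_eq_default _ _ (by omega)]

/-- The first input register is one less than the number of input registers, so register `0` becomes
the address where the cells start, and its `e`-th power times `K` is the number of processes. -/
theorem rep_initVars (C : SimContext M ls K e w Q s P S) :
    Rep w Q (regs w Q 0 Q 0 0 0 0 0 0 Q Q) (fun _ _ => 0) (fun _ => 0)
      ((initVars K e).den (load w)) := by
  have h1 : Rep w Q [(w.length : ℤ), 0, 0, 0, 0, 0, 0, 0, 0, 0, 0, 0] (fun _ _ => 0) (fun _ => 0)
      ((Prog.op (.add (wLoc 0) (.loc (.dir .inp 0)) (.const 1))).den (load w)) := by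
    have := (rep_load w Q).updateWork 0 (w.getD 0 0 + 1) rfl
    rw [C.head] at this
    have hv : (Operand.loc (.dir .inp 0)).val (load w) + (Operand.const 1).val (load w) =
        (w.length : ℤ) := C.head
    rw [Prog.den, Op.run, hv]
    exact this
  have h2 := Rep.powProg e (h1.moveC 1 K)
  have hQ : (K : ℤ) * (w.length : ℤ) ^ e = Q := by
    rw [C.eq]
    push_cast
    rfl
  rw [hQ] at h2
  exact ((h2.moveW 3 1).moveW 10 1).moveW 11 1

/-- The cells of a process during the initialization: the registers of the input bank from address
`i` on have been copied. -/
def partCells (i : ℕ) (f : ℕ → ℤ) (k : ℕ) : ℤ := if k % 4 = 0 ∧ k / 4 < i then 0 else f k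

theorem partCells_zero (f : ℕ → ℤ) : partCells 0 f = f := by
  ext k
  simp [partCells]

/-- The input is copied from the highest address down: one more copied register lowers the threshold
by one. -/
theorem update_partCells (i : ℕ) (f : ℕ → ℤ) :
    Function.update (partCells (i + 1) f) (4 * i) (f (4 * i)) = partCells i f := by
  ext k
  rw [Function.update_apply]
  unfold partCells
  split_ifs with h1 h2 h3 h3
  · omega
  · rw [h1]
  · rfl
  · omega
  · omega
  · rfl

theorem partCells_length {L : Type} (num : L → ℕ) (l : L) (cnt wid : ℤ) :
    Function.update (Function.update (Function.update (fun _ => 0) 7 cnt) 11 wid) 3 (num l : ℤ) =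
      partCells w.length (cells num ⟨l, load w⟩ cnt wid) := by
  ext k
  simp only [Function.update_apply, partCells, cells, load_apply]
  by_cases h0 : k % 4 = 0
  · by_cases hk : k / 4 < w.length
    · simp [h0, hk, show k ≠ 3 by omega, show k ≠ 7 by omega, show k ≠ 11 by omega]
    · simp [h0, hk, show k ≠ 3 by omega, show k ≠ 7 by omega, show k ≠ 11 by omega]
  · simp only [h0, false_and, if_false]
    split_ifs <;> first | rfl | omega | simp_all

/-- The cells during the initialization of process `j`. -/
def initCellsOf (M : RAM) (ls : List M.Label) (w : List ℤ) (Q j : ℕ) (f : ℕ → ℤ) :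
    ℕ → ℕ → ℤ := fun i => if i < j then simCells M ls w Q (fun _ => 0) i else
  if i = j then f else fun _ => 0

theorem initCellsOf_succ (j : ℕ) :
    initCellsOf M ls w Q j (simCells M ls w Q (fun _ => 0) j) =
      initCellsOf M ls w Q (j + 1) (fun _ => 0) := by
  ext i k
  unfold initCellsOf
  split_ifs <;> first | rfl | omega | simp_all

theorem setCell_initCellsOf (j k : ℕ) (f : ℕ → ℤ) (z : ℤ) :
    setCell (initCellsOf M ls w Q j f) j k z =
      initCellsOf M ls w Q j (Function.update f k z) := by
  ext i k'
  by_cases hi : i = j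
  · subst hi
    simp [setCell, initCellsOf]
  · simp [setCell, initCellsOf, hi]

theorem cellBound_zero (P : ℕ) : CellBound (fun _ => 0) P := ⟨∅, fun _ _ => rfl, by simp⟩

theorem cellBound_initCellsOf (C : SimContext M ls K e w Q s P S) {j : ℕ} {f : ℕ → ℤ}
    (hf : CellBound f P) : ∀ i < Q, CellBound (initCellsOf M ls w Q j f i) P := by
  intro i hi
  unfold initCellsOf
  split_ifs
  · exact C.cellBound (t := fun _ => 0) hi (Nat.zero_le _)
  · exact hf
  · exact cellBound_zero P

theorem outBound_zero (Q P : ℕ) : OutBound Q P fun _ => 0 :=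
  ⟨fun _ _ => rfl, fun _ => Nat.zero_le _⟩

/-- The cells of process `j` before its first step. -/
theorem simCells_zero (j : ℕ) : simCells M ls w Q (fun _ => 0) j =
    cells (labelNum M ls) ⟨M.start, load w⟩ (zoneEnd Q j) (zoneWidth Q j) := by
  simp [simCells, RAM.conf]

/-- Registers `10` and `11` carry the width and the end of the current zone. The next zone has the
present end as its width and twice the present end as its end. -/
theorem rep_initCells {j : ℕ} (hj : j < Q) {x3 x4 x10 x11 : ℤ} {o : ℕ → ℤ} {m : Memory}
    (h10 : x10 = zoneWidth Q j) (h11 : x11 = zoneEnd Q j)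
    (h : Rep w Q (regs w Q j x3 x4 0 0 0 0 0 x10 x11)
      (initCellsOf M ls w Q j fun _ => 0) o m) :
    Rep w Q (regs w Q j x3 w.length 0 0 0 0 0 (zoneWidth Q (j + 1)) (zoneEnd Q (j + 1)))
      (initCellsOf M ls w Q j (partCells w.length (simCells M ls w Q (fun _ => 0) j))) o
      ((initCells M ls).den m) := by
  obtain ⟨y1, h1⟩ := h.putCell11 7 hj
  obtain ⟨y2, h2⟩ := h1.putCell10 11 hj
  obtain ⟨y3, h3⟩ := h2.putCellC 3 (labelNum M ls M.start : ℤ) hj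
  rw [setCell_initCellsOf, setCell_initCellsOf, setCell_initCellsOf, partCells_length, h10, h11,
    ← simCells_zero] at h3
  have h4 := Rep.clearProg (((h3.moveW 10 11).addW 11 11 11).moveW 4 0)
  rw [show (zoneEnd Q (j + 1) : ℤ) = (zoneEnd Q j : ℤ) + zoneEnd Q j by
    rw [zoneEnd, zoneEnd, pow_succ]
    push_cast
    ring]
  exact h4

theorem rep_initCopy {j : ℕ} (hj : j < Q) {i : ℕ} (hi : i < w.length) {x3 x10 x11 : ℤ}
    {o : ℕ → ℤ} {m : Memory}
    (h : Rep w Q (regs w Q j x3 (i + 1 : ℕ) 0 0 0 0 0 x10 x11)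
      (initCellsOf M ls w Q j (partCells (i + 1) (simCells M ls w Q (fun _ => 0) j))) o m) :
    Rep w Q (regs w Q j x3 i 0 0 0 0 0 x10 x11)
      (initCellsOf M ls w Q j (partCells i (simCells M ls w Q (fun _ => 0) j))) o
      (initCopy.den m) := by
  have h1 : Rep w Q (regs w Q j x3 ((i + 1 : ℕ) - 1) 0 0 0 0 0 x10 x11) _ o _ := h.subC 4 4 1
  rw [show ((i + 1 : ℕ) - 1 : ℤ) = i by push_cast; ring] at h1
  have h2 : Rep w Q (regs w Q j x3 i (i * 4) (w.getD i 0) 0 0 0 x10 x11) _ o _ :=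
    (h1.loadInp 6 4 hi rfl).mulC 5 4 4
  rw [show (i * 4 : ℤ) = (4 * i : ℕ) by push_cast; ring] at h2
  have h3 := (h2.cellAddr).storeCell 5 6 hj rfl
  have hv : w.getD i 0 = simCells M ls w Q (fun _ => 0) j (4 * i) := by
    rw [simCells_zero]
    exact (cells_reg (c := ⟨M.start, load w⟩) Bank.inp i).symm
  rw [setCell_initCellsOf, show (regs w Q j x3 i _ (w.getD i 0) 0 0 0 x10 x11).getD 6 0 =
    w.getD i 0 from rfl, hv, update_partCells] at h3
  exact Rep.clearProg h3

/-- A bound on the number of steps of the initialization. -/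
def initTime (b₁ b₂ b₃ b₄ b₅ l Q : ℕ) : ℕ :=
  b₁ + ((Q * ((b₂ + ((l * (b₃ + 1) + 1) + b₄)) + 1) + 1) + b₅)

theorem loopFree_powProg (e : ℕ) : (powProg e).LoopFree := by
  induction e with
  | zero => trivial
  | succ e ih => exact ⟨trivial, ih⟩

theorem exec_initCopy (C : SimContext M ls K e w Q s P S) {j : ℕ} (hj : j < Q) {x3 : ℕ}
    (hx3 : x3 ≤ Q) {m : Memory}
    (h : Rep w Q (regs w Q j x3 w.length 0 0 0 0 0 (zoneWidth Q (j + 1)) (zoneEnd Q (j + 1)))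
      (initCellsOf M ls w Q j (partCells w.length (simCells M ls w Q (fun _ => 0) j)))
      (fun _ => 0) m) :
    ∃ n ≤ w.length * (initCopy.size + 1) + 1, ∃ m', Exec S (.loop (wVal 4) initCopy) m n m' ∧
      Rep w Q (regs w Q j x3 (0 : ℕ) 0 0 0 0 0 (zoneWidth Q (j + 1)) (zoneEnd Q (j + 1)))
        (initCellsOf M ls w Q (j + 1) fun _ => 0) (fun _ => 0) m' := by
  have hP := C.le
  let P' : ℕ → Memory → Prop := fun i m' => i ≤ w.length ∧
    Rep w Q (regs w Q j x3 i 0 0 0 0 0 (zoneWidth Q (j + 1)) (zoneEnd Q (j + 1)))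
      (initCellsOf M ls w Q j (partCells i (simCells M ls w Q (fun _ => 0) j))) (fun _ => 0) m'
  have hspace : ∀ i m', P' i m' → memSpace m' ≤ spaceBound w.length Q P := by
    rintro i m' ⟨hi, hr⟩
    refine C.memSpace_le (outBound_zero Q P) ?_ (C.cellBound_initCellsOf
      ((C.cellBound (t := fun _ => 0) hj (Nat.zero_le _)).of_eq_or_eq_zero fun k => ?_)) hr
    · have h1 := bits_zoneEnd_le (Q := Q) (j := j + 1) hj (z := zoneWidth Q (j + 1)) (by omega)
        (by exact_mod_cast zoneWidth_le Q (j + 1))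
      have h2 := bits_zoneEnd_le (Q := Q) (j := j + 1) hj (z := zoneEnd Q (j + 1)) (by omega)
        le_rfl
      simp only [List.forall_mem_cons]
      exact ⟨(bits_natCast_le _).trans (by omega), (bits_natCast_le _).trans (by omega),
        (bits_natCast_le _).trans (by omega), by omega, by omega, by simp⟩
    · unfold partCells
      split_ifs
      · exact Or.inr rfl
      · exact Or.inl rfl
  obtain ⟨n, hn, m', e, ⟨i, hi, hr⟩, hg⟩ := exec_loop (S := S) (N := initCopy.size)
    (a := wVal 4) (p := initCopy) P' (fun k m' hm' => (hspace k m' hm').trans C.spaceBound_le)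
    (by
      rintro m' ⟨-, hr⟩
      rw [hr.val 4]
      exact lt_irrefl _)
    (by
      rintro i m' hm' -
      obtain ⟨n, hn, e⟩ := (show initCopy.LoopFree from ⟨trivial, trivial, trivial,
        ⟨trivial, trivial, trivial⟩, trivial, trivial, trivial, trivial, trivial,
          trivial⟩).exec_of_le (hspace _ _ hm') (C.growth_le _ (by simp [simBlocks]))
      exact ⟨n, hn, _, e, i, le_rfl, by have := hm'.1; omega,
        rep_initCopy hj (by have := hm'.1; omega) hm'.2⟩)
    w.length m ⟨le_rfl, h⟩
  rw [hr.val 4] at hg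
  obtain rfl : i = 0 := by
    have hg : ¬ (0 : ℤ) < i := hg
    omega
  rw [partCells_zero, initCellsOf_succ] at hr
  exact ⟨n, hn, m', e, hr⟩

theorem exec_init (C : SimContext M ls K e w Q s P S) :
    ∃ n ≤ initTime (initVars K e).size (initCells M ls).size initCopy.size initNext.size
      initEnd.size w.length Q, ∃ m', Exec S (initProg M ls K e) (load w) n m' ∧
      Rep w Q (regs w Q Q 0 0 0 0 0 0 0 0 0) (simCells M ls w Q fun _ => 0) (fun _ => 0) m' := by
  have hP := C.le
  let P' : ℕ → Memory → Prop := fun k m' => ∃ j, j + k = Q ∧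
    Rep w Q (regs w Q j k (0 : ℕ) 0 0 0 0 0 (zoneWidth Q j) (zoneEnd Q j))
      (initCellsOf M ls w Q j fun _ => 0) (fun _ => 0) m'
  have hregs : ∀ j ≤ Q, ∀ k ≤ Q, ∀ l ≤ w.length, ∀ z ∈ [(j : ℤ), k, l, zoneWidth Q j, zoneEnd Q j],
      bits z ≤ P := by
    intro j hj k hk l hl
    have h1 := bits_zoneEnd_le (Q := Q) hj (z := zoneWidth Q j) (by omega)
      (by exact_mod_cast zoneWidth_le Q j)
    have h2 := bits_zoneEnd_le (Q := Q) hj (z := zoneEnd Q j) (by omega) le_rfl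
    simp only [List.forall_mem_cons]
    exact ⟨(bits_natCast_le _).trans (by omega), (bits_natCast_le _).trans (by omega),
      (bits_natCast_le _).trans (by omega), by omega, by omega, by simp⟩
  have hspace : ∀ k m', P' k m' → memSpace m' ≤ spaceBound w.length Q P := by
    rintro k m' ⟨j, hj, hr⟩
    exact C.memSpace_le (outBound_zero Q P) (hregs j (by omega) k (by omega) 0 (Nat.zero_le _))
      (C.cellBound_initCellsOf (cellBound_zero P)) hr
  have hload : memSpace (load w) ≤ spaceBound w.length Q P := by
    refine (rep_load w Q).memSpace_le C.pos ⟨?_, le_rfl, C.inp, fun j _ => cellBound_zero P,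
      fun _ _ => rfl, fun _ => Nat.zero_le _⟩
    simp
  obtain ⟨n₀, hn₀, e₀⟩ := (show (initVars K e).LoopFree from ⟨trivial, trivial,
    loopFree_powProg e, trivial, trivial, trivial⟩).exec_of_le hload
    (C.growth_le _ (by simp [simBlocks]))
  have r₀ : P' Q ((initVars K e).den (load w)) := by
    refine ⟨0, by omega, ?_⟩
    have := C.rep_initVars
    rw [show (zoneWidth Q 0 : ℤ) = Q by simp [zoneWidth],
      show (zoneEnd Q 0 : ℤ) = Q by simp [zoneEnd]]
    refine this.congr_data fun j hj => ?_
    simp [initCellsOf]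
  obtain ⟨n₁, hn₁, m₁, e₁, ⟨k, j, hjk, hr⟩, hg⟩ := exec_loop (S := S)
    (N := (initCells M ls).size + ((w.length * (initCopy.size + 1) + 1) + initNext.size))
    (a := wVal 3) (p := .seq (initCells M ls) (.seq (.loop (wVal 4) initCopy) initNext)) P'
    (fun k m' hm' => (hspace k m' hm').trans C.spaceBound_le)
    (by
      rintro m' ⟨j, -, hr⟩
      rw [hr.val 3]
      exact lt_irrefl _)
    (by
      rintro k m' hm' -
      obtain ⟨n₁, hn₁, e₁⟩ := (show (initCells M ls).LoopFree from ⟨loopFree_putCell _ _,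
        loopFree_putCell _ _, loopFree_putCell _ _, trivial, trivial, trivial, trivial, trivial,
        trivial, trivial, trivial⟩).exec_of_le (hspace _ _ hm')
        (C.growth_le _ (by simp [simBlocks]))
      obtain ⟨j, hjk, hr⟩ := hm'
      have hj : j < Q := by omega
      have h1 := rep_initCells hj rfl rfl hr
      obtain ⟨n₂, hn₂, m₂, e₂, h2⟩ := C.exec_initCopy hj (by omega) h1
      have hs := C.memSpace_le (outBound_zero Q P) (by
        simpa only [List.forall_mem_cons] using
          (⟨(bits_natCast_le j).trans (by omega), (hregs (j + 1) hj (k + 1) (by omega) 0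
            (Nat.zero_le _) _ (by simp)), (hregs (j + 1) hj (k + 1) (by omega) 0
            (Nat.zero_le _) _ (by simp)), (hregs (j + 1) hj (k + 1) (by omega) 0
            (Nat.zero_le _) _ (by simp)), (hregs (j + 1) hj (k + 1) (by omega) 0
            (Nat.zero_le _) _ (by simp)), by simp⟩ : bits (j : ℤ) ≤ P ∧ bits ((k + 1 : ℕ) : ℤ) ≤ P ∧
              bits ((0 : ℕ) : ℤ) ≤ P ∧ bits (zoneWidth Q (j + 1) : ℤ) ≤ P ∧
              bits (zoneEnd Q (j + 1) : ℤ) ≤ P ∧ ∀ z ∈ ([] : List ℤ), bits z ≤ P))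
        (C.cellBound_initCellsOf (cellBound_zero P)) h2
      obtain ⟨n₃, hn₃, e₃⟩ := (show initNext.LoopFree from ⟨trivial, trivial⟩).exec_of_le hs
        (C.growth_le _ (by simp [simBlocks]))
      have h3 := (h2.addC 2 2 1).subC 3 3 1
      refine ⟨n₁ + (n₂ + n₃), by omega, _, .seq e₁ (.seq e₂ e₃), k, le_rfl, j + 1, by omega, ?_⟩
      rw [show (k : ℤ) = (k + 1 : ℕ) - 1 by push_cast; ring, Nat.cast_succ j]
      exact h3)
    Q _ r₀
  rw [hr.val 3] at hg
  obtain rfl : k = 0 := by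
    have hg : ¬ (0 : ℤ) < k := hg
    omega
  obtain rfl : j = Q := by omega
  obtain ⟨n₂, hn₂, e₂⟩ := (show initEnd.LoopFree from ⟨trivial, trivial⟩).exec_of_le
    (hspace 0 m₁ ⟨j, hjk, hr⟩) (C.growth_le _ (by simp [simBlocks]))
  have h3 := (hr.moveC 10 0).moveC 11 0
  refine ⟨n₀ + (n₁ + n₂), by rw [initTime]; omega, _, .seq e₀ (.seq e₁ e₂), ?_⟩
  -- The two descriptions of the cells agree only for the indices of actual processes, which is all
  -- that `Rep` reads.
  refine Rep.congr_data h3 fun i hi => ?_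
  simp [initCellsOf, hi]

end SimContext

end

/-! ### The outputs of a machine that solves an enumeration problem -/

namespace RAM

variable {M : RAM} {A : Predicate}

/-- Before an output the machine has not halted, so every step costs at least `1`. This converts
bounds on the cost into bounds on the number of steps, the measure of time used for the zones. -/
theorem le_elapsed_of_atOutput {x : Word} {t : ℕ} (h : M.OutputsAt x t) :
    t ≤ M.elapsed (encode x) t := by
  have key : ∀ s ∈ Finset.range t, 1 ≤ M.cost (M.conf (encode x) s) := by
    intro s hs
    have hs := Finset.mem_range.1 hs
    rw [cost]
    cases hp : M.prog (M.conf (encode x) s).label with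
    | halt =>
      have hh : M.Halted (M.conf (encode x) s) := hp
      refine absurd h ?_
      rw [OutputsAt, conf_of_halted hh hs.le]
      exact not_atOutput_of_halted hh
    | _ => simp only; omega
  simpa [elapsed] using Finset.card_nsmul_le_sum _ _ 1 key

namespace Solves

theorem finite_outputs (h : M.Solves A) (x : Word) : {t | M.OutputsAt x t}.Finite := by
  obtain ⟨t, ht⟩ := h.halts x
  refine (Set.finite_Iio t).subset fun s hs => ?_
  by_contra hst
  have hs : M.AtOutput (M.conf (encode x) s) := hs
  rw [conf_of_halted ht (not_lt.1 hst)] at hs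
  exact not_atOutput_of_halted ht hs

theorem image_wordAt (h : M.Solves A) (x : Word) :
    M.wordAt x '' {t | M.OutputsAt x t} = A x := by
  ext y
  rw [h.produces x y]
  rfl

theorem finite (h : M.Solves A) (x : Word) : (A x).Finite := by
  rw [← h.image_wordAt x]
  exact (h.finite_outputs x).image _

theorem ncard_outputs (h : M.Solves A) (x : Word) :
    (h.finite_outputs x).toFinset.card = (A x).ncard := by
  have hinj : Set.InjOn (M.wordAt x) {t | M.OutputsAt x t} :=
    fun s hs t ht => h.distinct x s t hs ht
  rw [← h.image_wordAt x, hinj.ncard_image, Set.ncard_eq_toFinset_card _ (h.finite_outputs x)]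

open scoped Classical in
theorem count_le (h : M.Solves A) (x : Word) (t : ℕ) :
    Nat.count (M.OutputsAt x) t ≤ (A x).ncard := by
  rw [← h.ncard_outputs x, Nat.count_eq_card_filter_range]
  refine Finset.card_le_card fun s hs => ?_
  simpa using (Finset.mem_filter.1 hs).2

open scoped Classical in
theorem le_count (hM : M.Solves A) {x : Word} {h Q : ℕ}
    (hT : ∀ k ≤ (A x).ncard, M.T x k ≤ k * h) (hQ : h < Q) (K : ℕ) :
    min K (A x).ncard ≤ Nat.count (M.OutputsAt x) (K * Q) := by
  obtain ⟨k, hk⟩ : ∃ k, k = min K (A x).ncard := ⟨_, rfl⟩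
  rw [← hk]
  have hkK : k ≤ K := by omega
  have hkN : k ≤ (A x).ncard := by omega
  cases k with
  | zero => exact Nat.zero_le _
  | succ k =>
    have hcard : ∀ hf : (Set.ofPred (M.OutputsAt x)).Finite, k < hf.toFinset.card := by
      intro hf
      have := hM.ncard_outputs x
      exact lt_of_lt_of_eq (Nat.lt_of_succ_le hkN) this.symm
    have hmem := Nat.nth_mem k hcard
    have hcount := Nat.count_nth hcard
    have h1 := le_elapsed_of_atOutput hmem
    have h2 := hT (k + 1) hkN
    rw [T] at h2
    -- The strict inequality is needed: an output at step `t` is counted by `Nat.count` only from `t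
    -- + 1` on.
    have h3 : (k + 1) * h < K * Q := by
      calc (k + 1) * h < (k + 1) * Q := by gcongr
        _ ≤ K * Q := by gcongr
    have h4 : Nat.count (M.OutputsAt x) (Nat.nth (M.OutputsAt x) k + 1) = k + 1 := by
      rw [Nat.count_succ, hcount, if_pos hmem]
    rw [← h4]
    exact Nat.count_monotone _ (by omega)

end Solves

end RAM

/-- A word of length at most `r` is determined by its first `r` entries, each a letter or absent,
which leaves four possibilities per position. -/
theorem ncard_le_of_length_le {s : Set Word} {r : ℕ} (h : ∀ y ∈ s, y.length ≤ r) :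
    s.ncard ≤ 2 ^ (2 * r) := by
  let f : Word → (Fin r → Option Letter) := fun y i => y[(i : ℕ)]?
  have hf : Set.InjOn f s := by
    intro y hy z hz hyz
    refine List.ext_getElem? fun i => ?_
    rcases lt_or_ge i r with hi | hi
    · exact congrFun hyz ⟨i, hi⟩
    · rw [List.getElem?_eq_none ((h y hy).trans hi), List.getElem?_eq_none ((h z hz).trans hi)]
  have hcard : Nat.card (Fin r → Option Letter) = 2 ^ (2 * r) := by
    rw [Nat.card_eq_fintype_card, Fintype.card_fun, Fintype.card_fin, pow_mul]
    rfl
  rw [← hf.ncard_image, ← hcard, ← Set.ncard_univ]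
  exact Set.ncard_le_ncard (Set.subset_univ _)

theorem exists_eval_le (p : Polynomial ℕ) : ∃ K e, ∀ n, p.eval n ≤ K * (n + 1) ^ e := by
  refine ⟨∑ i ∈ Finset.range (p.natDegree + 1), p.coeff i, p.natDegree, fun n => ?_⟩
  rw [Polynomial.eval_eq_sum_range, Finset.sum_mul]
  refine Finset.sum_le_sum fun i hi => ?_
  have hi := Finset.mem_range.1 hi
  refine Nat.mul_le_mul_left _ ?_
  calc n ^ i ≤ (n + 1) ^ i := Nat.pow_le_pow_left (by omega) i
    _ ≤ (n + 1) ^ p.natDegree := Nat.pow_le_pow_right (by omega) (by omega)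

/-! ### Sequences of memories -/

/-- `J l m` is an invariant of the enumeration, `l` being the list of the words produced so far. The
induction is on a bound `k` for the number of missing words; freshness of each word gives
termination and distinctness. -/
theorem exists_sequence {A : Set Word} (hA : A.Finite) {D S : ℕ} {H : Prog} {a : Operand}
    (J : List Word → Memory → Prop) (hS : ∀ l m, J l m → memSpace m ≤ S)
    (hdone : ∀ l m, J l m → a.val m = 0 → ∀ y, y ∈ A ↔ y ∈ l)
    (hnext : ∀ l m, J l m → a.val m ≠ 0 → ∃ y ∈ A, y ∉ l ∧ ∃ m', (∃ n ≤ D, Exec S H m n m') ∧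
      outputWord m' = y ∧ J (y :: l) m') (k : ℕ) (l : List Word) (m : Memory) (h : J l m)
    (hl : l.Nodup) (hlA : ∀ y ∈ l, y ∈ A) (hk : A.ncard ≤ l.length + k) :
    ∃ (N : ℕ) (mem : ℕ → Memory), mem 0 = m ∧
      (∀ i < N, ∃ n ≤ D, Exec S H (mem i) n (mem (i + 1))) ∧
      (∀ i ≤ N, a.val (mem i) = 0 ↔ i = N) ∧ (∀ i ≤ N, memSpace (mem i) ≤ S) ∧
      (∀ y, y ∈ A ↔ y ∈ l ∨ ∃ i < N, outputWord (mem (i + 1)) = y) ∧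
      (∀ i < N, outputWord (mem (i + 1)) ∉ l) ∧
      (∀ i j, i < N → j < N → outputWord (mem (i + 1)) = outputWord (mem (j + 1)) → i = j) := by
  induction k generalizing l m with
  | zero =>
    -- When no word can be missing, a further fresh word would make `A` too large, so the flag is
    -- `0`.
    have ha : a.val m = 0 := by
      by_contra ha
      obtain ⟨y, hy, hyl, -⟩ := hnext l m h ha
      have h1 : (y :: l).toFinset.card = l.length + 1 := by
        rw [List.toFinset_card_of_nodup (List.nodup_cons.2 ⟨hyl, hl⟩), List.length_cons]
      have h2 : ((y :: l).toFinset : Set Word) ⊆ A := by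
        intro z hz
        rcases List.mem_cons.1 (List.mem_toFinset.1 (Finset.mem_coe.1 hz)) with rfl | hz
        · exact hy
        · exact hlA z hz
      have h3 := Set.ncard_le_ncard h2 hA
      rw [Set.ncard_coe_finset, h1] at h3
      omega
    exact ⟨0, fun _ => m, rfl, by simp, fun i hi => by simp [ha]; omega, fun _ _ => hS l m h,
      by simpa using hdone l m h ha, by simp, by simp⟩
  | succ k ih =>
    by_cases ha : a.val m = 0
    · exact ⟨0, fun _ => m, rfl, by simp, fun i hi => by simp [ha]; omega, fun _ _ => hS l m h,
        by simpa using hdone l m h ha, by simp, by simp⟩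
    · obtain ⟨y, hy, hyl, m', hm', hw, hJ⟩ := hnext l m h ha
      obtain ⟨N, mem, h0, h1, h2, h3, h4, h5, h6⟩ := ih (y :: l) m' hJ
        (List.nodup_cons.2 ⟨hyl, hl⟩) (List.forall_mem_cons.2 ⟨hy, hlA⟩) (by simp; omega)
      refine ⟨N + 1, fun i => Nat.casesOn i m mem, rfl, fun i hi => ?_, fun i hi => ?_,
        fun i hi => ?_, fun z => ?_, fun i hi => ?_, fun i j hi hj hij => ?_⟩
      · cases i with
        | zero => simpa [h0] using hm'
        | succ i => exact h1 i (by omega)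
      · cases i with
        | zero => simpa using ha
        | succ i => simpa using h2 i (by omega)
      · cases i with
        | zero => exact hS l m h
        | succ i => exact h3 i (by omega)
      · rw [h4, List.mem_cons, or_assoc, or_left_comm]
        refine or_congr_right ⟨?_, ?_⟩
        · rintro (rfl | ⟨i, hi, rfl⟩)
          · exact ⟨0, by omega, by simp only [h0]; exact hw⟩
          · exact ⟨i + 1, by omega, rfl⟩
        · rintro ⟨i, hi, rfl⟩
          cases i with
          | zero => exact Or.inl (by simp only [h0]; exact hw)
          | succ i => exact Or.inr ⟨i, by omega, rfl⟩
      · cases i with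
        | zero => simpa only [h0, hw] using hyl
        | succ i => exact fun hmem => h5 i (by omega) (List.mem_cons_of_mem _ hmem)
      · cases i with
        | zero =>
          cases j with
          | zero => rfl
          | succ j =>
            refine absurd ?_ (h5 j (by omega))
            simp only [h0, hw] at hij
            rw [← hij]
            exact List.mem_cons_self
        | succ i =>
          cases j with
          | zero =>
            refine absurd ?_ (h5 i (by omega))
            simp only [h0, hw] at hij
            rw [hij]
            exact List.mem_cons_self
          | succ j => rw [h6 i j (by omega) (by omega) hij]

/-! ### The simulation enumerates the solutions -/

namespace SimContext

variable {M : RAM} {ls : List M.Label} {x : Word} {K e Q s P S : ℕ} {A : Predicate}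

/-- The memory after a search, when the words in `l` have been produced or are in the output
registers. -/
def AfterSearch (M : RAM) (ls : List M.Label) (A : Predicate) (x : Word) (Q P : ℕ) (l : List Word)
    (o : ℕ → ℤ) (m : Memory) : Prop :=
  ∃ t : ℕ → ℕ, OutBound Q P o ∧ (∀ j < Q, t j ≤ zoneEnd Q j) ∧
    ((Rep (encode x) Q (regs (encode x) Q (0 : ℕ) (0 : ℕ) (0 : ℕ) 0 0 0 0 0 0 0)
        (simCells M ls (encode x) Q t) o m ∧ ∀ y, y ∈ A x ↔ y ∈ l) ∨
      ∃ j u, j < Q ∧ t j = u + 1 ∧ M.OutputsAt x u ∧ M.wordAt x u ∉ l ∧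
        Amortized (M.OutputsAt x) Q t ∧ (∀ y ∈ l, y ∈ A x) ∧
        (∀ s, WasFound (M.OutputsAt x) Q t s ↔
          M.OutputsAt x s ∧ (M.wordAt x s ∈ l ∨ s = u)) ∧
        Rep (encode x) Q (regs (encode x) Q (0 : ℕ) (0 : ℕ) (j + 1 : ℕ) 0 0 0 0 0 0 0)
          (simCells M ls (encode x) Q t) o m)

/-- This joins the program to the amortization argument: a failed search means that every output
time was found before, hence that `l` is complete, and a successful one yields an output time that
was not found before. -/
theorem exec_search_afterSearch (C : SimContext M ls K e (encode x) Q s P S) (hM : M.Solves A)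
    (hN : (A x).ncard ≤ 2 ^ (Q - 1))
    (hcount : ∀ k, min k (A x).ncard ≤
      @Nat.count (M.OutputsAt x) (Classical.decPred _) (k * Q))
    {o : ℕ → ℤ} (ho : OutBound Q P o) {t : ℕ → ℕ} (ha : Amortized (M.OutputsAt x) Q t)
    {l : List Word} (hl : ∀ y ∈ l, y ∈ A x)
    (hfound : ∀ s, WasFound (M.OutputsAt x) Q t s ↔ M.OutputsAt x s ∧ M.wordAt x s ∈ l)
    {x2 x3 x4 : ℤ} {m : Memory} (hx : ∀ z ∈ [x2, x3, x4, 0, 0], bits z ≤ P)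
    (h : Rep (encode x) Q (regs (encode x) Q x2 x3 x4 0 0 0 0 0 0 0)
      (simCells M ls (encode x) Q t) o m) :
    ∃ n ≤ searchTime (tick (labelNum M ls) M.prog ls).size Q, ∃ m',
      Exec S (searchProg M ls) m n m' ∧ AfterSearch M ls A x Q P l o m' := by
  classical
  obtain ⟨n, hn, m', e, ⟨t', hadv, hr⟩ | ⟨t', j, u, hf, hr⟩⟩ :=
    C.exec_search ho (fun j hj => (ha j hj).1) hx h
  · refine ⟨n, hn, m', e, t', ho, fun j hj => (hadv j hj).le_end, Or.inl ⟨hr, fun y => ⟨?_, hl y⟩⟩⟩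
    rw [hM.produces]
    rintro ⟨s, hs, rfl⟩
    refine ((hfound s).1 ((wasFound_iff_of_advance hadv s).1
      (wasFound_of_advance (N := (A x).ncard) C.pos hN (fun k => ?_) (fun k => ?_) ha hadv hs))).2
    · convert hcount k
    · convert hM.count_le x k
  · refine ⟨n, hn, m', e, t', ho, fun i hi => ((ha.found hf) i hi).1,
      Or.inr ⟨j, u, hf.lt, hf.pos, hf.isOutput, fun hul => ?_, ha.found hf, hl, fun s => ?_, hr⟩⟩
    · exact hf.not_wasFound ha ((hfound u).2 ⟨hf.isOutput, hul⟩)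
    · have hw : WasFound (M.OutputsAt x) Q t' s ↔ WasFound (M.OutputsAt x) Q t s ∨ s = u :=
        hf.wasFound_iff s
      rw [hw, hfound]
      constructor
      · rintro (⟨h1, h2⟩ | rfl)
        · exact ⟨h1, Or.inl h2⟩
        · exact ⟨hf.isOutput, Or.inr rfl⟩
      · rintro ⟨h1, h2 | h2⟩
        · exact Or.inl ⟨h1, h2⟩
        · exact Or.inr h2

/-- A process stops one step after its output; since that step leaves the memory alone, the word can
still be read. -/
theorem outputWord_conf_succ {u : ℕ} (hu : M.OutputsAt x u) :
    outputWord (M.conf (encode x) (u + 1)).mem = M.wordAt x u := by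
  obtain ⟨l, hl⟩ := hu
  rw [RAM.conf_succ, RAM.step_of_atOutput hl, RAM.wordAt]

theorem amortized_zero (O : ℕ → Prop) (Q : ℕ) : Amortized O Q fun _ => 0 := by
  classical
  intro j _
  refine ⟨Nat.zero_le _, Or.inr ?_⟩
  rw [Finset.sum_eq_zero fun i _ => by simp [numFound], mul_zero]

theorem memSpace_le_of_afterSearch (C : SimContext M ls K e (encode x) Q s P S) {l : List Word}
    {o : ℕ → ℤ} {m : Memory} (h : AfterSearch M ls A x Q P l o m) :
    memSpace m ≤ spaceBound (encode x).length Q P := by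
  have := C.le
  obtain ⟨t, ho, ht, ⟨hr, -⟩ | ⟨j, u, hj, -, -, -, -, -, -, hr⟩⟩ := h
  · exact C.memSpace_le_sim ho (by omega) (by omega) (by omega) ht hr
  · exact C.memSpace_le_sim ho (by omega) (by omega) (by omega) ht hr

theorem out_of_afterSearch {l : List Word} {o : ℕ → ℤ} {m : Memory}
    (h : AfterSearch M ls A x Q P l o m) (i : ℕ) : m (Bank.out, i) = o i := by
  obtain ⟨t, -, -, ⟨hr, -⟩ | ⟨j, u, -, -, -, -, -, -, -, hr⟩⟩ := h
  · exact hr.out i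
  · exact hr.out i

theorem exec_first (C : SimContext M ls K e (encode x) Q s P S) (hM : M.Solves A)
    (hN : (A x).ncard ≤ 2 ^ (Q - 1))
    (hcount : ∀ k, min k (A x).ncard ≤
      @Nat.count (M.OutputsAt x) (Classical.decPred _) (k * Q)) :
    ∃ n ≤ initTime (initVars K e).size (initCells M ls).size initCopy.size initNext.size
        initEnd.size (encode x).length Q + searchTime (tick (labelNum M ls) M.prog ls).size Q,
      ∃ m, Exec S (.seq (initProg M ls K e) (searchProg M ls)) (load (encode x)) n m ∧
        ∃ o, AfterSearch M ls A x Q P [] o m := by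
  have := C.le
  obtain ⟨n₁, hn₁, m₁, e₁, h₁⟩ := C.exec_init
  obtain ⟨n₂, hn₂, m₂, e₂, h₂⟩ := C.exec_search_afterSearch hM hN hcount (outBound_zero Q P)
    (amortized_zero _ Q) (l := []) (by simp) (fun s => by simp [WasFound]) (by
      simpa using (bits_natCast_le Q).trans (by omega)) h₁
  exact ⟨n₁ + n₂, Nat.add_le_add hn₁ hn₂, m₂, .seq e₁ e₂, _, h₂⟩

theorem exec_next (C : SimContext M ls K e (encode x) Q s P S) (hM : M.Solves A)
    (hN : (A x).ncard ≤ 2 ^ (Q - 1))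
    (hcount : ∀ k, min k (A x).ncard ≤
      @Nat.count (M.OutputsAt x) (Classical.decPred _) (k * Q))
    (hlen : ∀ y ∈ A x, y.length ≤ Q) {l : List Word} {o : ℕ → ℤ} {m : Memory}
    (h : AfterSearch M ls A x Q P l o m) (hm : (wVal 4).val m ≠ 0) :
    ∃ y ∈ A x, y ∉ l ∧ ∃ m', (∃ n ≤ copyTime Q +
        searchTime (tick (labelNum M ls) M.prog ls).size Q,
        Exec S (.seq copyProg (searchProg M ls)) m n m') ∧
      outputWord m' = y ∧ ∃ o', AfterSearch M ls A x Q P (y :: l) o' m' := by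
  have := C.le
  obtain ⟨t, ho, ht, ⟨hr, -⟩ | ⟨j, u, hj, htj, hu, hul, ha, hl, hfound, hr⟩⟩ := h
  · exact absurd (hr.val 4) hm
  · have hy : M.wordAt x u ∈ A x := (hM.produces x _).2 ⟨u, hu, rfl⟩
    have hw : outputWord (M.conf (encode x) (t j)).mem = M.wordAt x u := by
      rw [htj, outputWord_conf_succ hu]
    obtain ⟨n₁, hn₁, m₁, e₁, o', x3, hx3, ho', hr₁, hout⟩ := C.exec_copy ho ht hj
      (by rw [hw]; exact hlen _ hy) hr
    obtain ⟨n₂, hn₂, m₂, e₂, h₂⟩ := C.exec_search_afterSearch hM hN hcount ho' ha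
      (l := M.wordAt x u :: l) (List.forall_mem_cons.2 ⟨hy, hl⟩) (fun s => by
        rw [hfound, List.mem_cons]
        refine and_congr_right fun hs => ?_
        rw [or_comm]
        -- The machine never repeats a word, so words in the list and output times determine each
        -- other.
        refine or_congr_left ⟨fun h => by rw [h], fun h => hM.distinct x s u hs hu h⟩) (by
        simp only [List.forall_mem_cons]
        exact ⟨(bits_natCast_le _).trans (by omega), hx3, (bits_natCast_le _).trans (by omega),
          by simp, by simp, by simp⟩) hr₁
    refine ⟨M.wordAt x u, hy, hul, m₂, ⟨n₁ + n₂, Nat.add_le_add hn₁ hn₂, .seq e₁ e₂⟩, ?_, _, h₂⟩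
    rw [hout m₂ (out_of_afterSearch h₂), hw]

end SimContext

/-- An incremental linear machine that uses polynomial space can be turned into a machine with
polynomial delay that uses polynomial space. -/
theorem exists_polyDelay_of_incrementalLinear {A : Predicate} (hb : PolyBalanced A) {M : RAM}
    (hM : M.IncrementalLinear A) (hspace : M.PolySpace) :
    ∃ M' : RAM, M'.PolyDelay A ∧ M'.PolySpace := by
  obtain ⟨hsol, h, hh⟩ := hM
  obtain ⟨s, hs⟩ := hspace
  obtain ⟨r, hr⟩ := hb
  have := M.finite
  obtain ⟨ls, hls⟩ : ∃ ls : List M.Label, ∀ l, l ∈ ls := by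
    have := Fintype.ofFinite M.Label
    exact ⟨Finset.univ.toList, by simp⟩
  -- `Q` exceeds `h` so that the `k`-th output comes before step `k * Q`; `2 * r ≤ Q - 1` bounds the
  -- number of solutions by `2 ^ (Q - 1)`, and `r ≤ Q` bounds their lengths.
  obtain ⟨K, e, hKe⟩ := exists_eval_le (h + 2 * r + 2)
  let Q : Polynomial ℕ := Polynomial.C K * (Polynomial.X + 1) ^ e
  -- A process needs `s` for its configuration, the number of labels for its label, and `2 * Q` for
  -- each of counter and width. The last terms cover the length of the input, its letters and the
  -- other variables.
  let P : Polynomial ℕ := s + Polynomial.C ls.length + 4 * Q + (Polynomial.X + 1) + 3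
  let B : Polynomial ℕ := P * (12 + (Polynomial.X + 1) + Q + (Q + 1))
  -- The sum dominates the growth of every single block started within the space `B`.
  let S : Polynomial ℕ := ((simBlocks M ls K e).map fun p => p.growth.comp B).sum
  let T : Polynomial ℕ := 3 + (Q * ((2 + (2 * Q *
    (Polynomial.C (tick (labelNum M ls) M.prog ls).size + 1) + 1)) + 1) + 1)
  let D₀ : Polynomial ℕ := Polynomial.C (initVars K e).size +
    ((Q * ((Polynomial.C (initCells M ls).size + (((Polynomial.X + 1) *
      (Polynomial.C initCopy.size + 1) + 1) + Polynomial.C initNext.size)) + 1) + 1) +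
        Polynomial.C initEnd.size)
  let D₁ : Polynomial ℕ := Polynomial.C copyInit.size +
    (Q * (Polynomial.C copyStep.size + 1) + 1)
  refine exists_polyDelay_polySpace (.seq (initProg M ls K e) (searchProg M ls))
    (.seq copyProg (searchProg M ls)) (wVal 4) (D₀ + D₁ + T) S fun x => ?_
  have hrx := hr x
  have hhx := hh x
  obtain ⟨n, hn⟩ : ∃ n, n = x.length := ⟨_, rfl⟩
  have hsx := hs x
  rw [← hn] at hrx hhx hsx ⊢
  have hlen : (encode x).length = n + 1 := by simp [encode, hn]
  have hQ : Q.eval n = K * (n + 1) ^ e := by simp [Q]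
  have hP : P.eval n = s.eval n + ls.length + 4 * Q.eval n + (n + 1) + 3 := by simp [P]
  have hB : B.eval n = spaceBound (encode x).length (Q.eval n) (P.eval n) := by
    simp [B, spaceBound, hlen]
  have hT : T.eval n = SimContext.searchTime (tick (labelNum M ls) M.prog ls).size (Q.eval n) := by
    simp [T, SimContext.searchTime]
  have hD₀ : D₀.eval n = SimContext.initTime (initVars K e).size (initCells M ls).size
      initCopy.size initNext.size initEnd.size (encode x).length (Q.eval n) := by
    simp [D₀, SimContext.initTime, hlen]
  have hD₁ : D₁.eval n = SimContext.copyTime (Q.eval n) := by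
    simp [D₁, SimContext.copyTime]
  have hle : h.eval n + 2 * r.eval n + 2 ≤ Q.eval n := by
    rw [hQ]
    simpa using hKe n
  have C : SimContext M ls K e (encode x) (Q.eval n) (s.eval n) (P.eval n) (S.eval n) := by
    refine ⟨by rw [hlen, hQ], by omega, by simp [encode], hls, hsx, ?_, by omega, ?_⟩
    · intro z hz
      rcases List.mem_cons.1 hz with rfl | hz
      · exact (bits_natCast_le _).trans (by omega)
      · obtain ⟨a, -, rfl⟩ := List.mem_map.1 hz
        exact (bits_natCast_le _).trans (by omega)
    · intro p hp
      rw [← hB, ← Polynomial.eval_comp]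
      simp only [S, Polynomial.eval_listSum, List.map_map]
      exact List.le_sum_of_mem (List.mem_map.2 ⟨p, hp, rfl⟩)
  have hN : (A x).ncard ≤ 2 ^ (Q.eval n - 1) :=
    (ncard_le_of_length_le hrx).trans (Nat.pow_le_pow_right (by norm_num) (by omega))
  have hcount : ∀ k, min k (A x).ncard ≤
      @Nat.count (M.OutputsAt x) (Classical.decPred _) (k * Q.eval n) :=
    hsol.le_count hhx (by omega)
  obtain ⟨n₀, hn₀, m₀, e₀, h₀⟩ := C.exec_first hsol hN hcount
  obtain ⟨N, mem, hm0, h1, h2, h3, h4, -, h6⟩ := exists_sequence (hsol.finite x)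
    (D := (D₀ + D₁ + T).eval n) (S := S.eval n) (H := .seq copyProg (searchProg M ls))
    (a := wVal 4) (fun l m => ∃ o, SimContext.AfterSearch M ls A x (Q.eval n) (P.eval n) l o m)
    (fun l m ⟨o, hJ⟩ => (C.memSpace_le_of_afterSearch hJ).trans C.spaceBound_le)
    (fun l m ⟨o, t, _, _, hJ⟩ hm => by
      rcases hJ with ⟨-, hJ⟩ | ⟨j, u, -, -, -, -, -, -, -, hr⟩
      · exact hJ
      · have : ((j + 1 : ℕ) : ℤ) = 0 := (hr.val 4).symm.trans hm
        omega)
    (fun l m ⟨o, hJ⟩ hm => by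
      obtain ⟨y, hy, hyl, m', ⟨n', hn', e'⟩, hw, hJ'⟩ := C.exec_next hsol hN hcount
        (fun y hy => (hrx y hy).trans (by omega)) hJ hm
      exact ⟨y, hy, hyl, m', ⟨n', by simp only [Polynomial.eval_add]; omega, e'⟩, hw, hJ'⟩)
    (A x).ncard [] m₀ h₀ List.nodup_nil (by simp) (by simp)
  refine ⟨N, mem, ⟨n₀, by simp only [Polynomial.eval_add]; omega, by rwa [hm0]⟩, h1, h2, h3,
    fun y => by simpa using h4 y, h6⟩

end EnumRAM

end

/-- Indices `a < b ≤ k` start from `a = 0` (the start of the run), and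
`k < q(|x|) * (b - a)` says that `b - a > k / q(|x|)`. -/
theorem mainTheorem5 (A : EnumRAM.Predicate) (hA : A ∈ EnumRAM.IncP1)
    (I : EnumRAM.RAM) (hI : I.IncrementalLinear A) (hspace : I.PolySpace)
    (p q : Polynomial ℕ)
    (hgap : ∀ (x : EnumRAM.Word) (k : ℕ), 1 ≤ k → k ≤ (A x).ncard →
      ∃ a b : ℕ, a < b ∧ b ≤ k ∧ k < q.eval x.length * (b - a) ∧
        ∀ i, a ≤ i → i < b → ¬ I.IsGap p x i) :
    A ∈ EnumRAM.DelayPPolySpace :=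
  ⟨hA.1, EnumRAM.exists_polyDelay_of_incrementalLinear hA.1.2 hI hspace⟩
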